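/- For a number field $K$ let $D=D_K$ be the absolute value of its discriminant, let $I_K(x)$ be the number of nonzero ideals of the ring of integers $\mathcal O_K$ of norm at most $x$, and let $$c=c_K=\frac{2^{r_1}(2\pi)^{r_2}hR}{w\sqrt{D}}$$ be the residue at $s=1$ of the Dedekind zeta function $\zeta_K(s)$, where $r_1$ is the number of real embeddings, $r_2$ the number of pairs of complex embeddings, $h$ the class number, $R$ the regulator and $w$ the number of roots of unity of $K$. Theorem. Let $n$ be a natural number. For every $\varepsilon>0$, $$I_K(x)=c\,x+O\!\left(x^{1-\frac{2}{n+2}+\varepsilon}D^{\frac{1}{n+2}+\varepsilon}\right)$$ uniformly over all number fields $K$ with $[K:\mathbf Q]\le n$ and all real $x>0$ with $x^{2n}>D^{n+4}$. That is, there is a constant $C$ depending only on $n$ and $\varepsilon$ such that for all such $K$ and $x$ $$\left|I_K(x)-c\,x\right|\le C\,x^{1-\frac{2}{n+2}+\varepsilon}D^{\frac{1}{n+2}+\varepsilon}.$$ -/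

import Mathlib

open scoped nonZeroDivisors NumberField

/-- `I_K(x)`: the number of nonzero ideals of the ring of integers of `K` whose absolute norm is
at most `x`. -/
noncomputable def idealCount (K : Type*) [Field K] [NumberField K] (x : ℝ) : ℕ :=
  Nat.card {I : (Ideal (𝓞 K))⁰ // (Ideal.absNorm (I : Ideal (𝓞 K)) : ℝ) ≤ x}

/-- `D`: the absolute value of the discriminant of `K`, as a real number. -/
noncomputable def absDiscr (K : Type*) [Field K] [NumberField K] : ℝ :=
  |(NumberField.discr K : ℝ)|

open MeasureTheory Set in
/-- The half-open unit cubes with integral corners tile space. -/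
theorem iUnion_int_cube_eq_univ {ι : Type*} :
    (⋃ c : ι → ℤ, {x : ι → ℝ | ∀ i, x i ∈ Ioc (c i : ℝ) (c i + 1)}) = univ := by
  refine eq_univ_of_forall fun x => mem_iUnion.2 ⟨fun i => ⌈x i⌉ - 1, fun i => ?_⟩
  have h1 := Int.ceil_lt_add_one (x i)
  have h2 := Int.le_ceil (x i)
  constructor <;> push_cast <;> linarith

open Set in
theorem pairwise_disjoint_int_cube {ι : Type*} :
    Pairwise (Function.onFun Disjoint
      fun c : ι → ℤ => {x : ι → ℝ | ∀ i, x i ∈ Ioc (c i : ℝ) (c i + 1)}) := by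
  intro c c' hne
  refine Set.disjoint_left.2 fun x hx hx' => hne (funext fun i => ?_)
  have h1 := hx i
  have h2 := hx' i
  have h3 : (c i : ℝ) < c' i + 1 := h1.1.trans_le h2.2
  have h4 : (c' i : ℝ) < c i + 1 := h2.1.trans_le h1.2
  have h5 : c i < c' i + 1 := by exact_mod_cast h3
  have h6 : c' i < c i + 1 := by exact_mod_cast h4
  omega

/-- The character `x ↦ e(-m·x)` of `ℝ^ι`. -/
noncomputable def latticeChar {ι : Type*} [Fintype ι] (m : ι → ℤ) (x : ι → ℝ) : ℂ :=
  Complex.exp (-(2 * Real.pi * (∑ i, (m i : ℝ) * x i : ℝ)) * Complex.I)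

theorem continuous_latticeChar {ι : Type*} [Fintype ι] (m : ι → ℤ) :
    Continuous (latticeChar m) := by
  unfold latticeChar
  fun_prop

theorem latticeChar_add_int {ι : Type*} [Fintype ι] (m c : ι → ℤ) (x : ι → ℝ) :
    latticeChar m (fun i => x i + c i) = latticeChar m x := by
  unfold latticeChar
  rw [Complex.exp_eq_exp_iff_exists_int]
  refine ⟨-∑ i, m i * c i, ?_⟩
  push_cast
  simp only [mul_add, Finset.sum_add_distrib]
  ring

theorem mFourier_neg_eq_latticeChar {ι : Type*} [Fintype ι] (m : ι → ℤ) (x : ι → ℝ) :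
    UnitAddTorus.mFourier (-m) (fun i => (x i : UnitAddCircle)) = latticeChar m x := by
  simp only [UnitAddTorus.mFourier, latticeChar, ContinuousMap.coe_mk, fourier_coe_apply,
    Pi.neg_apply]
  rw [← Complex.exp_sum]
  congr 1
  push_cast
  rw [Finset.mul_sum, neg_mul, Finset.sum_mul, ← Finset.sum_neg_distrib]
  refine Finset.sum_congr rfl fun i _ => ?_
  simp
  ring

theorem finite_int_translates_meeting {ι : Type*} [Fintype ι] {s t : Set (ι → ℝ)}
    (hs : Bornology.IsBounded s) (ht : Bornology.IsBounded t) :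
    {c : ι → ℤ | ∃ x ∈ s, (fun i => x i + c i) ∈ t}.Finite := by
  classical
  obtain ⟨R, hR⟩ := hs.exists_norm_le
  obtain ⟨R', hR'⟩ := ht.exists_norm_le
  refine (Set.finite_Icc (fun _ : ι => -⌈R + R'⌉) (fun _ => ⌈R + R'⌉)).subset ?_
  rintro c ⟨x, hx, hxc⟩
  have key : ∀ i, |(c i : ℝ)| ≤ R + R' := fun i => by
    have h1 : |x i| ≤ R := (norm_le_pi_norm x i).trans (hR x hx)
    have h2 : |x i + c i| ≤ R' := (norm_le_pi_norm (fun i => x i + (c i : ℝ)) i).trans (hR' _ hxc)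
    rw [abs_le] at *
    constructor <;> linarith
  constructor <;> intro i <;> have h1 := abs_le.1 (key i) <;> have h2 := Int.le_ceil (R + R')
  · have : (-⌈R + R'⌉ : ℝ) ≤ c i := by linarith
    exact_mod_cast this
  · have : (c i : ℝ) ≤ ⌈R + R'⌉ := by linarith
    exact_mod_cast this

section Poisson

open MeasureTheory Set

variable {ι : Type*} [Fintype ι] {f : (ι → ℝ) → ℂ}

/-- The sum of the integral translates of a function. -/
noncomputable def periodization (f : (ι → ℝ) → ℂ) (x : ι → ℝ) : ℂ :=
  ∑ᶠ c : ι → ℤ, f (fun i => x i + c i)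

theorem finite_support_translates (hs : HasCompactSupport f) (x : ι → ℝ) :
    (Function.support fun c : ι → ℤ => f (fun i => x i + c i)).Finite := by
  refine (finite_int_translates_meeting (Bornology.isBounded_singleton (x := x))
    hs.isCompact.isBounded).subset fun c hc => ⟨x, rfl, subset_tsupport f hc⟩

theorem continuous_periodization (hc : Continuous f) (hs : HasCompactSupport f) :
    Continuous (periodization f) := by
  refine continuous_finsum (fun c => by fun_prop) fun x => ?_
  refine ⟨Metric.ball x 1, Metric.ball_mem_nhds x one_pos, ?_⟩
  refine (finite_int_translates_meeting (Metric.isBounded_ball (x := x) (r := 1))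
    hs.isCompact.isBounded).subset ?_
  rintro c ⟨y, hy, hy'⟩
  exact ⟨y, hy', subset_tsupport f hy⟩

omit [Fintype ι] in
theorem periodization_add_int (f : (ι → ℝ) → ℂ) (x : ι → ℝ) (d : ι → ℤ) :
    periodization f (fun i => x i + d i) = periodization f x := by
  unfold periodization
  rw [← finsum_comp_equiv (Equiv.addLeft d) (f := fun c : ι → ℤ => f fun i => x i + c i)]
  refine finsum_congr fun c => ?_
  congr 1
  ext i
  simp [add_assoc]

theorem exists_continuousMap_torus (hc : Continuous f) (hs : HasCompactSupport f) :
    ∃ F : C(UnitAddTorus ι, ℂ), ∀ x : ι → ℝ,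
      F (fun i => (x i : UnitAddCircle)) = periodization f x := by
  have hq : IsOpenQuotientMap (Pi.map fun (_ : ι) (y : ℝ) => (y : UnitAddCircle)) :=
    IsOpenQuotientMap.piMap fun _ => QuotientAddGroup.isOpenQuotientMap_mk
  let g : C(ι → ℝ, ℂ) := ⟨periodization f, continuous_periodization hc hs⟩
  let q : C(ι → ℝ, UnitAddTorus ι) := ⟨_, hq.continuous⟩
  have hq' : Topology.IsQuotientMap q := hq.isQuotientMap
  have hfac : Function.FactorsThrough g q := by
    intro x y hxy
    have : ∀ i, ∃ n : ℤ, y i = x i + n := fun i => by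
      have h : ((y i - x i : ℝ) : UnitAddCircle) = 0 := by
        have h' : ((x i : ℝ) : UnitAddCircle) = (y i : ℝ) := congrFun hxy i
        rw [AddCircle.coe_sub, h', sub_self]
      obtain ⟨n, hn⟩ := (AddCircle.coe_eq_zero_iff (1 : ℝ)).1 h
      exact ⟨n, by simp at hn; linarith⟩
    choose n hn using this
    have : y = fun i => x i + n i := funext hn
    change periodization f x = periodization f y
    rw [this, periodization_add_int]
  exact ⟨hq'.lift g hfac, fun x => DFunLike.congr_fun (hq'.lift_comp g hfac) x⟩

theorem integrable_latticeChar_mul (hc : Continuous f) (hs : HasCompactSupport f) (m : ι → ℤ) :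
    Integrable fun x => latticeChar m x * f x :=
  ((continuous_latticeChar m).mul hc).integrable_of_hasCompactSupport hs.mul_left

theorem measurableSet_int_cube (c : ι → ℤ) :
    MeasurableSet {x : ι → ℝ | ∀ i, x i ∈ Ioc (c i : ℝ) (c i + 1)} := by
  have : {x : ι → ℝ | ∀ i, x i ∈ Ioc (c i : ℝ) (c i + 1)} =
      univ.pi fun i => Ioc (c i : ℝ) (c i + 1) := by ext; simp
  rw [this]
  exact MeasurableSet.univ_pi fun _ => measurableSet_Ioc

theorem setIntegral_int_cube (c : ι → ℤ) (h : (ι → ℝ) → ℂ) :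
    ∫ x in {x : ι → ℝ | ∀ i, x i ∈ Ioc (c i : ℝ) (c i + 1)}, h x =
      ∫ x in {x : ι → ℝ | ∀ i, x i ∈ Ioc (0 : ℝ) (0 + 1)}, h (fun i => x i + c i) := by
  have hmp := measurePreserving_add_right (volume : Measure (ι → ℝ)) (fun i => (c i : ℝ))
  rw [← hmp.setIntegral_preimage_emb (measurableEmbedding_addRight _)]
  have : ((fun x : ι → ℝ => x + fun i => (c i : ℝ)) ⁻¹'
      {x : ι → ℝ | ∀ i, x i ∈ Ioc (c i : ℝ) (c i + 1)}) =
      {x : ι → ℝ | ∀ i, x i ∈ Ioc (0 : ℝ) (0 + 1)} := by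
    ext x
    refine forall_congr' fun i => ?_
    simp only [Pi.add_apply, mem_Ioc]
    constructor <;> rintro ⟨h1, h2⟩ <;> constructor <;> linarith
  rw [this]
  rfl

theorem setIntegral_periodization (hc : Continuous f) (hs : HasCompactSupport f) (m : ι → ℤ) :
    ∫ x in {x : ι → ℝ | ∀ i, x i ∈ Ioc (0 : ℝ) (0 + 1)}, latticeChar m x * periodization f x =
      ∫ x, latticeChar m x * f x := by
  set Q : Set (ι → ℝ) := {x | ∀ i, x i ∈ Ioc (0 : ℝ) (0 + 1)} with hQ
  have hQm : MeasurableSet Q := by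
    simpa only [Pi.zero_apply, Int.cast_zero] using measurableSet_int_cube (ι := ι) 0
  have hQb : Bornology.IsBounded Q := by
    refine (Metric.isBounded_Icc (0 : ι → ℝ) 1).subset fun x hx => ⟨fun i => (hx i).1.le, fun i => ?_⟩
    simpa using (hx i).2
  have hfin := finite_int_translates_meeting hQb hs.isCompact.isBounded
  have hint := integrable_latticeChar_mul hc hs m
  have h1 : ∀ x ∈ Q, latticeChar m x * periodization f x =
      ∑ c ∈ hfin.toFinset, latticeChar m (fun i => x i + c i) * f (fun i => x i + c i) := by
    intro x hx
    rw [periodization, finsum_eq_sum_of_support_subset (s := hfin.toFinset), Finset.mul_sum]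
    · simp_rw [latticeChar_add_int]
    · intro c hc'
      rw [Finite.coe_toFinset]
      exact ⟨x, hx, subset_tsupport f hc'⟩
  rw [setIntegral_congr_fun hQm h1, integral_finsetSum]
  swap
  · intro c _
    exact (hint.comp_add_right (fun i => (c i : ℝ))).integrableOn
  have h2 := hasSum_integral_iUnion (fun c => measurableSet_int_cube (ι := ι) c)
    pairwise_disjoint_int_cube (hint.integrableOn (s := ⋃ c : ι → ℤ,
      {x : ι → ℝ | ∀ i, x i ∈ Ioc (c i : ℝ) (c i + 1)}))
  rw [iUnion_int_cube_eq_univ, setIntegral_univ] at h2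
  simp_rw [setIntegral_int_cube] at h2
  rw [← h2.tsum_eq, tsum_eq_sum]
  intro c hc'
  rw [setIntegral_congr_fun hQm (g := fun _ => 0), integral_zero]
  intro x hx
  have : f (fun i => x i + c i) = 0 := by
    by_contra h
    exact hc' (by simpa using ⟨x, hx, subset_tsupport f h⟩)
  simp [this]

/-- **Poisson summation** over `ℤ^ι` for continuous functions with compact support. -/
theorem hasSum_latticeChar_integral (hc : Continuous f) (hs : HasCompactSupport f)
    (hsum : Summable fun m : ι → ℤ => ∫ x, latticeChar m x * f x) :
    HasSum (fun m : ι → ℤ => ∫ x, latticeChar m x * f x) (∑ᶠ c : ι → ℤ, f fun i => c i) := by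
  obtain ⟨F, hF⟩ := exists_continuousMap_torus hc hs
  have hcoef : ∀ m, UnitAddTorus.mFourierCoeff F m = ∫ x, latticeChar m x * f x := by
    intro m
    rw [UnitAddTorus.mFourierCoeff_eq_integral F m 0, ← setIntegral_periodization hc hs m]
    simp only [mFourier_neg_eq_latticeChar, hF, smul_eq_mul, Pi.zero_apply]
  have h := UnitAddTorus.hasSum_mFourier_series_apply_of_summable (f := F)
    ((funext hcoef : UnitAddTorus.mFourierCoeff F = _) ▸ hsum) (fun _ => ((0 : ℝ) : UnitAddCircle))
  rw [hF] at h
  convert h using 1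
  · ext m
    have := mFourier_neg_eq_latticeChar (-m) 0
    simp only [neg_neg, Pi.zero_apply] at this
    rw [this, hcoef]
    simp [latticeChar]
  · simp [periodization]

end Poisson

section SchwartzFourier

open MeasureTheory SchwartzMap Module
open scoped FourierTransform LineDeriv

variable {V : Type*} [NormedAddCommGroup V] [InnerProductSpace ℝ V] [FiniteDimensional ℝ V]

/-- The sum of `k`-th powers of the squared coordinates controls the `2k`-th power of the norm. -/
theorem norm_pow_le_sum_inner_pow (w : V) (k : ℕ) :
    ‖w‖ ^ (2 * k) ≤ (finrank ℝ V : ℝ) ^ k *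
      ∑ i, (inner ℝ w (stdOrthonormalBasis ℝ V i)) ^ (2 * k) + (if k = 0 then 1 else 0) := by
  rcases k with _ | k
  · simp
  · have h1 : ‖w‖ ^ 2 = ∑ i, (inner ℝ w (stdOrthonormalBasis ℝ V i)) ^ 2 := by
      rw [← (stdOrthonormalBasis ℝ V).sum_sq_norm_inner_left w]
      simp
    rcases Nat.eq_zero_or_pos (finrank ℝ V) with h0 | h0
    · have : Subsingleton V := finrank_zero_iff.1 h0
      simp [Subsingleton.elim w 0, h0]
    have h2 := pow_sum_div_card_le_sum_pow (s := Finset.univ)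
      (f := fun i => (inner ℝ w (stdOrthonormalBasis ℝ V i)) ^ 2) (fun _ _ => sq_nonneg _) k
    rw [Finset.card_univ, Fintype.card_fin, div_le_iff₀ (by positivity), ← h1, mul_comm] at h2
    simp_rw [← pow_mul] at h2
    simp only [Nat.succ_ne_zero, if_false, add_zero]
    refine h2.trans (mul_le_mul_of_nonneg_right ?_ (Finset.sum_nonneg fun i _ =>
      (even_two_mul _).pow_nonneg _))
    exact pow_le_pow_right₀ (by exact_mod_cast h0) (Nat.le_succ k)

variable [MeasurableSpace V] [BorelSpace V]

theorem SchwartzMap.fourier_iteratedLineDerivOp_const (f : 𝓢(V, ℂ)) (m : V) (k : ℕ) (w : V) :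
    𝓕 (∂^{fun _ : Fin k => m} f) w = (2 * Real.pi * Complex.I * inner ℝ w m) ^ k * 𝓕 f w := by
  induction k with
  | zero => simp
  | succ k ih =>
    have hm : (inner ℝ · m : V → ℝ).HasTemperateGrowth := ((innerSL ℝ).flip m).hasTemperateGrowth
    rw [LineDeriv.iteratedLineDerivOp_succ_left, fourier_lineDerivOp_eq]
    simp only [smul_apply, smulLeftCLM_apply_apply hm]
    have : 𝓕 (∂^{Fin.tail fun _ : Fin (k + 1) => m} f) w = _ := ih
    rw [this]
    simp only [smul_eq_mul, Complex.real_smul]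
    ring

theorem SchwartzMap.integrable_norm_pow_mul_norm_sq (f : 𝓢(V, ℂ)) (k : ℕ) :
    Integrable fun w => ‖w‖ ^ k * ‖f w‖ ^ 2 := by
  obtain ⟨C, -, hC⟩ := f.decay 0 0
  have h := (f.integrable_pow_mul volume k).mul_const C
  refine h.mono' ?_ ?_
  · exact (by fun_prop : Continuous fun w => ‖w‖ ^ k * ‖f w‖ ^ 2).aestronglyMeasurable
  · filter_upwards with w
    have h1 : ‖f w‖ ≤ C := by simpa using hC w
    rw [Real.norm_of_nonneg (by positivity), sq, ← mul_assoc]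
    exact mul_le_mul_of_nonneg_left h1 (by positivity)

theorem SchwartzMap.integral_norm_pow_mul_fourier_sq_le (f : 𝓢(V, ℂ)) (k : ℕ) {M R : ℝ}
    (hR : ∀ p, R < ‖p‖ → f p = 0) (hM0 : ∀ p, ‖f p‖ ≤ M)
    (hM : ∀ p, ‖iteratedFDeriv ℝ k f p‖ ≤ M) :
    ∫ w, ‖w‖ ^ (2 * k) * ‖𝓕 f w‖ ^ 2 ≤
      ((finrank ℝ V : ℝ) ^ (k + 1) + 1) * (M ^ 2 * volume.real (Metric.closedBall (0 : V) R)) := by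
  set e := stdOrthonormalBasis ℝ V
  have hM' : 0 ≤ M := (norm_nonneg _).trans (hM 0)
  have bd : ∀ g : 𝓢(V, ℂ), (∀ p, R < ‖p‖ → g p = 0) → (∀ p, ‖g p‖ ≤ M) →
      ∫ w, ‖𝓕 g w‖ ^ 2 ≤ M ^ 2 * volume.real (Metric.closedBall (0 : V) R) := by
    intro g hg hgM
    rw [integral_norm_sq_fourier]
    rw [← setIntegral_eq_integral_of_forall_compl_eq_zero (s := Metric.closedBall (0 : V) R)]
    · have := norm_setIntegral_le_of_norm_le_const (μ := volume) (s := Metric.closedBall (0 : V) R)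
        (f := fun p => ‖g p‖ ^ 2) (C := M ^ 2) measure_closedBall_lt_top (fun p _ => by
          rw [norm_pow, norm_norm]; exact pow_le_pow_left₀ (norm_nonneg _) (hgM p) 2)
      exact (le_abs_self _).trans this
    · intro p hp
      rw [hg p (by simpa using hp)]
      simp
  have hder : ∀ i, (∀ p, R < ‖p‖ → (∂^{fun _ : Fin k => e i} f) p = 0) ∧
      ∀ p, ‖(∂^{fun _ : Fin k => e i} f) p‖ ≤ M := by
    refine fun i => ⟨fun p hp => ?_, fun p => ?_⟩
    · have hts : tsupport f ⊆ Metric.closedBall 0 R := by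
        refine closure_minimal (fun q hq => ?_) Metric.isClosed_closedBall
        by_contra h
        exact hq (hR q (by simpa using h))
      by_contra h
      have := hts (tsupport_iteratedLineDerivOp_subset (fun _ : Fin k => e i) f
        (subset_tsupport _ h))
      simp at this
      linarith
    · rw [iteratedLineDerivOp_eq_iteratedFDeriv]
      refine (ContinuousMultilinearMap.le_opNorm _ _).trans ?_
      simpa using hM p
  have hint : ∀ g : 𝓢(V, ℂ), Integrable fun w => ‖𝓕 g w‖ ^ 2 := fun g => by
    have h := (𝓕 g).integrable_norm_pow_mul_norm_sq 0
    simp only [pow_zero, one_mul] at h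
    exact h
  have hle : ∀ w, ‖w‖ ^ (2 * k) * ‖𝓕 f w‖ ^ 2 ≤
      (finrank ℝ V : ℝ) ^ k * ∑ i, ‖𝓕 (∂^{fun _ : Fin k => e i} f) w‖ ^ 2 + ‖𝓕 f w‖ ^ 2 := by
    intro w
    refine (mul_le_mul_of_nonneg_right (norm_pow_le_sum_inner_pow w k) (sq_nonneg _)).trans ?_
    rw [add_mul, mul_assoc, Finset.sum_mul]
    refine add_le_add (mul_le_mul_of_nonneg_left (Finset.sum_le_sum fun i _ => ?_)
      (by positivity)) ?_
    · rw [fourier_iteratedLineDerivOp_const, norm_mul, mul_pow]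
      refine mul_le_mul_of_nonneg_right ?_ (sq_nonneg _)
      simp only [norm_pow, norm_mul, Complex.norm_real, Complex.norm_I, mul_one,
        Complex.norm_ofNat, Real.norm_eq_abs, abs_of_pos Real.pi_pos]
      rw [← (even_two_mul k).pow_abs, pow_mul']
      refine pow_le_pow_left₀ (by positivity) (pow_le_pow_left₀ (abs_nonneg _) ?_ k) 2
      change |inner ℝ w (e i)| ≤ _
      exact le_mul_of_one_le_left (abs_nonneg _) (by nlinarith [Real.pi_gt_three])
    · split_ifs <;> simp
  refine (integral_mono ((𝓕 f).integrable_norm_pow_mul_norm_sq _)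
    (((integrable_finsetSum _ fun i _ => hint _).const_mul _).add (hint f)) hle).trans ?_
  rw [integral_add' ((integrable_finsetSum _ fun i _ => hint _).const_mul _) (hint f),
    integral_const_mul, integral_finsetSum _ fun i _ => hint _]
  have h1 : ∑ i, ∫ w, ‖𝓕 (∂^{fun _ : Fin k => e i} f) w‖ ^ 2 ≤
      finrank ℝ V * (M ^ 2 * volume.real (Metric.closedBall (0 : V) R)) := by
    refine (Finset.sum_le_sum fun i _ => bd _ (hder i).1 (hder i).2).trans ?_
    simp
  have h2 := bd f hR hM0
  calc _ ≤ (finrank ℝ V : ℝ) ^ k * (finrank ℝ V * (M ^ 2 * volume.real (Metric.closedBall (0 : V) R)))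
      + M ^ 2 * volume.real (Metric.closedBall (0 : V) R) := by gcongr
    _ = _ := by ring

end SchwartzFourier

section SmoothBounds

open scoped ContDiff

variable {V : Type*} [NormedAddCommGroup V]

/-- A radial bump function supported in an annulus. -/
noncomputable def annularBump (p : V) : ℝ :=
  (⟨1 / 2, 1, by norm_num, by norm_num⟩ : ContDiffBump (2 : ℝ)) (‖p‖ ^ 2)

/-- A smooth function with compact support equal to `log ‖p‖` on the support of `annularBump`. -/
noncomputable def truncLog (p : V) : ℝ :=
  (⟨1, 3 / 2, by norm_num, by norm_num⟩ : ContDiffBump (2 : ℝ)) (‖p‖ ^ 2) *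
    Real.log (‖p‖ ^ 2) / 2

/-- The product of `annularBump` with the character `‖p‖ ^ (iθ)`. -/
noncomputable def twistedBump (θ : ℝ) (p : V) : ℂ :=
  annularBump p * Complex.exp (Complex.I * (θ * truncLog p : ℝ))

theorem annularBump_nonneg (p : V) : 0 ≤ annularBump p := ContDiffBump.nonneg _

theorem annularBump_le_one (p : V) : annularBump p ≤ 1 := ContDiffBump.le_one _

theorem annularBump_eq_of_norm_eq {W : Type*} [NormedAddCommGroup W]
    {p : V} {q : W} (h : ‖p‖ = ‖q‖) : annularBump p = annularBump q := by
  simp [annularBump, h]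

theorem norm_mem_of_annularBump_ne_zero {p : V} (h : annularBump p ≠ 0) :
    1 < ‖p‖ ^ 2 ∧ ‖p‖ ^ 2 < 3 := by
  have h1 : ‖p‖ ^ 2 ∈ Metric.ball (2 : ℝ) 1 := by
    rw [← ContDiffBump.support_eq (⟨1 / 2, 1, by norm_num, by norm_num⟩ : ContDiffBump (2 : ℝ))]
    exact h
  rw [Metric.mem_ball, Real.dist_eq, abs_lt] at h1
  constructor <;> linarith

theorem one_lt_norm_of_annularBump_ne_zero {p : V} (h : annularBump p ≠ 0) : 1 < ‖p‖ := by
  nlinarith [norm_mem_of_annularBump_ne_zero h, norm_nonneg p]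

theorem norm_lt_two_of_annularBump_ne_zero {p : V} (h : annularBump p ≠ 0) : ‖p‖ < 2 := by
  nlinarith [norm_mem_of_annularBump_ne_zero h, norm_nonneg p]

theorem annularBump_eq_one {p : V} (h : 3 / 2 ≤ ‖p‖ ^ 2) (h' : ‖p‖ ^ 2 ≤ 5 / 2) :
    annularBump p = 1 := by
  refine ContDiffBump.one_of_mem_closedBall _ ?_
  rw [Metric.mem_closedBall, Real.dist_eq, abs_le]
  constructor <;> simp only <;> linarith

theorem truncLog_eq_log {p : V} (h : annularBump p ≠ 0) : truncLog p = Real.log ‖p‖ := by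
  have h1 := norm_mem_of_annularBump_ne_zero h
  rw [truncLog, ContDiffBump.one_of_mem_closedBall, Real.log_pow]
  · push_cast; ring
  · rw [Metric.mem_closedBall, Real.dist_eq, abs_le]
    constructor <;> simp only <;> linarith

variable [InnerProductSpace ℝ V]

theorem contDiff_annularBump : ContDiff ℝ ∞ (annularBump : V → ℝ) := by
  unfold annularBump
  exact (ContDiffBump.contDiff _).comp (contDiff_norm_sq ℝ)

theorem contDiff_truncLog : ContDiff ℝ ∞ (truncLog : V → ℝ) := by
  have h : ContDiff ℝ ∞ fun u : ℝ =>
      (⟨1, 3 / 2, by norm_num, by norm_num⟩ : ContDiffBump (2 : ℝ)) u * Real.log u := by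
    rw [contDiff_iff_contDiffAt]
    intro u
    by_cases hu : u = 0
    · subst hu
      refine (contDiffAt_const (c := (0 : ℝ))).congr_of_eventuallyEq ?_
      filter_upwards [Metric.ball_mem_nhds (0 : ℝ) (ε := 1 / 2) (by norm_num)] with v hv
      rw [ContDiffBump.zero_of_le_dist, zero_mul]
      rw [Metric.mem_ball, Real.dist_eq, abs_lt] at hv
      rw [Real.dist_eq, abs_of_nonpos (by linarith)]
      simp only
      linarith
    · exact (ContDiffBump.contDiffAt _).mul (Real.contDiffAt_log.2 hu)
  exact (h.comp (contDiff_norm_sq ℝ)).div_const 2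

theorem contDiff_twistedBump (θ : ℝ) : ContDiff ℝ ∞ (twistedBump θ : V → ℂ) := by
  unfold twistedBump
  refine (Complex.ofRealCLM.contDiff.comp contDiff_annularBump).mul (Complex.contDiff_exp.comp
    (contDiff_const.mul (Complex.ofRealCLM.contDiff.comp (contDiff_const.mul contDiff_truncLog))))

omit [InnerProductSpace ℝ V] in
theorem norm_twistedBump (θ : ℝ) (p : V) : ‖twistedBump θ p‖ = annularBump p := by
  rw [twistedBump, norm_mul, mul_comm Complex.I, Complex.norm_exp_ofReal_mul_I, mul_one,
    Complex.norm_real, Real.norm_of_nonneg (annularBump_nonneg p)]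

omit [InnerProductSpace ℝ V] in
theorem twistedBump_eq_zero {θ : ℝ} {p : V} (h : 2 ≤ ‖p‖) : twistedBump θ p = 0 := by
  rw [← norm_eq_zero, norm_twistedBump]
  by_contra h'
  linarith [norm_lt_two_of_annularBump_ne_zero h']

omit [InnerProductSpace ℝ V] in
theorem twistedBump_eq_zero_of_norm_le_one {θ : ℝ} {p : V} (h : ‖p‖ ≤ 1) :
    twistedBump θ p = 0 := by
  rw [← norm_eq_zero, norm_twistedBump]
  by_contra h'
  linarith [one_lt_norm_of_annularBump_ne_zero h']

theorem hasCompactSupport_of_norm_le [FiniteDimensional ℝ V] {E : Type*} [Zero E] {f : V → E}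
    (R : ℝ) (h : ∀ p, R < ‖p‖ → f p = 0) : HasCompactSupport f := by
  have := FiniteDimensional.proper ℝ V
  exact HasCompactSupport.intro (isCompact_closedBall 0 R) fun p hp => h p (by simpa using hp)

theorem hasCompactSupport_twistedBump [FiniteDimensional ℝ V] (θ : ℝ) :
    HasCompactSupport (twistedBump θ : V → ℂ) :=
  hasCompactSupport_of_norm_le 2 fun _ hp => twistedBump_eq_zero hp.le

theorem hasCompactSupport_annularBump [FiniteDimensional ℝ V] :
    HasCompactSupport (annularBump : V → ℝ) :=
  hasCompactSupport_of_norm_le 2 fun _ hp => by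
    by_contra h
    linarith [norm_lt_two_of_annularBump_ne_zero h]

theorem hasCompactSupport_truncLog [FiniteDimensional ℝ V] :
    HasCompactSupport (truncLog : V → ℝ) :=
  hasCompactSupport_of_norm_le 2 fun p hp => by
    rw [truncLog, ContDiffBump.zero_of_le_dist, zero_mul, zero_div]
    rw [Real.dist_eq, abs_of_nonneg (by nlinarith)]
    simp only
    nlinarith

theorem exists_iteratedFDeriv_le {E F : Type*} [NormedAddCommGroup E] [NormedSpace ℝ E]
    [NormedAddCommGroup F] [NormedSpace ℝ F] {f : E → F} (hf : ContDiff ℝ ∞ f)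
    (hs : HasCompactSupport f) (k : ℕ) :
    ∃ C : ℝ, 1 ≤ C ∧ ∀ j ≤ k, ∀ p, ‖iteratedFDeriv ℝ j f p‖ ≤ C := by
  have h : ∀ j : ℕ, ∃ C : ℝ, ∀ p, ‖iteratedFDeriv ℝ j f p‖ ≤ C := fun j =>
    (hf.continuous_iteratedFDeriv (m := j) (by exact_mod_cast le_top)).bounded_above_of_compact_support
      (hs.iteratedFDeriv j)
  choose C hC using h
  refine ⟨1 + ∑ j ∈ Finset.range (k + 1), |C j|, ?_, fun j hj p => (hC j p).trans ?_⟩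
  · exact le_add_of_nonneg_right (Finset.sum_nonneg fun _ _ => abs_nonneg _)
  · have := Finset.single_le_sum (f := fun j => |C j|) (fun _ _ => abs_nonneg _)
      (Finset.mem_range.2 (Nat.lt_succ_of_le hj))
    linarith [le_abs_self (C j)]

theorem norm_iteratedFDeriv_cexp_I_mul (i : ℕ) (u : ℝ) :
    ‖iteratedFDeriv ℝ i (fun u : ℝ => Complex.exp (Complex.I * u)) u‖ ≤ 1 := by
  rw [norm_iteratedFDeriv_eq_norm_iteratedDeriv]
  have h : ∀ i : ℕ, iteratedDeriv i (fun u : ℝ => Complex.exp (Complex.I * u)) =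
      fun u : ℝ => Complex.I ^ i * Complex.exp (Complex.I * u) := by
    intro i
    induction i with
    | zero => simp
    | succ i ih =>
      rw [iteratedDeriv_succ, ih]
      ext u
      have h1 : HasDerivAt (fun u : ℝ => Complex.exp (Complex.I * u))
          (Complex.exp (Complex.I * u) * (Complex.I * 1)) u :=
        ((Complex.ofRealCLM.hasDerivAt (x := u)).const_mul Complex.I).cexp
      rw [(h1.const_mul _).deriv]
      ring
  rw [h, norm_mul, mul_comm Complex.I, Complex.norm_exp_ofReal_mul_I]
  simp

theorem exists_iteratedFDeriv_twistedBump_le [FiniteDimensional ℝ V] (k : ℕ) :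
    ∃ C : ℝ, 1 ≤ C ∧ ∀ θ : ℝ, ∀ p : V,
      ‖iteratedFDeriv ℝ k (twistedBump θ) p‖ ≤ C * (1 + |θ|) ^ k := by
  obtain ⟨M, hM1, hM⟩ := exists_iteratedFDeriv_le (contDiff_truncLog (V := V))
    hasCompactSupport_truncLog k
  obtain ⟨N, hN1, hN⟩ := exists_iteratedFDeriv_le (E := V)
    (f := fun p : V => (annularBump p : ℂ)) (Complex.ofRealCLM.contDiff.comp contDiff_annularBump)
    (hasCompactSupport_annularBump.comp_left (g := fun x : ℝ => (x : ℂ)) rfl) k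
  have hexp : ∀ j ≤ k, ∀ θ : ℝ, ∀ p : V,
      ‖iteratedFDeriv ℝ j (fun p : V => Complex.exp (Complex.I * (θ * truncLog p : ℝ))) p‖ ≤
        (k.factorial : ℝ) * (M * (1 + |θ|)) ^ k := by
    intro j hj θ p
    have hθ : 1 ≤ M * (1 + |θ|) := by nlinarith [abs_nonneg θ]
    have := norm_iteratedFDeriv_comp_le (𝕜 := ℝ) (N := ∞)
      (g := fun u : ℝ => Complex.exp (Complex.I * u))
      (f := fun p : V => θ * truncLog p) (n := j)
      (Complex.contDiff_exp.comp (contDiff_const.mul Complex.ofRealCLM.contDiff))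
      (contDiff_const.mul contDiff_truncLog) (by exact_mod_cast le_top) p (C := 1)
      (D := M * (1 + |θ|)) (fun i _ => norm_iteratedFDeriv_cexp_I_mul i _) (fun i hi hi' => by
        have h1 : iteratedFDeriv ℝ i (fun p : V => θ * truncLog p) p =
            θ • iteratedFDeriv ℝ i (truncLog : V → ℝ) p :=
          iteratedFDeriv_const_smul_apply (a := θ) (f := (truncLog : V → ℝ))
            (contDiff_truncLog.contDiffAt.of_le (by exact_mod_cast le_top))
        rw [h1, norm_smul, Real.norm_eq_abs]
        refine le_trans ?_ (le_self_pow₀ hθ (by omega))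
        nlinarith [hM i (hi'.trans hj) p, abs_nonneg θ])
    refine this.trans ?_
    rw [mul_one]
    gcongr
  refine ⟨2 ^ k * N * (k.factorial * M ^ k), ?_, fun θ p => ?_⟩
  · have h1 : (1 : ℝ) ≤ 2 ^ k := one_le_pow₀ (by norm_num)
    have h2 : (1 : ℝ) ≤ k.factorial := by exact_mod_cast Nat.one_le_iff_ne_zero.2 k.factorial_ne_zero
    have h3 : (1 : ℝ) ≤ M ^ k := one_le_pow₀ hM1
    have := mul_le_mul h2 h3 (by norm_num) (by positivity)
    have := mul_le_mul h1 hN1 (by norm_num) (by positivity)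
    nlinarith
  · have h := norm_iteratedFDeriv_mul_le (𝕜 := ℝ) (N := ∞) (A := ℂ) (n := k)
      (f := fun p : V => (annularBump p : ℂ))
      (g := fun p : V => Complex.exp (Complex.I * (θ * truncLog p : ℝ)))
      (Complex.ofRealCLM.contDiff.comp contDiff_annularBump)
      (Complex.contDiff_exp.comp (contDiff_const.mul
        (Complex.ofRealCLM.contDiff.comp (contDiff_const.mul contDiff_truncLog)))) p
        (by exact_mod_cast le_top)
    refine h.trans ?_
    calc _ ≤ ∑ i ∈ Finset.range (k + 1), (k.choose i : ℝ) * N *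
          ((k.factorial : ℝ) * (M * (1 + |θ|)) ^ k) := by
          refine Finset.sum_le_sum fun i hi => ?_
          have hi' : i ≤ k := Nat.lt_succ_iff.1 (Finset.mem_range.1 hi)
          have h1 := hN i hi' p
          have h2 := hexp (k - i) (Nat.sub_le _ _) θ p
          gcongr
      _ = _ := by
          rw [← Finset.sum_mul, ← Finset.sum_mul]
          have : ∑ i ∈ Finset.range (k + 1), (k.choose i : ℝ) = 2 ^ k := by
            exact_mod_cast Nat.sum_range_choose k
          rw [this, mul_pow]
          ring

end SmoothBounds

open MeasureTheory Module in
/-- The properties shared by `ℝ` and `ℂ` that are used in the local Fourier analysis. -/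
class IsArchimedeanLocalField (𝕜 : Type*) [NormedField 𝕜] [StarRing 𝕜] [InnerProductSpace ℝ 𝕜]
    [FiniteDimensional ℝ 𝕜] [MeasurableSpace 𝕜] [BorelSpace 𝕜] : Prop where
  inner_mul_left : ∀ u v w : 𝕜, inner ℝ (u * v) w = inner ℝ v (star u * w)
  norm_star : ∀ u : 𝕜, ‖star u‖ = ‖u‖
  measurePreserving_star : MeasurePreserving (star : 𝕜 → 𝕜) volume volume
  map_mul_left : ∀ u : 𝕜, u ≠ 0 → Measure.map (u * ·) (volume : Measure 𝕜) =
    ENNReal.ofReal (‖u‖ ^ finrank ℝ 𝕜)⁻¹ • volume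

section LocalFourier

open MeasureTheory Module
open scoped FourierTransform ContDiff

variable {𝕜 : Type*} [NormedField 𝕜] [StarRing 𝕜] [InnerProductSpace ℝ 𝕜]
  [FiniteDimensional ℝ 𝕜] [MeasurableSpace 𝕜] [BorelSpace 𝕜]

omit [StarRing 𝕜] [InnerProductSpace ℝ 𝕜] [FiniteDimensional ℝ 𝕜] in
theorem measurableEmbedding_mul_left' {u : 𝕜} (hu : u ≠ 0) :
    MeasurableEmbedding (u * · : 𝕜 → 𝕜) :=
  (Homeomorph.mulLeft₀ u hu).measurableEmbedding

variable [IsArchimedeanLocalField 𝕜]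

theorem integral_comp_mul_left_local {u : 𝕜} (hu : u ≠ 0) {E : Type*} [NormedAddCommGroup E]
    [NormedSpace ℝ E] (g : 𝕜 → E) :
    ∫ p, g (u * p) = (‖u‖ ^ finrank ℝ 𝕜)⁻¹ • ∫ p, g p := by
  rw [← (measurableEmbedding_mul_left' hu).integral_map,
    IsArchimedeanLocalField.map_mul_left u hu, integral_smul_measure, ENNReal.toReal_ofReal]
  positivity

theorem integrable_comp_mul_left_local {u : 𝕜} (hu : u ≠ 0) {E : Type*} [NormedAddCommGroup E]
    {g : 𝕜 → E} (hg : Integrable g) : Integrable fun p => g (u * p) := by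
  have h := (measurableEmbedding_mul_left' hu).integrable_map_iff (μ := volume) (g := g)
  rw [IsArchimedeanLocalField.map_mul_left u hu] at h
  exact h.1 (hg.smul_measure ENNReal.ofReal_ne_top)

/-- The multiplicative convolution square of `annularBump`. -/
noncomputable def localWeight (𝕜 : Type*) [NormedField 𝕜] [InnerProductSpace ℝ 𝕜]
    [FiniteDimensional ℝ 𝕜] [MeasurableSpace 𝕜] [BorelSpace 𝕜] (p : 𝕜) : ℝ :=
  ∫ v : 𝕜, annularBump v * annularBump (v⁻¹ * p) * (‖v‖ ^ finrank ℝ 𝕜)⁻¹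

/-- The twist of `localWeight` by the character `‖p‖ ^ (iθ)`. -/
noncomputable def twistedWeight (θ : ℝ) (p : 𝕜) : ℂ :=
  localWeight 𝕜 p * Complex.exp (Complex.I * (θ * Real.log ‖p‖ : ℝ))

/-- The integrand of the multiplicative convolution square of `twistedBump`. -/
noncomputable def convKernel (θ : ℝ) (x : 𝕜 × 𝕜) : ℂ :=
  twistedBump θ x.2 * twistedBump θ (x.2⁻¹ * x.1) * ((‖x.2‖ ^ finrank ℝ 𝕜)⁻¹ : ℝ)

omit [StarRing 𝕜] [FiniteDimensional ℝ 𝕜] [MeasurableSpace 𝕜] [BorelSpace 𝕜]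
  [IsArchimedeanLocalField 𝕜] in
theorem continuous_convKernel (θ : ℝ) : Continuous (convKernel θ : 𝕜 × 𝕜 → ℂ) := by
  have hb : Continuous (twistedBump θ : 𝕜 → ℂ) := (contDiff_twistedBump θ).continuous
  rw [continuous_iff_continuousAt]
  rintro ⟨p, v⟩
  by_cases hv : v = 0
  · refine (continuousAt_const (y := (0 : ℂ))).congr ?_
    have : {x : 𝕜 × 𝕜 | ‖x.2‖ < 1} ∈ nhds (p, v) :=
      (isOpen_lt (by fun_prop) continuous_const).mem_nhds (by simp [hv])
    filter_upwards [this] with x hx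
    rw [convKernel, twistedBump_eq_zero_of_norm_le_one (le_of_lt hx)]
    simp
  · have h1 : ContinuousAt (fun x : 𝕜 × 𝕜 => x.2⁻¹) (p, v) :=
      (continuousAt_inv₀ hv).comp continuousAt_snd
    unfold convKernel
    refine ((hb.continuousAt.comp continuousAt_snd).mul
      (hb.continuousAt.comp (h1.mul continuousAt_fst))).mul ?_
    refine Complex.continuous_ofReal.continuousAt.comp (ContinuousAt.inv₀ (by fun_prop) ?_)
    simpa using fun h => absurd h hv

omit [StarRing 𝕜] [FiniteDimensional ℝ 𝕜] [MeasurableSpace 𝕜] [BorelSpace 𝕜]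
  [IsArchimedeanLocalField 𝕜] in
theorem convKernel_ne_zero {θ : ℝ} {x : 𝕜 × 𝕜} (h : convKernel θ x ≠ 0) :
    1 < ‖x.2‖ ∧ ‖x.2‖ < 2 ∧ 1 < ‖x.1‖ ∧ ‖x.1‖ < 3 := by
  have h1 : annularBump x.2 ≠ 0 := fun h0 => h (by
    rw [convKernel, norm_eq_zero.1 ((norm_twistedBump θ x.2).trans h0)]; simp)
  have h2 : annularBump (x.2⁻¹ * x.1) ≠ 0 := fun h0 => h (by
    rw [convKernel, norm_eq_zero.1 ((norm_twistedBump θ _).trans h0)]; simp)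
  have h3 := norm_mem_of_annularBump_ne_zero h1
  have h4 := norm_mem_of_annularBump_ne_zero h2
  have h5 : 0 < ‖x.2‖ := by linarith [one_lt_norm_of_annularBump_ne_zero h1]
  have h6 : ‖x.1‖ = ‖x.2‖ * ‖x.2⁻¹ * x.1‖ := by
    rw [norm_mul, norm_inv, mul_inv_cancel_left₀ h5.ne']
  have h7 := one_lt_norm_of_annularBump_ne_zero h1
  have h8 := one_lt_norm_of_annularBump_ne_zero h2
  refine ⟨h7, norm_lt_two_of_annularBump_ne_zero h1, ?_, ?_⟩
  · rw [h6]; nlinarith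
  · have : ‖x.1‖ ^ 2 < 3 ^ 2 := by
      rw [h6, mul_pow]; nlinarith
    exact lt_of_pow_lt_pow_left₀ 2 (by norm_num) this

omit [StarRing 𝕜] [MeasurableSpace 𝕜] [BorelSpace 𝕜] [IsArchimedeanLocalField 𝕜] in
theorem hasCompactSupport_convKernel (θ : ℝ) :
    HasCompactSupport (convKernel θ : 𝕜 × 𝕜 → ℂ) := by
  have := FiniteDimensional.proper ℝ 𝕜
  refine HasCompactSupport.intro (isCompact_closedBall 0 3) fun x hx => ?_
  by_contra h
  have h1 := convKernel_ne_zero h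
  refine hx ?_
  rw [mem_closedBall_zero_iff, Prod.norm_def]
  exact max_le h1.2.2.2.le (by linarith [h1.2.1])

omit [StarRing 𝕜] [IsArchimedeanLocalField 𝕜] in
theorem twistedWeight_eq_integral (θ : ℝ) (p : 𝕜) :
    twistedWeight θ p = ∫ v, convKernel θ (p, v) := by
  rw [twistedWeight, localWeight, ← integral_complex_ofReal, ← integral_mul_const]
  refine integral_congr_ae (.of_forall fun v => ?_)
  simp only [convKernel, twistedBump]
  by_cases h1 : annularBump v = 0
  · simp [h1]
  by_cases h2 : annularBump (v⁻¹ * p) = 0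
  · simp [h2]
  have h3 : 0 < ‖v‖ := by linarith [one_lt_norm_of_annularBump_ne_zero h1]
  have h4 : 0 < ‖v⁻¹ * p‖ := by linarith [one_lt_norm_of_annularBump_ne_zero h2]
  have h5 : ‖p‖ = ‖v‖ * ‖v⁻¹ * p‖ := by
    rw [norm_mul, norm_inv, mul_inv_cancel_left₀ h3.ne']
  rw [truncLog_eq_log h1, truncLog_eq_log h2, h5, Real.log_mul h3.ne' h4.ne', mul_add]
  push_cast
  rw [mul_add, Complex.exp_add]
  ring

omit [StarRing 𝕜] [IsArchimedeanLocalField 𝕜] in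
theorem continuous_twistedWeight (θ : ℝ) : Continuous (twistedWeight θ : 𝕜 → ℂ) := by
  have := FiniteDimensional.proper ℝ 𝕜
  have h : (twistedWeight θ : 𝕜 → ℂ) =
      fun p => ∫ v in Metric.closedBall (0 : 𝕜) 3, convKernel θ (p, v) := by
    ext p
    rw [twistedWeight_eq_integral, setIntegral_eq_integral_of_forall_compl_eq_zero]
    intro v hv
    by_contra h
    refine hv ?_
    rw [mem_closedBall_zero_iff]
    linarith [(convKernel_ne_zero h).2.1]
  rw [h]
  exact continuous_parametric_integral_of_continuous (f := fun p v => convKernel θ (p, v))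
    (continuous_convKernel θ) (isCompact_closedBall 0 3)

omit [StarRing 𝕜] [IsArchimedeanLocalField 𝕜] in
theorem continuous_localWeight : Continuous (localWeight 𝕜) := by
  have h := continuous_twistedWeight (𝕜 := 𝕜) 0
  have h2 : localWeight 𝕜 = fun p => (twistedWeight 0 p : ℂ).re := by
    ext p
    simp [twistedWeight]
  rw [h2]
  exact Complex.continuous_re.comp h

omit [StarRing 𝕜] [IsArchimedeanLocalField 𝕜] in
theorem localWeight_nonneg (p : 𝕜) : 0 ≤ localWeight 𝕜 p :=
  integral_nonneg fun v => mul_nonneg (mul_nonneg (annularBump_nonneg _) (annularBump_nonneg _))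
    (by positivity)

omit [StarRing 𝕜] [IsArchimedeanLocalField 𝕜] in
theorem norm_mem_of_localWeight_ne_zero {p : 𝕜} (h : localWeight 𝕜 p ≠ 0) :
    1 < ‖p‖ ∧ ‖p‖ < 3 := by
  have h1 : twistedWeight 0 p ≠ 0 := by simpa [twistedWeight] using h
  rw [twistedWeight_eq_integral] at h1
  by_contra h2
  refine h1 (integral_eq_zero_of_ae (.of_forall fun v => ?_))
  by_contra h3
  exact h2 (convKernel_ne_zero h3).2.2

omit [StarRing 𝕜] [IsArchimedeanLocalField 𝕜] in
theorem localWeight_eq_of_norm_eq {p q : 𝕜} (h : ‖p‖ = ‖q‖) :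
    localWeight 𝕜 p = localWeight 𝕜 q := by
  refine integral_congr_ae (.of_forall fun v => ?_)
  simp only
  rw [annularBump_eq_of_norm_eq (p := v⁻¹ * p) (q := v⁻¹ * q) (by rw [norm_mul, norm_mul, h])]

omit [StarRing 𝕜] [IsArchimedeanLocalField 𝕜] in
theorem localWeight_pos {p : 𝕜} (h : ‖p‖ = 2) : 0 < localWeight 𝕜 p := by
  have hre : ∀ v : 𝕜, annularBump v * annularBump (v⁻¹ * p) * (‖v‖ ^ finrank ℝ 𝕜)⁻¹ =
      (convKernel 0 (p, v)).re := fun v => by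
    simp only [convKernel, twistedBump, zero_mul, Complex.ofReal_zero, mul_zero, Complex.exp_zero,
      mul_one, ← Complex.ofReal_mul, Complex.ofReal_re]
  have hc : Continuous fun v : 𝕜 =>
      annularBump v * annularBump (v⁻¹ * p) * (‖v‖ ^ finrank ℝ 𝕜)⁻¹ := by
    simp_rw [hre]
    exact Complex.continuous_re.comp ((continuous_convKernel 0).comp (by fun_prop))
  have hs : HasCompactSupport fun v : 𝕜 =>
      annularBump v * annularBump (v⁻¹ * p) * (‖v‖ ^ finrank ℝ 𝕜)⁻¹ := by
    simp_rw [mul_assoc]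
    exact hasCompactSupport_annularBump.mul_right
  refine hc.integral_pos_of_hasCompactSupport_nonneg_nonzero (x := (Real.sqrt 2 • (1 : 𝕜))) hs
    (fun v => mul_nonneg (mul_nonneg (annularBump_nonneg _) (annularBump_nonneg _))
      (by positivity)) ?_
  have h1 : ‖Real.sqrt 2 • (1 : 𝕜)‖ = Real.sqrt 2 := by
    rw [norm_smul, norm_one, mul_one, Real.norm_of_nonneg (Real.sqrt_nonneg 2)]
  have h2 : Real.sqrt 2 ^ 2 = 2 := Real.sq_sqrt (by norm_num)
  rw [annularBump_eq_one (p := Real.sqrt 2 • (1 : 𝕜)), annularBump_eq_one, h1]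
  · positivity
  all_goals simp only [norm_mul, norm_inv, h1, h, mul_pow, inv_pow, h2]
  all_goals norm_num

theorem fourier_twistedWeight (θ : ℝ) (w : 𝕜) :
    𝓕 (twistedWeight θ : 𝕜 → ℂ) w =
      ∫ v, twistedBump θ v * 𝓕 (twistedBump θ : 𝕜 → ℂ) (star v * w) := by
  simp only [Real.fourier_eq, twistedWeight_eq_integral]
  have hint : Integrable (Function.uncurry fun p v : 𝕜 =>
      Real.fourierChar (-inner ℝ p w) • convKernel θ (p, v)) (volume.prod volume) := by
    refine Continuous.integrable_of_hasCompactSupport ?_ ?_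
    · have := continuous_convKernel (𝕜 := 𝕜) θ
      exact (Real.continuous_fourierChar.comp (by fun_prop :
        Continuous fun x : 𝕜 × 𝕜 => -inner ℝ x.1 w)).smul this
    · exact (hasCompactSupport_convKernel (𝕜 := 𝕜) θ).smul_left
  simp only [Circle.smul_def] at hint ⊢
  simp_rw [← integral_smul]
  rw [integral_integral_swap hint]
  refine integral_congr_ae (.of_forall fun v => ?_)
  simp only
  by_cases hv : v = 0
  · subst hv
    have : twistedBump θ (0 : 𝕜) = 0 := twistedBump_eq_zero_of_norm_le_one (by simp)
    simp [convKernel, this]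
  · have h := integral_comp_mul_left_local hv
      (fun p => (Real.fourierChar (-inner ℝ p w) : ℂ) • convKernel θ (p, v))
    have hv' : ‖v‖ ^ finrank ℝ 𝕜 ≠ 0 := by simpa using fun h => absurd h hv
    rw [eq_inv_smul_iff₀ hv'] at h
    rw [← h, ← integral_smul, ← integral_const_mul]
    refine integral_congr_ae (.of_forall fun q => ?_)
    simp only [convKernel, inv_mul_cancel_left₀ hv,
      IsArchimedeanLocalField.inner_mul_left v q w, smul_eq_mul, Complex.real_smul]
    have : ((‖v‖ ^ finrank ℝ 𝕜 : ℝ) : ℂ) ≠ 0 := by exact_mod_cast hv'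
    push_cast at this ⊢
    field_simp

/-- The twisted bump as a Schwartz function. -/
noncomputable def twistedBumpSchwartz (𝕜 : Type*) [NormedAddCommGroup 𝕜] [InnerProductSpace ℝ 𝕜]
    [FiniteDimensional ℝ 𝕜] (θ : ℝ) : SchwartzMap 𝕜 ℂ :=
  (hasCompactSupport_twistedBump θ).toSchwartzMap (contDiff_twistedBump θ)

omit [StarRing 𝕜] [IsArchimedeanLocalField 𝕜] in
theorem integrable_annularBump_sq : Integrable fun v : 𝕜 => annularBump v ^ 2 := by
  have hc : Continuous (annularBump : 𝕜 → ℝ) := contDiff_annularBump.continuous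
  have hs : HasCompactSupport fun v : 𝕜 => annularBump v ^ 2 :=
    hasCompactSupport_of_norm_le 2 fun p hp => by
      by_contra h
      linarith [norm_lt_two_of_annularBump_ne_zero (p := p) (fun h0 => h (by simp [h0]))]
  exact (hc.pow 2).integrable_of_hasCompactSupport hs

theorem norm_fourier_twistedWeight_le_of_pos (θ : ℝ) {w : 𝕜} (hw : w ≠ 0) (k : ℕ) {l : ℝ}
    (hl : 0 < l) :
    ‖𝓕 (twistedWeight θ : 𝕜 → ℂ) w‖ ≤ (l * (∫ v : 𝕜, annularBump v ^ 2) +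
      l⁻¹ * ((‖w‖ ^ (2 * k))⁻¹ * ((‖w‖ ^ finrank ℝ 𝕜)⁻¹ *
        ∫ u : 𝕜, ‖u‖ ^ (2 * k) * ‖𝓕 (twistedBump θ : 𝕜 → ℂ) u‖ ^ 2))) / 2 := by
  set Φ : 𝕜 → ℝ := fun u => ‖u‖ ^ (2 * k) * ‖𝓕 (twistedBump θ : 𝕜 → ℂ) u‖ ^ 2 with hΦ
  have hΦi : Integrable Φ :=
    (𝓕 (twistedBumpSchwartz 𝕜 θ)).integrable_norm_pow_mul_norm_sq (2 * k)
  have hsw : star w ≠ 0 := star_ne_zero.2 hw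
  have hstar : ∀ v : 𝕜, star v * w = star (star w * v) := fun v => by
    rw [star_mul, star_star]
  have hΦs : Integrable fun v : 𝕜 => Φ (star v) :=
    (IsArchimedeanLocalField.measurePreserving_star (𝕜 := 𝕜)).integrable_comp_of_integrable hΦi
  have hemb : MeasurableEmbedding (star : 𝕜 → 𝕜) :=
    MeasurableEquiv.measurableEmbedding
      { toEquiv := (star_involutive (R := 𝕜)).toPerm
        measurable_toFun := IsArchimedeanLocalField.measurePreserving_star.measurable
        measurable_invFun := IsArchimedeanLocalField.measurePreserving_star.measurable }
  have h1 : ∫ v, Φ (star v * w) = (‖w‖ ^ finrank ℝ 𝕜)⁻¹ * ∫ u, Φ u := by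
    simp_rw [hstar]
    rw [integral_comp_mul_left_local hsw (fun v => Φ (star v)),
      IsArchimedeanLocalField.norm_star,
      IsArchimedeanLocalField.measurePreserving_star.integral_comp hemb, smul_eq_mul]
  have h1i : Integrable fun v => Φ (star v * w) := by
    simp_rw [hstar]
    exact integrable_comp_mul_left_local hsw hΦs
  have hw0 : 0 < ‖w‖ := norm_pos_iff.2 hw
  rw [fourier_twistedWeight]
  refine (norm_integral_le_of_norm_le (g := fun v => (l * annularBump v ^ 2 +
    l⁻¹ * ((‖w‖ ^ (2 * k))⁻¹ * Φ (star v * w))) / 2) ?_ (.of_forall fun v => ?_)).trans_eq ?_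
  · exact ((integrable_annularBump_sq.const_mul l).add
      ((h1i.const_mul _).const_mul _)).div_const 2
  · rw [norm_mul, norm_twistedBump]
    set y := ‖𝓕 (twistedBump θ : 𝕜 → ℂ) (star v * w)‖ with hy
    by_cases h0 : annularBump v = 0
    · rw [h0, zero_mul]
      positivity
    have hv := one_lt_norm_of_annularBump_ne_zero h0
    have h2 : y ^ 2 ≤ (‖w‖ ^ (2 * k))⁻¹ * Φ (star v * w) := by
      simp only [hΦ]
      rw [norm_mul, IsArchimedeanLocalField.norm_star, mul_pow, ← hy, ← mul_assoc,
        mul_comm (‖v‖ ^ (2 * k)), inv_mul_cancel_left₀ (by positivity)]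
      exact le_mul_of_one_le_left (sq_nonneg _) (one_le_pow₀ hv.le)
    have h3 : annularBump v * y ≤ (l * annularBump v ^ 2 + l⁻¹ * y ^ 2) / 2 := by
      have : 0 ≤ l⁻¹ * (l * annularBump v - y) ^ 2 := by positivity
      have h4 : l⁻¹ * (l * annularBump v - y) ^ 2 =
        l * annularBump v ^ 2 - 2 * (annularBump v * y) + l⁻¹ * y ^ 2 := by
        field_simp
        ring
      linarith
    refine h3.trans ?_
    gcongr
  · rw [integral_div, integral_add (integrable_annularBump_sq.const_mul l)
      ((h1i.const_mul _).const_mul _), integral_const_mul, integral_const_mul,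
      integral_const_mul, h1]

/-- The Fourier transform of the twisted weight decays like `‖w‖ ^ (-d / 2)` uniformly in the
twist, and like `‖w‖ ^ (-3 d / 2)` beyond the size of the twist. -/
theorem exists_norm_fourier_twistedWeight_le (𝕜 : Type*) [NormedField 𝕜] [StarRing 𝕜]
    [InnerProductSpace ℝ 𝕜] [FiniteDimensional ℝ 𝕜] [MeasurableSpace 𝕜] [BorelSpace 𝕜]
    [IsArchimedeanLocalField 𝕜] :
    ∃ C : ℝ, 0 < C ∧ ∀ θ : ℝ, ∀ w : 𝕜, w ≠ 0 →
      ‖𝓕 (twistedWeight θ : 𝕜 → ℂ) w‖ ≤ C * (Real.sqrt (‖w‖ ^ finrank ℝ 𝕜))⁻¹ ∧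
      ‖𝓕 (twistedWeight θ : 𝕜 → ℂ) w‖ ≤ C * (Real.sqrt (‖w‖ ^ finrank ℝ 𝕜))⁻¹ *
        ((1 + |θ|) / ‖w‖) ^ finrank ℝ 𝕜 := by
  have key : ∀ k : ℕ, ∃ B : ℝ, 0 < B ∧ ∀ θ : ℝ,
      ∫ u : 𝕜, ‖u‖ ^ (2 * k) * ‖𝓕 (twistedBump θ : 𝕜 → ℂ) u‖ ^ 2 ≤ B * ((1 + |θ|) ^ k) ^ 2 := by
    intro k
    obtain ⟨C, hC1, hC⟩ := exists_iteratedFDeriv_twistedBump_le (V := 𝕜) k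
    set B' := ((finrank ℝ 𝕜 : ℝ) ^ (k + 1) + 1) * (C ^ 2 * volume.real (Metric.closedBall (0 : 𝕜) 2))
    refine ⟨B' + 1, by positivity, fun θ => ?_⟩
    have h1 : 1 ≤ (1 + |θ|) ^ k := one_le_pow₀ (by linarith [abs_nonneg θ])
    have h := (twistedBumpSchwartz 𝕜 θ).integral_norm_pow_mul_fourier_sq_le k (R := 2)
      (M := C * (1 + |θ|) ^ k) (fun p hp => twistedBump_eq_zero hp.le)
      (fun p => (norm_twistedBump θ p).trans_le ((annularBump_le_one p).trans (by nlinarith)))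
      (hC θ)
    refine h.trans ?_
    have : B' * ((1 + |θ|) ^ k) ^ 2 ≤ (B' + 1) * ((1 + |θ|) ^ k) ^ 2 := by gcongr; linarith
    refine le_trans (le_of_eq ?_) this
    simp only [B']
    ring
  obtain ⟨B, hB, hB'⟩ := key 0
  obtain ⟨B₁, hB₁, hB₁'⟩ := key (finrank ℝ 𝕜)
  set A := ∫ v : 𝕜, annularBump v ^ 2
  have hA : 0 ≤ A := integral_nonneg fun v => sq_nonneg _
  refine ⟨A + B + B₁, by positivity, fun θ w hw => ?_⟩
  have hw0 : 0 < ‖w‖ := norm_pos_iff.2 hw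
  set N := ‖w‖ ^ finrank ℝ 𝕜 with hN
  have hN0 : 0 < N := by positivity
  have hs := Real.sqrt_pos.2 hN0
  have hss : Real.sqrt N * Real.sqrt N = N := Real.mul_self_sqrt hN0.le
  set s := Real.sqrt N
  constructor
  · refine (norm_fourier_twistedWeight_le_of_pos θ hw 0 (l := s⁻¹) (by positivity)).trans ?_
    have h1 := hB' θ
    calc _ ≤ (s⁻¹ * A + s⁻¹⁻¹ * ((‖w‖ ^ (2 * 0))⁻¹ * (N⁻¹ * (B * ((1 + |θ|) ^ 0) ^ 2)))) / 2 := by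
          gcongr
      _ = (s⁻¹ * A + s⁻¹ * B) / 2 := by
          rw [← hss]
          field_simp
          simp
      _ ≤ _ := by
          have h5 : 0 < s⁻¹ * B₁ := by positivity
          have h6 : 0 ≤ s⁻¹ * A := by positivity
          have h7 : 0 < s⁻¹ * B := by positivity
          linarith
  · set D := (1 + |θ|) ^ finrank ℝ 𝕜 with hD
    have hD0 : 0 < D := by positivity
    refine (norm_fourier_twistedWeight_le_of_pos θ hw (finrank ℝ 𝕜) (l := D / (s * N))
      (by positivity)).trans ?_
    have h1 := hB₁' θ
    calc _ ≤ (D / (s * N) * A + (D / (s * N))⁻¹ * ((‖w‖ ^ (2 * finrank ℝ 𝕜))⁻¹ *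
          (N⁻¹ * (B₁ * D ^ 2)))) / 2 := by gcongr
      _ = (s⁻¹ * (D / N) * A + s⁻¹ * (D / N) * B₁) / 2 := by
          rw [pow_mul', ← hN, ← hss]
          field_simp
      _ ≤ _ := by
          rw [div_pow, ← hD, ← hN]
          have h5 : 0 < s⁻¹ * (D / N) * B₁ := by positivity
          have h6 : 0 ≤ s⁻¹ * (D / N) * A := by positivity
          have h7 : 0 < s⁻¹ * (D / N) * B := by positivity
          linarith

end LocalFourier

instance : IsArchimedeanLocalField ℝ where
  inner_mul_left u v w := by simp; ring
  norm_star u := by simp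
  measurePreserving_star := MeasureTheory.MeasurePreserving.id _
  map_mul_left u hu := by
    rw [Real.map_volume_mul_left hu]
    simp

instance : IsArchimedeanLocalField ℂ where
  inner_mul_left u v w := by simp [Complex.inner]; ring
  norm_star u := by simp
  measurePreserving_star := Complex.conjLIE.measurePreserving
  map_mul_left u hu := by
    have h := MeasureTheory.Measure.map_linearMap_addHaar_eq_smul_addHaar
      (MeasureTheory.volume : MeasureTheory.Measure ℂ) (f := LinearMap.mulLeft ℝ u)
    have hdet : LinearMap.det (LinearMap.mulLeft ℝ u) = Complex.normSq u :=
      Algebra.norm_complex_apply u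
    rw [hdet, abs_of_nonneg (inv_nonneg.2 (Complex.normSq_nonneg u))] at h
    rw [Complex.finrank_real_complex, ← Complex.normSq_eq_norm_sq]
    exact h (by simpa using hu)

section LogStep

open MeasureTheory Real Module
open scoped FourierTransform ContDiff

/-- A smooth function equal to `1` on `[-log T, 0]` and vanishing outside
`[-log T - 1, 1 / T]`. -/
noncomputable def logStep (T x : ℝ) : ℝ :=
  smoothTransition (x + (log T + 1)) - smoothTransition (T * x)

variable {T : ℝ}

theorem logStep_nonneg (hT : 1 ≤ T) (x : ℝ) : 0 ≤ logStep T x := by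
  rw [logStep]
  have hlog := log_nonneg hT
  rcases le_total x 0 with hx | hx
  · rw [smoothTransition.zero_of_nonpos (mul_nonpos_of_nonneg_of_nonpos (by linarith) hx), sub_zero]
    exact smoothTransition.nonneg _
  · rw [smoothTransition.one_of_one_le (by linarith)]
    linarith [smoothTransition.le_one (T * x)]

theorem logStep_le_one (T x : ℝ) : logStep T x ≤ 1 := by
  rw [logStep]
  linarith [smoothTransition.le_one (x + (log T + 1)), smoothTransition.nonneg (T * x)]

theorem logStep_eq_one (hT : 1 ≤ T) {x : ℝ} (h : -log T ≤ x) (h' : x ≤ 0) : logStep T x = 1 := by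
  rw [logStep, smoothTransition.one_of_one_le (by linarith),
    smoothTransition.zero_of_nonpos (mul_nonpos_of_nonneg_of_nonpos (by linarith) h'), sub_zero]

theorem logStep_eq_zero_of_le (hT : 1 ≤ T) {x : ℝ} (h : 1 / T ≤ x) : logStep T x = 0 := by
  have h1 : 1 ≤ T * x := by rwa [div_le_iff₀' (by linarith)] at h
  have h2 : 0 ≤ x := le_trans (by positivity) h
  rw [logStep, smoothTransition.one_of_one_le h1,
    smoothTransition.one_of_one_le (by linarith [log_nonneg hT]), sub_self]

theorem logStep_eq_zero_of_ge (hT : 1 ≤ T) {x : ℝ} (h : x ≤ -log T - 1) : logStep T x = 0 := by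
  have hlog := log_nonneg hT
  rw [logStep, smoothTransition.zero_of_nonpos (by linarith),
    smoothTransition.zero_of_nonpos (mul_nonpos_of_nonneg_of_nonpos (by linarith) (by linarith)),
    sub_zero]

theorem contDiff_logStep (T : ℝ) : ContDiff ℝ ∞ (logStep T) := by
  unfold logStep
  exact (smoothTransition.contDiff.comp (contDiff_id.add contDiff_const)).sub
    (smoothTransition.contDiff.comp (contDiff_const.mul contDiff_id))

theorem logStep_ne_zero (hT : 1 ≤ T) {x : ℝ} (h : logStep T x ≠ 0) :
    -log T - 1 ≤ x ∧ x ≤ 1 := by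
  constructor
  · by_contra h'
    exact h (logStep_eq_zero_of_ge hT (by linarith))
  · by_contra h'
    exact h (logStep_eq_zero_of_le hT (le_trans (by rw [div_le_one (by linarith)]; exact hT)
      (le_of_not_ge h')))

theorem hasCompactSupport_logStep (hT : 1 ≤ T) : HasCompactSupport (logStep T) :=
  HasCompactSupport.intro (isCompact_Icc (a := -log T - 1) (b := 1)) fun x hx => by
    by_contra h
    exact hx (logStep_ne_zero hT h)

theorem contDiff_ofReal_logStep (T : ℝ) : ContDiff ℝ ∞ fun x => (logStep T x : ℂ) :=
  Complex.ofRealCLM.contDiff.comp (contDiff_logStep T)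

theorem hasCompactSupport_ofReal_logStep (hT : 1 ≤ T) :
    HasCompactSupport fun x => (logStep T x : ℂ) :=
  (hasCompactSupport_logStep hT).comp_left (g := fun x : ℝ => (x : ℂ)) rfl

/-- The Fourier transform of `logStep T`. -/
noncomputable def logStepFourier (T : ℝ) : ℝ → ℂ := 𝓕 fun x => (logStep T x : ℂ)

theorem exists_schwartz_logStepFourier (hT : 1 ≤ T) :
    ∃ f : SchwartzMap ℝ ℂ, (f : ℝ → ℂ) = logStepFourier T :=
  ⟨𝓕 ((hasCompactSupport_ofReal_logStep hT).toSchwartzMap (contDiff_ofReal_logStep T)), rfl⟩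

theorem continuous_logStepFourier (hT : 1 ≤ T) : Continuous (logStepFourier T) := by
  obtain ⟨f, hf⟩ := exists_schwartz_logStepFourier hT
  exact hf ▸ f.continuous

theorem integrable_logStepFourier (hT : 1 ≤ T) : Integrable (logStepFourier T) := by
  obtain ⟨f, hf⟩ := exists_schwartz_logStepFourier hT
  exact hf ▸ f.integrable

theorem logStep_eq_integral (hT : 1 ≤ T) (x : ℝ) :
    (logStep T x : ℂ) = ∫ t, Complex.exp (Complex.I * (2 * π * t * x : ℝ)) * logStepFourier T t := by
  have hi : Integrable fun x => (logStep T x : ℂ) :=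
    (contDiff_ofReal_logStep T).continuous.integrable_of_hasCompactSupport
      (hasCompactSupport_ofReal_logStep hT)
  have h := (contDiff_ofReal_logStep T).continuous.fourierInv_fourier_eq hi
    (integrable_logStepFourier hT)
  conv_lhs => rw [show (logStep T x : ℂ) = (fun x => (logStep T x : ℂ)) x from rfl, ← h]
  rw [Real.fourierInv_eq]
  refine integral_congr_ae (.of_forall fun t => ?_)
  simp only [Circle.smul_def, Real.fourierChar_apply, logStepFourier, smul_eq_mul]
  congr 2
  simp
  ring

theorem iteratedDeriv_logStep (k : ℕ) (T x : ℝ) :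
    iteratedDeriv k (logStep T) x = iteratedDeriv k smoothTransition (x + (log T + 1)) -
      T ^ k * iteratedDeriv k smoothTransition (T * x) := by
  have hs : ContDiff ℝ k smoothTransition := smoothTransition.contDiff
  have h1 : ContDiffAt ℝ k (fun x => smoothTransition (x + (log T + 1))) x :=
    (hs.comp (contDiff_id.add contDiff_const)).contDiffAt
  have h2 : ContDiffAt ℝ k (fun x => smoothTransition (T * x)) x :=
    (hs.comp (contDiff_const.mul contDiff_id)).contDiffAt
  have h := iteratedDeriv_sub h1 h2
  rw [iteratedDeriv_comp_add_const, iteratedDeriv_comp_const_mul hs] at h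
  exact h

theorem iteratedDeriv_ofReal_comp {k : ℕ} {f : ℝ → ℝ} (hf : ContDiff ℝ k f) (x : ℝ) :
    iteratedDeriv k (fun x => (f x : ℂ)) x = ((iteratedDeriv k f x : ℝ) : ℂ) := by
  have h := Complex.ofRealCLM.iteratedFDeriv_comp_left (f := f) (x := x) (i := k) hf.contDiffAt le_rfl
  rw [iteratedDeriv_eq_iteratedFDeriv, iteratedDeriv_eq_iteratedFDeriv]
  exact congrArg (fun m => m fun _ => 1) h

theorem integrable_iteratedDeriv_smoothTransition {k : ℕ} (hk : k ≠ 0) :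
    Integrable (iteratedDeriv k smoothTransition) := by
  refine Continuous.integrable_of_hasCompactSupport
    ((smoothTransition.contDiff (n := k)).continuous_iteratedDeriv k le_rfl) ?_
  refine HasCompactSupport.intro (isCompact_Icc (a := (0 : ℝ)) (b := 1)) fun x hx => ?_
  rw [Set.mem_Icc, not_and_or, not_le, not_le] at hx
  rcases hx with hx | hx
  · have : smoothTransition =ᶠ[nhds x] fun _ => 0 := by
      filter_upwards [Iio_mem_nhds hx] with y hy
      exact smoothTransition.zero_of_nonpos (le_of_lt hy)
    rw [this.iteratedDeriv_eq k]
    simp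
  · have : smoothTransition =ᶠ[nhds x] fun _ => 1 := by
      filter_upwards [Ioi_mem_nhds hx] with y hy
      exact smoothTransition.one_of_one_le (le_of_lt hy)
    rw [this.iteratedDeriv_eq k]
    simp [iteratedDeriv_const, hk]

theorem exists_pow_mul_norm_logStepFourier_le {k : ℕ} (hk : k ≠ 0) :
    ∃ C : ℝ, 0 < C ∧ ∀ T : ℝ, 1 ≤ T → ∀ t : ℝ,
      |t| ^ k * ‖logStepFourier T t‖ ≤ C * T ^ (k - 1) := by
  set S := ∫ x, ‖iteratedDeriv k smoothTransition x‖ with hS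
  have hS0 : 0 ≤ S := integral_nonneg fun _ => norm_nonneg _
  have hSi := (integrable_iteratedDeriv_smoothTransition hk).norm
  refine ⟨2 * S + 1, by positivity, fun T hT t => ?_⟩
  have hT0 : 0 < T := by linarith
  have hcd := contDiff_ofReal_logStep T
  have h1 : 𝓕 (iteratedDeriv k fun x => (logStep T x : ℂ)) =
      fun t : ℝ => (2 * π * Complex.I * t) ^ k • 𝓕 (fun x => (logStep T x : ℂ)) t := by
    refine Real.fourier_iteratedDeriv (N := ⊤) hcd (fun j _ => ?_) (by exact_mod_cast le_top)
    refine (hcd.continuous_iteratedDeriv j (by exact_mod_cast le_top)).integrable_of_hasCompactSupport ?_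
    have := (hasCompactSupport_ofReal_logStep hT).iteratedFDeriv (𝕜 := ℝ) j
    refine this.mono' fun x hx => subset_tsupport _ ?_
    simp only [Function.mem_support, iteratedDeriv_eq_iteratedFDeriv] at hx ⊢
    intro h0
    rw [h0] at hx
    simp at hx
  have h2 : ‖𝓕 (iteratedDeriv k fun x => (logStep T x : ℂ)) t‖ ≤
      ∫ x, ‖iteratedDeriv k (fun x => (logStep T x : ℂ)) x‖ := by
    rw [Real.fourier_eq]
    refine (norm_integral_le_integral_norm _).trans_eq (integral_congr_ae (.of_forall fun x => ?_))
    simp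
  have h3 : ∫ x, ‖iteratedDeriv k (fun x => (logStep T x : ℂ)) x‖ ≤ S + T ^ (k - 1) * S := by
    have hi1 : Integrable fun x => ‖iteratedDeriv k smoothTransition (x + (log T + 1))‖ :=
      hSi.comp_add_right _
    have hi2 : Integrable fun x => T ^ k * ‖iteratedDeriv k smoothTransition (T * x)‖ :=
      (hSi.comp_mul_left' hT0.ne').const_mul _
    calc _ ≤ ∫ x, (‖iteratedDeriv k smoothTransition (x + (log T + 1))‖ +
          T ^ k * ‖iteratedDeriv k smoothTransition (T * x)‖) := by
          refine integral_mono_of_nonneg (.of_forall fun x => norm_nonneg _) (hi1.add hi2)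
            (.of_forall fun x => ?_)
          simp only
          rw [iteratedDeriv_ofReal_comp ((contDiff_logStep T).of_le (by exact_mod_cast le_top)),
            iteratedDeriv_logStep, Complex.norm_real]
          refine (norm_sub_le _ _).trans_eq ?_
          rw [norm_mul, Real.norm_of_nonneg (pow_nonneg hT0.le k)]
      _ = S + T ^ (k - 1) * S := by
          rw [integral_add hi1 hi2, integral_const_mul,
            integral_add_right_eq_self (fun x => ‖iteratedDeriv k smoothTransition x‖),
            Measure.integral_comp_mul_left (fun x => ‖iteratedDeriv k smoothTransition x‖),
            abs_of_pos (inv_pos.2 hT0), ← hS, smul_eq_mul, ← mul_assoc]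
          congr 2
          rw [← pow_sub_one_mul hk T, mul_inv_cancel_right₀ hT0.ne']
  have h4 : 1 ≤ T ^ (k - 1) := one_le_pow₀ hT
  rw [h1] at h2
  simp only [norm_smul, norm_pow, norm_mul, Complex.norm_real, Complex.norm_I, mul_one,
    Complex.norm_ofNat, Real.norm_eq_abs, abs_of_pos Real.pi_pos] at h2
  have h5 : |t| ^ k ≤ (2 * π * |t|) ^ k := by
    refine pow_le_pow_left₀ (abs_nonneg _) ?_ k
    exact le_mul_of_one_le_left (abs_nonneg _) (by nlinarith [Real.pi_gt_three])
  calc |t| ^ k * ‖logStepFourier T t‖ ≤ (2 * π * |t|) ^ k * ‖logStepFourier T t‖ := by gcongr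
    _ ≤ S + T ^ (k - 1) * S := h2.trans h3
    _ ≤ _ := by nlinarith

theorem norm_logStepFourier_le (hT : 1 ≤ T) (t : ℝ) : ‖logStepFourier T t‖ ≤ log T + 2 := by
  rw [logStepFourier, Real.fourier_eq]
  refine (norm_integral_le_integral_norm _).trans ?_
  have h0 : ∀ x, x ∉ Set.Icc (-log T - 1) 1 →
      ‖Real.fourierChar (-inner ℝ x t) • (logStep T x : ℂ)‖ = 0 := fun x hx => by
    have : logStep T x = 0 := by
      by_contra h
      exact hx (logStep_ne_zero hT h)
    simp [this]
  rw [← setIntegral_eq_integral_of_forall_compl_eq_zero h0]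
  have h1 := norm_setIntegral_le_of_norm_le_const (μ := volume) (s := Set.Icc (-log T - 1) 1)
    (f := fun x => ‖Real.fourierChar (-inner ℝ x t) • (logStep T x : ℂ)‖) (C := 1)
    (by simp) (fun x _ => by
      simp only [norm_norm, Circle.norm_smul, Complex.norm_real]
      rw [Real.norm_of_nonneg (logStep_nonneg hT x)]
      exact logStep_le_one T x)
  refine (le_abs_self _).trans (h1.trans_eq ?_)
  rw [Real.volume_real_Icc_of_le (by linarith [log_nonneg hT])]
  ring

theorem exists_norm_logStepFourier_le {k : ℕ} (hk : k ≠ 0) :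
    ∃ C : ℝ, 0 < C ∧ ∀ T : ℝ, 1 ≤ T → ∀ t : ℝ,
      (1 + |t|) ^ k * ‖logStepFourier T t‖ ≤ C * (1 + log T) * T ^ (k - 1) := by
  obtain ⟨C, hC, h⟩ := exists_pow_mul_norm_logStepFourier_le hk
  refine ⟨2 ^ k * (C + 2), by positivity, fun T hT t => ?_⟩
  have h1 := h T hT t
  have h2 := norm_logStepFourier_le hT t
  have h3 : 1 ≤ T ^ (k - 1) := one_le_pow₀ hT
  have h4 := log_nonneg hT
  have h5 : (1 + |t|) ^ k ≤ 2 ^ k * (1 + |t| ^ k) := by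
    rcases le_total |t| 1 with ht | ht
    · calc (1 + |t|) ^ k ≤ 2 ^ k := pow_le_pow_left₀ (by positivity) (by linarith) k
        _ ≤ _ := le_mul_of_one_le_right (by positivity) (by simp)
    · calc (1 + |t|) ^ k ≤ (2 * |t|) ^ k := pow_le_pow_left₀ (by positivity) (by linarith) k
        _ = 2 ^ k * |t| ^ k := mul_pow _ _ _
        _ ≤ _ := by gcongr; linarith
  calc (1 + |t|) ^ k * ‖logStepFourier T t‖
      ≤ 2 ^ k * (1 + |t| ^ k) * ‖logStepFourier T t‖ := by gcongr
    _ = 2 ^ k * (‖logStepFourier T t‖ + |t| ^ k * ‖logStepFourier T t‖) := by ring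
    _ ≤ 2 ^ k * ((log T + 2) + C * T ^ (k - 1)) := by gcongr
    _ ≤ 2 ^ k * ((C + 2) * (1 + log T) * T ^ (k - 1)) := by
        gcongr
        have h6 : log T + 2 ≤ (2 * (1 + log T)) * T ^ (k - 1) := by nlinarith
        have h7 : C * T ^ (k - 1) ≤ C * (1 + log T) * T ^ (k - 1) := by
          gcongr
          nlinarith
        linarith
    _ = _ := by ring

theorem exists_norm_logStepFourier_le_rpow {B : ℝ} (hB : 0 ≤ B) :
    ∃ C : ℝ, 0 < C ∧ ∀ T : ℝ, 1 ≤ T → ∀ t : ℝ,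
      ‖logStepFourier T t‖ ≤ C * (1 + log T) * T ^ B * (1 + |t|) ^ (-(1 + B)) := by
  obtain ⟨C₁, hC₁, h₁⟩ := exists_norm_logStepFourier_le one_ne_zero
  obtain ⟨C₂, hC₂, h₂⟩ := exists_norm_logStepFourier_le (Nat.succ_ne_zero ⌈B⌉₊)
  refine ⟨C₁ + C₂, by positivity, fun T hT t => ?_⟩
  have hT0 : 0 < T := by linarith
  have ht : 0 < 1 + |t| := by positivity
  have hl : 0 < 1 + log T := by linarith [log_nonneg hT]
  have h1 := h₁ T hT t
  have h2 := h₂ T hT t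
  simp only [pow_one, Nat.sub_self, pow_zero, mul_one, Nat.succ_sub_one] at h1 h2
  set a := ‖logStepFourier T t‖
  have key : (1 + |t|) * a ≤ (C₁ + C₂) * (1 + log T) * (T / (1 + |t|)) ^ B := by
    rcases le_total 1 (T / (1 + |t|)) with hu | hu
    · have h3 : 1 ≤ (T / (1 + |t|)) ^ B := one_le_rpow hu hB
      refine h1.trans ?_
      calc C₁ * (1 + log T) ≤ (C₁ + C₂) * (1 + log T) * 1 := by nlinarith
        _ ≤ _ := by gcongr
    · have h3 : (T / (1 + |t|)) ^ (⌈B⌉₊ : ℝ) ≤ (T / (1 + |t|)) ^ B :=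
        rpow_le_rpow_of_exponent_ge (by positivity) hu (Nat.le_ceil B)
      rw [rpow_natCast, div_pow] at h3
      have h4 : (1 + |t|) * a ≤ C₂ * (1 + log T) * (T ^ ⌈B⌉₊ / (1 + |t|) ^ ⌈B⌉₊) := by
        rw [← mul_div_assoc, le_div_iff₀ (by positivity)]
        refine le_trans (le_of_eq ?_) h2
        rw [Nat.succ_eq_add_one, pow_succ]
        ring
      refine h4.trans ?_
      gcongr
      linarith
  rw [neg_add, rpow_add ht, rpow_neg_one, rpow_neg ht.le]
  rw [div_rpow hT0.le ht.le] at key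
  have : a = (1 + |t|)⁻¹ * ((1 + |t|) * a) := by rw [inv_mul_cancel_left₀ ht.ne']
  rw [this]
  refine (mul_le_mul_of_nonneg_left key (by positivity)).trans_eq ?_
  rw [div_eq_mul_inv]
  ring

/-- Weighted `L¹` bound for the Fourier transform of the smoothed indicator function. -/
theorem exists_integral_logStepFourier_le {A e : ℝ} (hA : 0 ≤ A) (he : 0 < e) :
    ∃ C : ℝ, 0 < C ∧ ∀ T : ℝ, 1 ≤ T →
      Integrable (fun t => ‖logStepFourier T t‖ * (1 + |t|) ^ A) ∧
      ∫ t, ‖logStepFourier T t‖ * (1 + |t|) ^ A ≤ C * T ^ (A + 2 * e) := by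
  obtain ⟨C, hC, h⟩ := exists_norm_logStepFourier_le_rpow (B := A + e) (by positivity)
  have hJ : Integrable fun t : ℝ => (1 + |t|) ^ (-(1 + e)) := by
    simpa using integrable_one_add_norm (E := ℝ) (μ := volume) (r := 1 + e) (by simp [he])
  have hJ0 : 0 ≤ ∫ t : ℝ, (1 + |t|) ^ (-(1 + e)) := integral_nonneg fun t => by positivity
  refine ⟨C * (1 + 1 / e) * ((∫ t : ℝ, (1 + |t|) ^ (-(1 + e))) + 1), by positivity,
    fun T hT => ?_⟩
  have hT0 : 0 < T := by linarith
  have hle : ∀ t, ‖logStepFourier T t‖ * (1 + |t|) ^ A ≤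
      C * (1 + log T) * T ^ (A + e) * (1 + |t|) ^ (-(1 + e)) := fun t => by
    have ht : 0 < 1 + |t| := by positivity
    refine (mul_le_mul_of_nonneg_right (h T hT t) (by positivity)).trans_eq ?_
    rw [mul_assoc _ _ ((1 + |t|) ^ A), ← rpow_add ht]
    ring_nf
  have hint : Integrable fun t => ‖logStepFourier T t‖ * (1 + |t|) ^ A := by
    refine (hJ.const_mul (C * (1 + log T) * T ^ (A + e))).mono' ?_ (.of_forall fun t => ?_)
    · have h1 := continuous_logStepFourier hT
      have h2 : Continuous fun t : ℝ => (1 + |t|) ^ A :=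
        (by fun_prop : Continuous fun t : ℝ => 1 + |t|).rpow_const fun t =>
          Or.inl (by positivity)
      exact (h1.norm.mul h2).aestronglyMeasurable
    · rw [Real.norm_of_nonneg (by positivity)]
      exact hle t
  refine ⟨hint, (integral_mono hint (hJ.const_mul _) hle).trans ?_⟩
  rw [integral_const_mul]
  have hlog : 1 + log T ≤ (1 + 1 / e) * T ^ e := by
    have h1 := log_le_rpow_div hT0.le he
    have h2 : 1 ≤ T ^ e := one_le_rpow hT he.le
    have h3 : T ^ e / e = 1 / e * T ^ e := by ring
    rw [add_mul, one_mul, ← h3]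
    linarith
  calc C * (1 + log T) * T ^ (A + e) * ∫ t : ℝ, (1 + |t|) ^ (-(1 + e))
      ≤ C * ((1 + 1 / e) * T ^ e) * T ^ (A + e) *
        ((∫ t : ℝ, (1 + |t|) ^ (-(1 + e))) + 1) := by
        gcongr
        linarith
    _ = _ := by
        rw [show A + 2 * e = e + (A + e) by ring, rpow_add hT0 e (A + e)]
        generalize T ^ (A + e) = X
        ring

end LogStep

/-- The function `min(r, 1/r) ^ (1/4)`. -/
noncomputable def envelope (r : ℝ) : ℝ := Real.exp (-|Real.log r| / 4)

theorem envelope_nonneg (r : ℝ) : 0 ≤ envelope r := (Real.exp_pos _).le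

theorem envelope_le_one (r : ℝ) : envelope r ≤ 1 := by
  rw [envelope, Real.exp_le_one_iff]
  linarith [abs_nonneg (Real.log r)]

theorem measurable_envelope : Measurable envelope := by
  unfold envelope
  exact Real.measurable_exp.comp ((Real.measurable_log.abs.neg).div_const 4)

theorem rpow_le_envelope_of_le_one {r b : ℝ} (hr : 0 < r) (hr1 : r ≤ 1) (hb : 1 / 4 ≤ b) :
    r ^ b ≤ envelope r := by
  have hlog := Real.log_nonpos hr.le hr1
  rw [envelope, Real.rpow_def_of_pos hr, Real.exp_le_exp, abs_of_nonpos hlog]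
  nlinarith

theorem rpow_neg_le_envelope_of_one_le {r b : ℝ} (hr1 : 1 ≤ r) (hb : 1 / 4 ≤ b) :
    r ^ (-b) ≤ envelope r := by
  have hlog := Real.log_nonneg hr1
  rw [envelope, Real.rpow_def_of_pos (by linarith), Real.exp_le_exp, abs_of_nonneg hlog]
  nlinarith

section LocalEnvelope

open Module Real
open scoped FourierTransform

theorem exists_norm_fourier_twistedWeight_le_envelope (𝕜 : Type*) [NormedField 𝕜] [StarRing 𝕜]
    [InnerProductSpace ℝ 𝕜] [FiniteDimensional ℝ 𝕜] [MeasurableSpace 𝕜] [BorelSpace 𝕜]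
    [IsArchimedeanLocalField 𝕜] (hd : 0 < finrank ℝ 𝕜) :
    ∃ C : ℝ, 0 < C ∧ ∀ θ : ℝ, ∀ w : 𝕜, w ≠ 0 → ∀ e : ℝ, 0 < e → e ≤ 1 / 4 →
      ‖𝓕 (twistedWeight θ : 𝕜 → ℂ) w‖ ≤ C * (‖w‖ ^ finrank ℝ 𝕜) ^ (-(1 + e)) *
        ((1 + |θ|) ^ finrank ℝ 𝕜) ^ (1 / 2 + e) * envelope (‖w‖ / (1 + |θ|)) := by
  obtain ⟨C, hC, h⟩ := exists_norm_fourier_twistedWeight_le 𝕜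
  refine ⟨C, hC, fun θ w hw e he he' => ?_⟩
  obtain ⟨h1, h2⟩ := h θ w hw
  have hw0 : 0 < ‖w‖ := norm_pos_iff.2 hw
  have hτ : 0 < 1 + |θ| := by positivity
  have hd1 : (1 : ℝ) ≤ finrank ℝ 𝕜 := by exact_mod_cast hd
  set d := finrank ℝ 𝕜
  have hs : (√(‖w‖ ^ d))⁻¹ = (‖w‖ ^ d) ^ (-(1 / 2) : ℝ) := by
    rw [Real.sqrt_eq_rpow, ← Real.rpow_neg (by positivity)]
  have hsplit : (‖w‖ ^ d) ^ (-(1 / 2) : ℝ) = (‖w‖ ^ d) ^ (-(1 + e)) * (‖w‖ ^ d) ^ (1 / 2 + e) := by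
    rw [← Real.rpow_add (by positivity)]
    congr 1
    ring
  have hr : 0 < ‖w‖ / (1 + |θ|) := by positivity
  have hfac : (‖w‖ ^ d) ^ (1 / 2 + e) =
      ((1 + |θ|) ^ d) ^ (1 / 2 + e) * (‖w‖ / (1 + |θ|)) ^ ((d : ℝ) * (1 / 2 + e)) := by
    rw [Real.rpow_mul hr.le, Real.rpow_natCast, ← Real.mul_rpow (by positivity) (by positivity),
      ← mul_pow, mul_div_cancel₀ _ hτ.ne']
  rw [hs, hsplit, hfac] at h1 h2
  rcases le_total (‖w‖ / (1 + |θ|)) 1 with hle | hle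
  · refine h1.trans ?_
    have := rpow_le_envelope_of_le_one (b := (d : ℝ) * (1 / 2 + e)) hr hle (by nlinarith)
    rw [← mul_assoc, ← mul_assoc]
    gcongr
  · refine h2.trans ?_
    have h3 : (‖w‖ / (1 + |θ|)) ^ ((d : ℝ) * (1 / 2 + e)) * ((1 + |θ|) / ‖w‖) ^ d =
        (‖w‖ / (1 + |θ|)) ^ (-((d : ℝ) * (1 / 2 - e))) := by
      rw [← inv_div ‖w‖, inv_pow, ← Real.rpow_natCast (‖w‖ / (1 + |θ|)) d, ← Real.rpow_neg hr.le,
        ← Real.rpow_add hr]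
      congr 1
      ring
    have := rpow_neg_le_envelope_of_one_le (b := (d : ℝ) * (1 / 2 - e)) hle (by nlinarith)
    rw [← h3] at this
    calc _ = C * (‖w‖ ^ d) ^ (-(1 + e)) * ((1 + |θ|) ^ d) ^ (1 / 2 + e) *
        ((‖w‖ / (1 + |θ|)) ^ ((d : ℝ) * (1 / 2 + e)) * ((1 + |θ|) / ‖w‖) ^ d) := by ring
      _ ≤ _ := by gcongr

/-- The local bound at a place of degree `m ∈ {1, 2}`, normalised by the trace form. -/
theorem exists_norm_fourier_twistedWeight_le_trace (𝕜 : Type*) [NormedField 𝕜] [StarRing 𝕜]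
    [InnerProductSpace ℝ 𝕜] [FiniteDimensional ℝ 𝕜] [MeasurableSpace 𝕜] [BorelSpace 𝕜]
    [IsArchimedeanLocalField 𝕜] (hd : 0 < finrank ℝ 𝕜) :
    ∃ C : ℝ, 1 ≤ C ∧ ∀ t : ℝ, ∀ w : 𝕜, w ≠ 0 → ∀ r : ℝ, ‖w‖ = finrank ℝ 𝕜 * r →
      ∀ e : ℝ, 0 < e → e ≤ 1 / 4 →
      ‖𝓕 (twistedWeight (2 * π * finrank ℝ 𝕜 * t) : 𝕜 → ℂ) w‖ ≤
        C * ((r ^ finrank ℝ 𝕜) ^ (-(1 + e)) * ((1 + |t|) ^ finrank ℝ 𝕜) ^ (1 / 2 + e) *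
          envelope (finrank ℝ 𝕜 * r / (1 + 2 * π * finrank ℝ 𝕜 * |t|))) := by
  obtain ⟨C, hC, h⟩ := exists_norm_fourier_twistedWeight_le_envelope 𝕜 hd
  have hd1 : (1 : ℝ) ≤ finrank ℝ 𝕜 := by exact_mod_cast hd
  set d := finrank ℝ 𝕜
  have hpi := Real.pi_gt_three
  have hB1 : (1 : ℝ) ≤ (2 * π * d) ^ d := one_le_pow₀ (by nlinarith)
  refine ⟨C * (2 * π * d) ^ d + 1, by nlinarith, fun t w hw r hr e he he' => ?_⟩
  have h1 := h (2 * π * d * t) w hw e he he'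
  rw [abs_mul, abs_of_nonneg (by positivity : 0 ≤ 2 * π * d), hr] at h1
  have hw0 : 0 < ‖w‖ := norm_pos_iff.2 hw
  have hr0 : 0 < r := by
    rw [hr] at hw0
    exact pos_of_mul_pos_right hw0 (by positivity)
  refine h1.trans ?_
  have h2 : ((d * r) ^ d) ^ (-(1 + e)) ≤ (r ^ d) ^ (-(1 + e)) := by
    refine Real.rpow_le_rpow_of_nonpos (by positivity) ?_ (by linarith)
    exact pow_le_pow_left₀ hr0.le (le_mul_of_one_le_left hr0.le hd1) d
  have h3 : ((1 + 2 * π * d * |t|) ^ d) ^ (1 / 2 + e) ≤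
      (2 * π * d) ^ d * ((1 + |t|) ^ d) ^ (1 / 2 + e) := by
    calc ((1 + 2 * π * d * |t|) ^ d) ^ (1 / 2 + e)
        ≤ ((2 * π * d) ^ d * (1 + |t|) ^ d) ^ (1 / 2 + e) := by
          refine Real.rpow_le_rpow (by positivity) ?_ (by linarith)
          rw [← mul_pow]
          refine pow_le_pow_left₀ (by positivity) ?_ d
          nlinarith
      _ = ((2 * π * d) ^ d) ^ (1 / 2 + e) * ((1 + |t|) ^ d) ^ (1 / 2 + e) :=
          Real.mul_rpow (by positivity) (by positivity)
      _ ≤ _ := by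
          gcongr
          exact (Real.rpow_le_rpow_of_exponent_le hB1 (by linarith)).trans_eq (Real.rpow_one _)
  have henv := envelope_nonneg (d * r / (1 + 2 * π * d * |t|))
  calc _ ≤ C * (r ^ d) ^ (-(1 + e)) * ((2 * π * d) ^ d * ((1 + |t|) ^ d) ^ (1 / 2 + e)) *
        envelope (d * r / (1 + 2 * π * d * |t|)) := by gcongr
    _ = C * (2 * π * d) ^ d * ((r ^ d) ^ (-(1 + e)) * ((1 + |t|) ^ d) ^ (1 / 2 + e) *
        envelope (d * r / (1 + 2 * π * d * |t|))) := by ring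
    _ ≤ _ := by
        gcongr
        linarith

end LocalEnvelope

section MixedFourier

open MeasureTheory Module Real
open scoped FourierTransform

variable {ι κ : Type*} [Fintype ι] [Fintype κ]

/-- The product of the local weights. -/
noncomputable def mixedWeight (v : (ι → ℝ) × (κ → ℂ)) : ℝ :=
  (∏ i, localWeight ℝ (v.1 i)) * ∏ j, localWeight ℂ (v.2 j)

/-- The norm form on `ℝ^ι × ℂ^κ`. -/
noncomputable def mixedNorm (v : (ι → ℝ) × (κ → ℂ)) : ℝ :=
  (∏ i, ‖v.1 i‖) * ∏ j, ‖v.2 j‖ ^ 2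

/-- The trace form on `ℝ^ι × ℂ^κ`. -/
noncomputable def mixedTrace (v ξ : (ι → ℝ) × (κ → ℂ)) : ℝ :=
  ∑ i, v.1 i * ξ.1 i + ∑ j, 2 * (v.2 j * ξ.2 j).re

/-- The additive character attached to the trace form. -/
noncomputable def mixedChar (ξ v : (ι → ℝ) × (κ → ℂ)) : ℂ :=
  Complex.exp (-(2 * π * mixedTrace v ξ : ℝ) * Complex.I)

/-- A smooth function on `ℝ^ι × ℂ^κ` cutting off the norm form. -/
noncomputable def normCutoff (T l : ℝ) (v : (ι → ℝ) × (κ → ℂ)) : ℝ :=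
  logStep T (log (mixedNorm v) + l) * mixedWeight v

/-- The product of the local twisted weights. -/
noncomputable def mixedTwistedWeight (t : ℝ) (v : (ι → ℝ) × (κ → ℂ)) : ℂ :=
  (∏ i, twistedWeight (2 * π * finrank ℝ ℝ * t) (v.1 i)) *
    ∏ j, twistedWeight (2 * π * finrank ℝ ℂ * t) (v.2 j)

theorem mixedWeight_nonneg (v : (ι → ℝ) × (κ → ℂ)) : 0 ≤ mixedWeight v :=
  mul_nonneg (Finset.prod_nonneg fun _ _ => localWeight_nonneg _)
    (Finset.prod_nonneg fun _ _ => localWeight_nonneg _)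

theorem continuous_mixedWeight : Continuous (mixedWeight : (ι → ℝ) × (κ → ℂ) → ℝ) := by
  have h1 : Continuous (localWeight ℝ) := continuous_localWeight
  have h2 : Continuous (localWeight ℂ) := continuous_localWeight
  unfold mixedWeight
  fun_prop

theorem norm_mem_of_mixedWeight_ne_zero {v : (ι → ℝ) × (κ → ℂ)} (h : mixedWeight v ≠ 0) :
    (∀ i, 1 < ‖v.1 i‖ ∧ ‖v.1 i‖ < 3) ∧ ∀ j, 1 < ‖v.2 j‖ ∧ ‖v.2 j‖ < 3 := by
  refine ⟨fun i => norm_mem_of_localWeight_ne_zero fun h0 => h ?_,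
    fun j => norm_mem_of_localWeight_ne_zero fun h0 => h ?_⟩
  · rw [mixedWeight, Finset.prod_eq_zero (Finset.mem_univ i) h0, zero_mul]
  · rw [mixedWeight, Finset.prod_eq_zero (Finset.mem_univ j) h0, mul_zero]

theorem hasCompactSupport_mixedWeight :
    HasCompactSupport (mixedWeight : (ι → ℝ) × (κ → ℂ) → ℝ) := by
  refine HasCompactSupport.intro (isCompact_closedBall 0 3) fun v hv => ?_
  by_contra h
  obtain ⟨h1, h2⟩ := norm_mem_of_mixedWeight_ne_zero h
  refine hv (mem_closedBall_zero_iff.2 (max_le ?_ ?_))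
  · exact (pi_norm_le_iff_of_nonneg (by norm_num)).2 fun i => (h1 i).2.le
  · exact (pi_norm_le_iff_of_nonneg (by norm_num)).2 fun j => (h2 j).2.le

theorem integrable_mixedWeight : Integrable (mixedWeight : (ι → ℝ) × (κ → ℂ) → ℝ) :=
  continuous_mixedWeight.integrable_of_hasCompactSupport hasCompactSupport_mixedWeight

theorem continuous_mixedNorm : Continuous (mixedNorm : (ι → ℝ) × (κ → ℂ) → ℝ) := by
  unfold mixedNorm
  fun_prop

theorem mixedNorm_bounds {v : (ι → ℝ) × (κ → ℂ)} (h : mixedWeight v ≠ 0) :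
    1 ≤ mixedNorm v ∧ mixedNorm v ≤ 3 ^ (Fintype.card ι + 2 * Fintype.card κ) := by
  obtain ⟨h1, h2⟩ := norm_mem_of_mixedWeight_ne_zero h
  constructor
  · have a1 : (1 : ℝ) ≤ ∏ i, ‖v.1 i‖ := by
      simpa using Finset.prod_le_prod (s := Finset.univ) (f := fun _ : ι => (1 : ℝ))
        (fun _ _ => zero_le_one) fun i _ => (h1 i).1.le
    have a2 : (1 : ℝ) ≤ ∏ j, ‖v.2 j‖ ^ 2 := by
      simpa using Finset.prod_le_prod (s := Finset.univ) (f := fun _ : κ => (1 : ℝ))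
        (fun _ _ => zero_le_one) fun j _ => one_le_pow₀ (n := 2) (h2 j).1.le
    rw [mixedNorm]
    nlinarith
  · have a1 : ∏ i, ‖v.1 i‖ ≤ 3 ^ Fintype.card ι :=
      (Finset.prod_le_prod (fun i _ => norm_nonneg _) fun i _ => (h1 i).2.le).trans_eq (by simp)
    have a2 : ∏ j, ‖v.2 j‖ ^ 2 ≤ (3 ^ 2) ^ Fintype.card κ :=
      (Finset.prod_le_prod (fun i _ => sq_nonneg _) fun j _ =>
        pow_le_pow_left₀ (norm_nonneg _) (h2 j).2.le 2).trans_eq (by simp)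
    rw [mixedNorm, pow_add, pow_mul]
    gcongr

theorem normCutoff_nonneg {T : ℝ} (hT : 1 ≤ T) (l : ℝ) (v : (ι → ℝ) × (κ → ℂ)) :
    0 ≤ normCutoff T l v := mul_nonneg (logStep_nonneg hT _) (mixedWeight_nonneg v)

theorem continuous_normCutoff (T l : ℝ) :
    Continuous (normCutoff T l : (ι → ℝ) × (κ → ℂ) → ℝ) := by
  rw [continuous_iff_continuousAt]
  intro v
  by_cases hv : mixedNorm v = 0
  · refine (continuousAt_const (y := (0 : ℝ))).congr ?_
    have : {u : (ι → ℝ) × (κ → ℂ) | mixedNorm u < 1} ∈ nhds v :=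
      (isOpen_lt continuous_mixedNorm continuous_const).mem_nhds (by simp [hv])
    filter_upwards [this] with u hu
    have : mixedWeight u = 0 := by
      by_contra h
      exact absurd (mixedNorm_bounds h).1 (not_le.2 hu)
    rw [normCutoff, this, mul_zero]
  · unfold normCutoff
    refine ContinuousAt.mul ?_ continuous_mixedWeight.continuousAt
    exact (contDiff_logStep T).continuous.continuousAt.comp
      ((continuous_mixedNorm.continuousAt.log hv).add continuousAt_const)

theorem hasCompactSupport_normCutoff (T l : ℝ) :
    HasCompactSupport (normCutoff T l : (ι → ℝ) × (κ → ℂ) → ℝ) :=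
  hasCompactSupport_mixedWeight.mul_left

theorem mixedTwistedWeight_eq (t : ℝ) (v : (ι → ℝ) × (κ → ℂ)) :
    mixedTwistedWeight t v =
      mixedWeight v * Complex.exp (Complex.I * (2 * π * t * log (mixedNorm v) : ℝ)) := by
  by_cases h : mixedWeight v = 0
  · rw [h]
    simp only [Complex.ofReal_zero, zero_mul]
    rw [mixedWeight, mul_eq_zero, Finset.prod_eq_zero_iff, Finset.prod_eq_zero_iff] at h
    rcases h with ⟨i, -, hi⟩ | ⟨j, -, hj⟩
    · rw [mixedTwistedWeight, Finset.prod_eq_zero (Finset.mem_univ i), zero_mul]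
      rw [twistedWeight, hi]; simp
    · rw [mixedTwistedWeight, Finset.prod_eq_zero (Finset.mem_univ j), mul_zero]
      rw [twistedWeight, hj]; simp
  · obtain ⟨h1, h2⟩ := norm_mem_of_mixedWeight_ne_zero h
    have h1' : ∀ i ∈ Finset.univ, ‖v.1 i‖ ≠ 0 := fun i _ => by linarith [(h1 i).1]
    have h2' : ∀ j ∈ Finset.univ, ‖v.2 j‖ ^ 2 ≠ 0 := fun j _ => by
      have := (h2 j).1
      positivity
    rw [mixedNorm, Real.log_mul (Finset.prod_ne_zero_iff.2 h1') (Finset.prod_ne_zero_iff.2 h2'),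
      Real.log_prod h1', Real.log_prod h2', mixedTwistedWeight, mixedWeight]
    simp only [twistedWeight, Finset.prod_mul_distrib, ← Complex.exp_sum]
    push_cast
    rw [mul_mul_mul_comm, ← Complex.exp_add]
    congr 2
    simp only [mul_add, Finset.mul_sum, finrank_self, Complex.finrank_real_complex, Real.log_pow]
    push_cast
    congr 1 <;> refine Finset.sum_congr rfl fun _ _ => ?_ <;> ring

theorem norm_mixedTwistedWeight (t : ℝ) (v : (ι → ℝ) × (κ → ℂ)) :
    ‖mixedTwistedWeight t v‖ = mixedWeight v := by
  rw [mixedTwistedWeight_eq, norm_mul, mul_comm Complex.I, Complex.norm_exp_ofReal_mul_I, mul_one,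
    Complex.norm_real, Real.norm_of_nonneg (mixedWeight_nonneg v)]

theorem norm_mixedChar (ξ v : (ι → ℝ) × (κ → ℂ)) : ‖mixedChar ξ v‖ = 1 := by
  rw [mixedChar, ← Complex.ofReal_neg, Complex.norm_exp_ofReal_mul_I]

theorem continuous_mixedChar (ξ : (ι → ℝ) × (κ → ℂ)) : Continuous (mixedChar ξ) := by
  unfold mixedChar mixedTrace
  fun_prop

theorem mixedChar_eq_prod (ξ v : (ι → ℝ) × (κ → ℂ)) :
    mixedChar ξ v = (∏ i, (Real.fourierChar (-inner ℝ (v.1 i) (ξ.1 i)) : ℂ)) *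
      ∏ j, (Real.fourierChar (-inner ℝ (v.2 j) (2 * star (ξ.2 j))) : ℂ) := by
  simp only [Real.fourierChar_apply, ← Complex.exp_sum, ← Complex.exp_add, mixedChar]
  congr 1
  rw [mixedTrace]
  push_cast
  simp only [mul_add, neg_add, add_mul, Finset.mul_sum, Finset.sum_mul, ← Finset.sum_neg_distrib]
  congr 1
  · refine Finset.sum_congr rfl fun i _ => ?_
    simp
    ring
  · refine Finset.sum_congr rfl fun j _ => ?_
    simp [Complex.inner]
    ring

theorem integral_mixedChar_mul_mixedTwistedWeight (t : ℝ) (ξ : (ι → ℝ) × (κ → ℂ)) :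
    ∫ v, mixedChar ξ v * mixedTwistedWeight t v =
      (∏ i, 𝓕 (twistedWeight (2 * π * finrank ℝ ℝ * t) : ℝ → ℂ) (ξ.1 i)) *
        ∏ j, 𝓕 (twistedWeight (2 * π * finrank ℝ ℂ * t) : ℂ → ℂ) (2 * star (ξ.2 j)) := by
  have h : ∀ v : (ι → ℝ) × (κ → ℂ), mixedChar ξ v * mixedTwistedWeight t v =
      (∏ i, ((Real.fourierChar (-inner ℝ (v.1 i) (ξ.1 i)) : ℂ) *
        twistedWeight (2 * π * finrank ℝ ℝ * t) (v.1 i))) *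
      ∏ j, ((Real.fourierChar (-inner ℝ (v.2 j) (2 * star (ξ.2 j))) : ℂ) *
        twistedWeight (2 * π * finrank ℝ ℂ * t) (v.2 j)) := fun v => by
    rw [mixedChar_eq_prod, mixedTwistedWeight, Finset.prod_mul_distrib, Finset.prod_mul_distrib]
    ring
  simp_rw [h]
  rw [Measure.volume_eq_prod, integral_prod_mul
    (f := fun x : ι → ℝ => ∏ i, ((Real.fourierChar (-inner ℝ (x i) (ξ.1 i)) : ℂ) *
        twistedWeight (2 * π * finrank ℝ ℝ * t) (x i)))
    (g := fun y : κ → ℂ => ∏ j, ((Real.fourierChar (-inner ℝ (y j) (2 * star (ξ.2 j))) : ℂ) *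
        twistedWeight (2 * π * finrank ℝ ℂ * t) (y j)))]
  rw [integral_fintype_prod_volume_eq_prod (f := fun (i : ι) (x : ℝ) =>
      (Real.fourierChar (-inner ℝ x (ξ.1 i)) : ℂ) * twistedWeight (2 * π * finrank ℝ ℝ * t) x),
    integral_fintype_prod_volume_eq_prod (f := fun (j : κ) (y : ℂ) =>
      (Real.fourierChar (-inner ℝ y (2 * star (ξ.2 j))) : ℂ) *
        twistedWeight (2 * π * finrank ℝ ℂ * t) y)]
  simp only [Real.fourier_eq, Circle.smul_def, smul_eq_mul]

theorem normCutoff_eq_integral {T : ℝ} (hT : 1 ≤ T) (l : ℝ) (v : (ι → ℝ) × (κ → ℂ)) :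
    (normCutoff T l v : ℂ) = ∫ t, Complex.exp (Complex.I * (2 * π * t * l : ℝ)) *
      logStepFourier T t * mixedTwistedWeight t v := by
  rw [normCutoff, Complex.ofReal_mul, logStep_eq_integral hT, ← integral_mul_const]
  refine integral_congr_ae (.of_forall fun t => ?_)
  simp only [mixedTwistedWeight_eq]
  rw [mul_add, Complex.ofReal_add, mul_add, Complex.exp_add]
  ring

theorem norm_integral_mixedChar_mul_normCutoff_le {T : ℝ} (hT : 1 ≤ T) (l : ℝ)
    (ξ : (ι → ℝ) × (κ → ℂ)) :
    ‖∫ v, mixedChar ξ v * (normCutoff T l v : ℂ)‖ ≤ ∫ t, ‖logStepFourier T t‖ *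
      ((∏ i, ‖𝓕 (twistedWeight (2 * π * finrank ℝ ℝ * t) : ℝ → ℂ) (ξ.1 i)‖) *
        ∏ j, ‖𝓕 (twistedWeight (2 * π * finrank ℝ ℂ * t) : ℂ → ℂ) (2 * star (ξ.2 j))‖) := by
  simp_rw [normCutoff_eq_integral hT, ← integral_const_mul]
  have hmeas : Measurable fun x : ((ι → ℝ) × (κ → ℂ)) × ℝ => mixedTwistedWeight x.2 x.1 := by
    simp_rw [mixedTwistedWeight_eq]
    have h1 := (continuous_mixedWeight (ι := ι) (κ := κ)).measurable
    have h2 := (continuous_mixedNorm (ι := ι) (κ := κ)).measurable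
    fun_prop
  have hint : Integrable (Function.uncurry fun (v : (ι → ℝ) × (κ → ℂ)) (t : ℝ) => mixedChar ξ v *
      (Complex.exp (Complex.I * (2 * π * t * l : ℝ)) * logStepFourier T t *
        mixedTwistedWeight t v)) (volume.prod volume) := by
    refine ((integrable_mixedWeight (ι := ι) (κ := κ)).mul_prod
      (integrable_logStepFourier hT).norm).mono' ?_ (.of_forall fun x => ?_)
    · refine Measurable.aestronglyMeasurable ?_
      have h1 := (continuous_mixedChar ξ).measurable
      have h2 := (continuous_logStepFourier hT).measurable
      simp only [Function.uncurry_def]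
      refine (h1.comp measurable_fst).mul (Measurable.mul ?_ hmeas)
      exact Measurable.mul (by fun_prop) (h2.comp measurable_snd)
    · simp only [Function.uncurry, norm_mul, norm_mixedChar, norm_mixedTwistedWeight,
        mul_comm Complex.I, Complex.norm_exp_ofReal_mul_I, one_mul]
      rw [mul_comm]
  rw [integral_integral_swap hint]
  refine (norm_integral_le_integral_norm _).trans_eq (integral_congr_ae (.of_forall fun t => ?_))
  simp only
  have : ∀ v : (ι → ℝ) × (κ → ℂ), mixedChar ξ v * (Complex.exp (Complex.I * (2 * π * t * l : ℝ)) *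
      logStepFourier T t * mixedTwistedWeight t v) =
      (Complex.exp (Complex.I * (2 * π * t * l : ℝ)) * logStepFourier T t) *
        (mixedChar ξ v * mixedTwistedWeight t v) := fun v => by ring
  simp_rw [this]
  rw [integral_const_mul, integral_mixedChar_mul_mixedTwistedWeight, norm_mul, norm_mul, norm_mul,
    norm_prod, norm_prod, mul_comm Complex.I, Complex.norm_exp_ofReal_mul_I, one_mul]

/-- The product of the local envelopes at the twist `t`. -/
noncomputable def mixedEnvelope (t : ℝ) (ξ : (ι → ℝ) × (κ → ℂ)) : ℝ :=
  (∏ i, envelope (finrank ℝ ℝ * ‖ξ.1 i‖ / (1 + 2 * π * finrank ℝ ℝ * |t|))) *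
    ∏ j, envelope (finrank ℝ ℂ * ‖ξ.2 j‖ / (1 + 2 * π * finrank ℝ ℂ * |t|))

theorem mixedEnvelope_nonneg (t : ℝ) (ξ : (ι → ℝ) × (κ → ℂ)) : 0 ≤ mixedEnvelope t ξ :=
  mul_nonneg (Finset.prod_nonneg fun _ _ => envelope_nonneg _)
    (Finset.prod_nonneg fun _ _ => envelope_nonneg _)

theorem mixedEnvelope_le_one (t : ℝ) (ξ : (ι → ℝ) × (κ → ℂ)) : mixedEnvelope t ξ ≤ 1 :=
  mul_le_one₀ (Finset.prod_le_one (fun _ _ => envelope_nonneg _) fun _ _ => envelope_le_one _)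
    (Finset.prod_nonneg fun _ _ => envelope_nonneg _)
    (Finset.prod_le_one (fun _ _ => envelope_nonneg _) fun _ _ => envelope_le_one _)

theorem measurable_mixedEnvelope :
    Measurable fun x : ℝ × ((ι → ℝ) × (κ → ℂ)) => mixedEnvelope x.1 x.2 := by
  have := measurable_envelope
  unfold mixedEnvelope
  fun_prop

theorem rpow_mixedNorm (ξ : (ι → ℝ) × (κ → ℂ)) (a : ℝ) :
    mixedNorm ξ ^ a = (∏ i, (‖ξ.1 i‖ ^ finrank ℝ ℝ) ^ a) * ∏ j, (‖ξ.2 j‖ ^ finrank ℝ ℂ) ^ a := by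
  rw [mixedNorm, Real.mul_rpow (Finset.prod_nonneg fun _ _ => norm_nonneg _)
    (Finset.prod_nonneg fun _ _ => sq_nonneg _),
    ← Real.finsetProd_rpow _ _ fun _ _ => norm_nonneg _,
    ← Real.finsetProd_rpow _ _ fun _ _ => sq_nonneg _]
  simp

theorem exists_norm_fourier_normCutoff_le :
    ∃ C : ℝ, 1 ≤ C ∧ ∀ (ι κ : Type*) [Fintype ι] [Fintype κ], ∀ T : ℝ, 1 ≤ T → ∀ l : ℝ,
      ∀ ξ : (ι → ℝ) × (κ → ℂ), mixedNorm ξ ≠ 0 → ∀ e : ℝ, 0 < e → e ≤ 1 / 4 →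
      ‖∫ v, mixedChar ξ v * (normCutoff T l v : ℂ)‖ ≤
        C ^ (Fintype.card ι + Fintype.card κ) * (mixedNorm ξ ^ (-(1 + e)) *
          ∫ t, ‖logStepFourier T t‖ * (1 + |t|) ^
            (((Fintype.card ι + 2 * Fintype.card κ : ℕ) : ℝ) * (1 / 2 + e)) * mixedEnvelope t ξ) := by
  obtain ⟨C₁, hC₁, h₁⟩ := exists_norm_fourier_twistedWeight_le_trace ℝ (by simp)
  obtain ⟨C₂, hC₂, h₂⟩ := exists_norm_fourier_twistedWeight_le_trace ℂ (by simp)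
  refine ⟨C₁ * C₂, one_le_mul_of_one_le_of_one_le hC₁ hC₂, ?_⟩
  intro ι κ _ _ T hT l ξ hξ e he he'
  refine (norm_integral_mixedChar_mul_normCutoff_le hT l ξ).trans ?_
  rw [← integral_const_mul, ← integral_const_mul]
  have hξ1 : ∀ i, ξ.1 i ≠ 0 := fun i h0 => hξ (by
    rw [mixedNorm, Finset.prod_eq_zero (Finset.mem_univ i) (by simp [h0]), zero_mul])
  have hξ2 : ∀ j, ξ.2 j ≠ 0 := fun j h0 => hξ (by
    rw [mixedNorm, Finset.prod_eq_zero (Finset.mem_univ j) (by simp [h0]), mul_zero])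
  have hC : C₁ ^ Fintype.card ι * C₂ ^ Fintype.card κ ≤
      (C₁ * C₂) ^ (Fintype.card ι + Fintype.card κ) := by
    rw [pow_add]
    gcongr
    · nlinarith
    · nlinarith
  have hA : 0 ≤ ((Fintype.card ι + 2 * Fintype.card κ : ℕ) : ℝ) * (1 / 2 + e) := by positivity
  obtain ⟨CI, -, hI⟩ := exists_integral_logStepFourier_le hA one_pos
  have hIT := (hI T hT).1
  refine integral_mono_of_nonneg (.of_forall fun t => ?_) ?_ (.of_forall fun t => ?_)
  · exact mul_nonneg (norm_nonneg _) (mul_nonneg (Finset.prod_nonneg fun _ _ => norm_nonneg _)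
      (Finset.prod_nonneg fun _ _ => norm_nonneg _))
  · refine Integrable.const_mul (Integrable.const_mul ?_ _) _
    refine hIT.mul_bdd (c := 1) ?_ (.of_forall fun t => ?_)
    · exact (measurable_mixedEnvelope.comp (measurable_id.prodMk measurable_const)).aestronglyMeasurable
    · rw [Real.norm_of_nonneg (mixedEnvelope_nonneg t ξ)]
      exact mixedEnvelope_le_one t ξ
  · simp only
    have p1 : ∏ i, ‖𝓕 (twistedWeight (2 * π * finrank ℝ ℝ * t) : ℝ → ℂ) (ξ.1 i)‖ ≤
        ∏ i, C₁ * ((‖ξ.1 i‖ ^ finrank ℝ ℝ) ^ (-(1 + e)) *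
          ((1 + |t|) ^ finrank ℝ ℝ) ^ (1 / 2 + e) *
          envelope (finrank ℝ ℝ * ‖ξ.1 i‖ / (1 + 2 * π * finrank ℝ ℝ * |t|))) :=
      Finset.prod_le_prod (fun _ _ => norm_nonneg _) fun i _ =>
        h₁ t (ξ.1 i) (hξ1 i) ‖ξ.1 i‖ (by simp) e he he'
    have p2 : ∏ j, ‖𝓕 (twistedWeight (2 * π * finrank ℝ ℂ * t) : ℂ → ℂ) (2 * star (ξ.2 j))‖ ≤
        ∏ j, C₂ * ((‖ξ.2 j‖ ^ finrank ℝ ℂ) ^ (-(1 + e)) *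
          ((1 + |t|) ^ finrank ℝ ℂ) ^ (1 / 2 + e) *
          envelope (finrank ℝ ℂ * ‖ξ.2 j‖ / (1 + 2 * π * finrank ℝ ℂ * |t|))) :=
      Finset.prod_le_prod (fun _ _ => norm_nonneg _) fun j _ =>
        h₂ t (2 * star (ξ.2 j)) (by simpa using hξ2 j) ‖ξ.2 j‖ (by simp) e he he'
    have hτ : (1 + |t|) ^ (((Fintype.card ι + 2 * Fintype.card κ : ℕ) : ℝ) * (1 / 2 + e)) =
        (((1 + |t|) ^ finrank ℝ ℝ) ^ (1 / 2 + e)) ^ Fintype.card ι *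
          (((1 + |t|) ^ finrank ℝ ℂ) ^ (1 / 2 + e)) ^ Fintype.card κ := by
      have h0 : 0 ≤ 1 + |t| := by positivity
      rw [Real.rpow_mul h0, Real.rpow_natCast, pow_add, pow_mul,
        Real.mul_rpow (by positivity) (by positivity), finrank_self, pow_one,
        Complex.finrank_real_complex]
      congr 1
      · rw [← Real.rpow_natCast, ← Real.rpow_natCast, ← Real.rpow_mul h0, ← Real.rpow_mul h0,
          mul_comm]
      · rw [← Real.rpow_natCast, ← Real.rpow_natCast _ (Fintype.card κ),
          ← Real.rpow_mul (by positivity), ← Real.rpow_mul (by positivity), mul_comm]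
    calc _ ≤ ‖logStepFourier T t‖ * ((∏ i, C₁ * ((‖ξ.1 i‖ ^ finrank ℝ ℝ) ^ (-(1 + e)) *
          ((1 + |t|) ^ finrank ℝ ℝ) ^ (1 / 2 + e) *
          envelope (finrank ℝ ℝ * ‖ξ.1 i‖ / (1 + 2 * π * finrank ℝ ℝ * |t|)))) *
          ∏ j, C₂ * ((‖ξ.2 j‖ ^ finrank ℝ ℂ) ^ (-(1 + e)) *
          ((1 + |t|) ^ finrank ℝ ℂ) ^ (1 / 2 + e) *
          envelope (finrank ℝ ℂ * ‖ξ.2 j‖ / (1 + 2 * π * finrank ℝ ℂ * |t|)))) := by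
          refine mul_le_mul_of_nonneg_left (mul_le_mul p1 p2
            (Finset.prod_nonneg fun _ _ => norm_nonneg _) ?_) (norm_nonneg _)
          exact (Finset.prod_nonneg fun _ _ => norm_nonneg _).trans p1
      _ = (C₁ ^ Fintype.card ι * C₂ ^ Fintype.card κ) * (mixedNorm ξ ^ (-(1 + e)) *
          (‖logStepFourier T t‖ * (1 + |t|) ^
            (((Fintype.card ι + 2 * Fintype.card κ : ℕ) : ℝ) * (1 / 2 + e)) *
              mixedEnvelope t ξ)) := by
          rw [hτ, rpow_mixedNorm, mixedEnvelope]
          simp only [Finset.prod_mul_distrib, Finset.prod_const, Finset.card_univ]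
          ring
      _ ≤ _ := by
          refine mul_le_mul_of_nonneg_right hC (mul_nonneg (Real.rpow_nonneg ?_ _)
            (mul_nonneg (by positivity) (mixedEnvelope_nonneg t ξ)))
          exact mul_nonneg (Finset.prod_nonneg fun _ _ => norm_nonneg _)
            (Finset.prod_nonneg fun _ _ => sq_nonneg _)

end MixedFourier

section MixedSpace

open MeasureTheory Module Real NumberField NumberField.InfinitePlace NumberField.mixedEmbedding
open scoped Classical

variable {K : Type*} [Field K] [NumberField K]

/-- The sum of the coordinates of `s`, weighted by the local degrees. -/
noncomputable def degreeSum (s : InfinitePlace K → ℝ) : ℝ := ∑ w, (mult w : ℝ) * s w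

/-- Multiplication of the coordinate at `w` by `exp (s w)`. -/
noncomputable def placeScale (s : InfinitePlace K → ℝ) (v : mixedSpace K) : mixedSpace K :=
  (fun w => exp (s w.1) * v.1 w, fun w => (exp (s w.1) : ℂ) * v.2 w)

theorem degreeSum_add (s t : InfinitePlace K → ℝ) :
    degreeSum (s + t) = degreeSum s + degreeSum t := by
  simp [degreeSum, mul_add, Finset.sum_add_distrib]

theorem degreeSum_eq (s : InfinitePlace K → ℝ) :
    degreeSum s = (∑ w : {w : InfinitePlace K // IsReal w}, s w.1) +
      ∑ w : {w : InfinitePlace K // IsComplex w}, 2 * s w.1 := by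
  have := prod_eq_prod_mul_prod (α := Multiplicative ℝ)
    (fun w : InfinitePlace K => Multiplicative.ofAdd ((mult w : ℝ) * s w))
  have h := congrArg Multiplicative.toAdd this
  rw [toAdd_mul, toAdd_prod, toAdd_prod, toAdd_prod] at h
  simp only [toAdd_ofAdd] at h
  rw [degreeSum, h]
  congr 1
  · exact Finset.sum_congr rfl fun w _ => by rw [mult_isReal]; simp
  · exact Finset.sum_congr rfl fun w _ => by rw [mult_isComplex]; simp

theorem mixedNorm_eq_norm (v : mixedSpace K) : mixedNorm v = mixedEmbedding.norm v := by
  rw [mixedEmbedding.norm_apply, prod_eq_prod_mul_prod, mixedNorm]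
  congr 1
  · exact Finset.prod_congr rfl fun w _ => by
      rw [mult_isReal, pow_one, normAtPlace_apply_of_isReal w.2]
  · exact Finset.prod_congr rfl fun w _ => by
      rw [mult_isComplex, normAtPlace_apply_of_isComplex w.2]

theorem mixedNorm_mixedEmbedding (x : K) :
    mixedNorm (mixedEmbedding K x) = |(Algebra.norm ℚ x : ℝ)| := by
  rw [mixedNorm_eq_norm, norm_eq_norm]
  push_cast
  rfl

theorem mixedNorm_placeScale (s : InfinitePlace K → ℝ) (v : mixedSpace K) :
    mixedNorm (placeScale s v) = exp (degreeSum s) * mixedNorm v := by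
  rw [degreeSum_eq, exp_add, exp_sum, exp_sum, mixedNorm, mixedNorm, mul_mul_mul_comm,
    ← Finset.prod_mul_distrib, ← Finset.prod_mul_distrib]
  congr 1
  · exact Finset.prod_congr rfl fun w _ => by
      simp [placeScale]
  · refine Finset.prod_congr rfl fun w _ => ?_
    simp only [placeScale]
    rw [norm_mul, mul_pow, Complex.norm_real, norm_eq_abs, abs_exp, ← exp_nat_mul]
    norm_num

omit [NumberField K] in
theorem placeScale_zero (s : InfinitePlace K → ℝ) : placeScale s 0 = 0 := by
  ext <;> simp [placeScale]

omit [NumberField K] in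
theorem placeScale_add (s t : InfinitePlace K → ℝ) (v : mixedSpace K) :
    placeScale (s + t) v = placeScale s (placeScale t v) := by
  ext w
  · simp [placeScale, exp_add, mul_assoc]
  · simp only [placeScale, Pi.add_apply, Complex.ofReal_exp, Complex.ofReal_add, Complex.exp_add]
    ring

omit [NumberField K] in
theorem placeScale_zero_left (v : mixedSpace K) : placeScale 0 v = v := by
  ext w <;> simp [placeScale]

/-- `placeScale` as a linear equivalence. -/
noncomputable def placeScaleEquiv (s : InfinitePlace K → ℝ) : mixedSpace K ≃ₗ[ℝ] mixedSpace K where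
  toFun := placeScale s
  invFun := placeScale (-s)
  map_add' u v := by ext w <;> simp [placeScale, mul_add]
  map_smul' c v := by ext w <;> simp [placeScale] <;> ring
  left_inv v := by rw [← placeScale_add, neg_add_cancel, placeScale_zero_left]
  right_inv v := by rw [← placeScale_add, add_neg_cancel, placeScale_zero_left]

omit [NumberField K] in
theorem continuous_placeScale (s : InfinitePlace K → ℝ) : Continuous (placeScale s) := by
  unfold placeScale
  fun_prop

theorem det_placeScaleEquiv (s : InfinitePlace K → ℝ) :
    LinearMap.det (placeScaleEquiv s : mixedSpace K →ₗ[ℝ] mixedSpace K) = exp (degreeSum s) := by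
  have h : (placeScaleEquiv s : mixedSpace K →ₗ[ℝ] mixedSpace K) =
      LinearMap.prodMap
        (LinearMap.pi fun w : {w : InfinitePlace K // IsReal w} =>
          (exp (s w.1) • (LinearMap.id : ℝ →ₗ[ℝ] ℝ)).comp (LinearMap.proj w))
        (LinearMap.pi fun w : {w : InfinitePlace K // IsComplex w} =>
          (exp (s w.1) • (LinearMap.id : ℂ →ₗ[ℝ] ℂ)).comp (LinearMap.proj w)) := by
    ext v w <;> simp [placeScaleEquiv, placeScale]
  rw [h, LinearMap.det_prodMap, LinearMap.det_pi, LinearMap.det_pi, degreeSum_eq, exp_add, exp_sum,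
    exp_sum]
  simp only [LinearMap.det_smul, LinearMap.det_id, mul_one, finrank_self, pow_one,
    Complex.finrank_real_complex, ← exp_nat_mul, Nat.cast_ofNat]

theorem integral_comp_placeScale (s : InfinitePlace K → ℝ) (f : mixedSpace K → ℂ) :
    ∫ v, f (placeScale s v) = (exp (-degreeSum s) : ℂ) * ∫ v, f v := by
  have hd : LinearMap.det (placeScaleEquiv s : mixedSpace K →ₗ[ℝ] mixedSpace K) ≠ 0 := by
    rw [det_placeScaleEquiv]; exact (exp_pos _).ne'
  have h := Measure.map_linearMap_addHaar_eq_smul_addHaar (volume : Measure (mixedSpace K)) hd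
  have he : MeasurableEmbedding (placeScale s) :=
    ((placeScaleEquiv s).toContinuousLinearEquiv.toHomeomorph).measurableEmbedding
  have h2 := he.integral_map (μ := volume) f
  rw [← h2]
  have h3 : Measure.map (placeScale s) volume = ENNReal.ofReal (exp (-degreeSum s)) •
      (volume : Measure (mixedSpace K)) := by
    rw [det_placeScaleEquiv, ← exp_neg, abs_exp] at h
    exact h
  rw [h3, integral_smul_measure, ENNReal.toReal_ofReal (exp_pos _).le]
  simp

theorem mixedTrace_add (v ξ η : mixedSpace K) :
    mixedTrace v (ξ + η) = mixedTrace v ξ + mixedTrace v η := by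
  simp [mixedTrace, mul_add, Finset.sum_add_distrib]
  ring

theorem mixedTrace_comm (v ξ : mixedSpace K) : mixedTrace v ξ = mixedTrace ξ v := by
  simp [mixedTrace, mul_comm]

theorem mixedTrace_smul (c : ℝ) (v ξ : mixedSpace K) :
    mixedTrace v (c • ξ) = c * mixedTrace v ξ := by
  simp only [mixedTrace, Prod.smul_fst, Prod.smul_snd, Pi.smul_apply, smul_eq_mul, mul_add,
    Finset.mul_sum]
  congr 1
  · exact Finset.sum_congr rfl fun w _ => by ring
  · exact Finset.sum_congr rfl fun w _ => by
      simp only [Complex.real_smul, Complex.mul_re, Complex.mul_im, Complex.ofReal_re,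
        Complex.ofReal_im]
      ring

theorem mixedTrace_sum {ι : Type*} (t : Finset ι) (v : mixedSpace K) (ξ : ι → mixedSpace K) :
    mixedTrace v (∑ i ∈ t, ξ i) = ∑ i ∈ t, mixedTrace v (ξ i) := by
  let f : mixedSpace K →ₗ[ℝ] ℝ :=
    { toFun := mixedTrace v
      map_add' := mixedTrace_add v
      map_smul' := fun c ξ => mixedTrace_smul c v ξ }
  exact map_sum f ξ t

theorem mixedTrace_placeScale (s : InfinitePlace K → ℝ) (v ξ : mixedSpace K) :
    mixedTrace (placeScale s v) (placeScale (-s) ξ) = mixedTrace v ξ := by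
  simp only [mixedTrace, placeScale, Pi.neg_apply, exp_neg]
  congr 1
  · exact Finset.sum_congr rfl fun w _ => by
      have := (exp_pos (s w.1)).ne'
      field_simp
  · refine Finset.sum_congr rfl fun w _ => ?_
    have : (exp (s w.1) : ℂ) ≠ 0 := by exact_mod_cast (exp_pos (s w.1)).ne'
    congr 2
    push_cast
    push_cast at this
    field_simp

theorem mixedTrace_mixedEmbedding (x y : K) :
    mixedTrace (mixedEmbedding K x) (mixedEmbedding K y) = (Algebra.trace ℚ K (x * y) : ℝ) := by
  classical
  have h1 : ((Algebra.trace ℚ K (x * y) : ℚ) : ℂ) = ∑ φ : K →+* ℂ, φ (x * y) := by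
    have := trace_eq_sum_embeddings (K := ℚ) (L := K) ℂ (x := x * y)
    rw [eq_ratCast] at this
    rw [this]
    exact Fintype.sum_equiv (RingHom.equivRatAlgHom (R := K) (S := ℂ)).symm _ _ fun _ => rfl
  have h2 : (Algebra.trace ℚ K (x * y) : ℝ) = ∑ φ : K →+* ℂ, (φ (x * y)).re := by
    rw [← Complex.re_sum, ← h1]
    simp
  rw [h2, ← Finset.sum_fiberwise Finset.univ InfinitePlace.mk]
  have h3 : ∀ w : InfinitePlace K,
      ∑ φ ∈ Finset.univ.filter (fun φ : K →+* ℂ => InfinitePlace.mk φ = w), (φ (x * y)).re =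
        mult w * (w.embedding (x * y)).re := by
    intro w
    rw [← card_filter_mk_eq w, ← nsmul_eq_mul, ← Finset.sum_const]
    refine Finset.sum_congr (by congr) fun φ hφ => ?_
    have hφ' := (Finset.mem_filter.1 hφ).2
    rw [← mk_embedding w, mk_eq_iff] at hφ'
    rcases hφ' with h | h
    · rw [h]
    · rw [← h, ComplexEmbedding.conjugate_coe_eq, Complex.conj_re]
  rw [Finset.sum_congr rfl fun w _ => h3 w]
  have := degreeSum_eq (fun w : InfinitePlace K => (w.embedding (x * y)).re)
  rw [degreeSum] at this
  rw [this, mixedTrace]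
  congr 1
  · refine Finset.sum_congr rfl fun w _ => ?_
    rw [mixedEmbedding_apply_isReal, mixedEmbedding_apply_isReal, ← map_mul,
      ← embedding_of_isReal_apply w.2, Complex.ofReal_re]
  · refine Finset.sum_congr rfl fun w _ => ?_
    rw [mixedEmbedding_apply_isComplex, mixedEmbedding_apply_isComplex, ← map_mul]

theorem integral_comp_basis_equivFun {ι : Type*} [Fintype ι] (b : Basis ι ℝ (mixedSpace K))
    (f : mixedSpace K → ℂ) :
    ∫ c : ι → ℝ, f (∑ i, c i • b i) =
      ((volume.real (ZSpan.fundamentalDomain b))⁻¹ : ℂ) * ∫ v, f v := by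
  classical
  have he : MeasurableEmbedding (b.equivFun.symm : (ι → ℝ) → mixedSpace K) :=
    (b.equivFun.symm.toContinuousLinearEquiv.toHomeomorph).measurableEmbedding
  have hmap : Measure.map b.equivFun.symm volume = b.addHaar := by
    have h1 : (Pi.basisFun ℝ ι).map b.equivFun.symm = b := by
      ext1 i
      simp
    have h2 := (Pi.basisFun ℝ ι).map_addHaar b.equivFun.symm.toContinuousLinearEquiv
    rw [show (Pi.basisFun ℝ ι).map b.equivFun.symm.toContinuousLinearEquiv.toLinearEquiv = b
      from h1] at h2
    have h3 : (Pi.basisFun ℝ ι).addHaar = volume := by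
      rw [Basis.addHaar, Basis.parallelepiped_basisFun, addHaarMeasure_eq_volume_pi]
    rw [← h2, h3]
    rfl
  have hv : (volume : Measure (mixedSpace K)) =
      volume (ZSpan.fundamentalDomain b) • b.addHaar := by
    rw [measure_congr (ZSpan.fundamentalDomain_ae_parallelepiped b volume), Basis.addHaar_def]
    exact Measure.addHaarMeasure_unique volume b.parallelepiped
  have h4 := he.integral_map (μ := volume) f
  simp only [Basis.equivFun_symm_apply] at h4
  have h5 : ∫ v, f v = (volume (ZSpan.fundamentalDomain b)).toReal • ∫ v, f v ∂b.addHaar := by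
    conv_lhs => rw [hv, integral_smul_measure]
  have hne : (volume (ZSpan.fundamentalDomain b)).toReal ≠ 0 := by
    rw [ENNReal.toReal_ne_zero]
    exact ⟨ZSpan.measure_fundamentalDomain_ne_zero b,
      (ZSpan.fundamentalDomain_isBounded b).measure_lt_top.ne⟩
  rw [← h4, hmap, h5, measureReal_def, Complex.real_smul, ← mul_assoc,
    inv_mul_cancel₀ (by exact_mod_cast hne), one_mul]

end MixedSpace

section IdealPoisson

open MeasureTheory Module Real NumberField NumberField.InfinitePlace NumberField.mixedEmbedding
open scoped Classical ENNReal

variable {K : Type*} [Field K] [NumberField K]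

/-- The dual of a fractional ideal for the trace form. -/
noncomputable def dualIdeal (𝔞 : (FractionalIdeal (𝓞 K)⁰ K)ˣ) : (FractionalIdeal (𝓞 K)⁰ K)ˣ :=
  Units.mk0 (FractionalIdeal.dual ℤ ℚ (𝔞 : FractionalIdeal (𝓞 K)⁰ K))
    (FractionalIdeal.dual_ne_zero ℤ ℚ 𝔞.ne_zero)

/-- The nonzero elements of a fractional ideal. -/
def nonzeroElements (𝔞 : (FractionalIdeal (𝓞 K)⁰ K)ˣ) : Set K :=
  {α | α ∈ (𝔞 : FractionalIdeal (𝓞 K)⁰ K) ∧ α ≠ 0}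

theorem mem_span_basis_iff {ι : Type*} [Fintype ι] (b : Basis ι ℚ K) (x : K) :
    x ∈ Submodule.span ℤ (Set.range b) ↔ ∃ m : ι → ℤ, ∑ i, m i • b i = x :=
  Submodule.mem_span_range_iff_exists_fun ℤ

theorem basis_intComb_injective {ι : Type*} [Fintype ι] (b : Basis ι ℚ K) :
    Function.Injective fun m : ι → ℤ => ∑ i, m i • b i := by
  intro m m' h
  have h' : b.equivFun.symm (fun i => (m i : ℚ)) = b.equivFun.symm (fun i => (m' i : ℚ)) := by
    rw [Basis.equivFun_symm_apply, Basis.equivFun_symm_apply]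
    simpa only [Int.cast_smul_eq_zsmul] using h
  ext i
  exact_mod_cast congrFun (b.equivFun.symm.injective h') i

/-- Nonzero coordinate vectors correspond to the nonzero elements of a fractional ideal. -/
noncomputable def nonzeroElementsEquiv {ι : Type*} [Fintype ι] (b : Basis ι ℚ K)
    (𝔞 : (FractionalIdeal (𝓞 K)⁰ K)ˣ)
    (hb : ∀ x, x ∈ Submodule.span ℤ (Set.range b) ↔ x ∈ (𝔞 : FractionalIdeal (𝓞 K)⁰ K)) :
    {m : ι → ℤ // m ≠ 0} ≃ nonzeroElements 𝔞 :=
  Equiv.ofBijective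
    (fun m => ⟨∑ i, m.1 i • b i, (hb _).1 ((mem_span_basis_iff b _).2 ⟨m, rfl⟩), fun h =>
      m.2 (basis_intComb_injective b (by simpa using h))⟩)
    ⟨fun m m' h => Subtype.ext (basis_intComb_injective b (congrArg Subtype.val h)), fun x => by
      obtain ⟨m, hm⟩ := (mem_span_basis_iff b _).1 ((hb _).2 x.2.1)
      refine ⟨⟨m, fun h0 => x.2.2 ?_⟩, Subtype.ext hm⟩
      rw [← hm, h0]
      simp⟩

theorem coe_nonzeroElementsEquiv {ι : Type*} [Fintype ι] (b : Basis ι ℚ K)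
    (𝔞 : (FractionalIdeal (𝓞 K)⁰ K)ˣ)
    (hb : ∀ x, x ∈ Submodule.span ℤ (Set.range b) ↔ x ∈ (𝔞 : FractionalIdeal (𝓞 K)⁰ K))
    (m : {m : ι → ℤ // m ≠ 0}) :
    (nonzeroElementsEquiv b 𝔞 hb m : K) = ∑ i, m.1 i • b i := rfl

theorem mem_span_traceDual_iff (𝔞 : (FractionalIdeal (𝓞 K)⁰ K)ˣ) (x : K) :
    x ∈ Submodule.span ℤ (Set.range (basisOfFractionalIdeal K 𝔞).traceDual) ↔
      x ∈ (dualIdeal 𝔞 : FractionalIdeal (𝓞 K)⁰ K) := by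
  have h : ((𝔞 : FractionalIdeal (𝓞 K)⁰ K) : Submodule (𝓞 K) K).restrictScalars ℤ =
      Submodule.span ℤ (Set.range (basisOfFractionalIdeal K 𝔞)) := by
    ext y
    rw [mem_span_basisOfFractionalIdeal]
    rfl
  rw [← Submodule.traceDual_span_of_basis ℤ _ _ h, dualIdeal, Units.val_mk0,
    ← FractionalIdeal.mem_coe, FractionalIdeal.coe_dual ℤ ℚ 𝔞.ne_zero]
  rfl

theorem latticeChar_eq_mixedChar (𝔞 : (FractionalIdeal (𝓞 K)⁰ K)ˣ)
    (m : Free.ChooseBasisIndex ℤ 𝔞 → ℤ) (c : Free.ChooseBasisIndex ℤ 𝔞 → ℝ) :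
    latticeChar m c =
      mixedChar (mixedEmbedding K (∑ i, m i • (basisOfFractionalIdeal K 𝔞).traceDual i))
        (∑ i, c i • fractionalIdealLatticeBasis K 𝔞 i) := by
  have h0 : ∑ i, (m i : ℝ) * c i = mixedTrace (∑ i, c i • fractionalIdealLatticeBasis K 𝔞 i)
      (mixedEmbedding K (∑ i, m i • (basisOfFractionalIdeal K 𝔞).traceDual i)) := by
    rw [mixedTrace_comm, mixedTrace_sum]
    refine Finset.sum_congr rfl fun i _ => ?_
    have h : ∀ j, Algebra.trace ℚ K (m j • (basisOfFractionalIdeal K 𝔞).traceDual j *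
        basisOfFractionalIdeal K 𝔞 i) = if i = j then (m j : ℚ) else 0 := by
      intro j
      rw [smul_mul_assoc, map_zsmul, Basis.trace_traceDual_mul, zsmul_eq_mul, mul_ite, mul_one,
        mul_zero]
    rw [mixedTrace_smul, fractionalIdealLatticeBasis_apply, mixedTrace_mixedEmbedding, Finset.sum_mul,
      map_sum]
    simp only [h, Finset.sum_ite_eq, Finset.mem_univ, if_true]
    push_cast
    ring
  rw [latticeChar, mixedChar, h0]
  push_cast
  rfl

/-- Poisson summation over a fractional ideal, as an estimate. -/
theorem poisson_fractionalIdeal (𝔞 : (FractionalIdeal (𝓞 K)⁰ K)ˣ) {f : mixedSpace K → ℝ}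
    (hc : Continuous f) (hs : HasCompactSupport f) (hf : ∀ v, 0 ≤ f v) (h0 : f 0 = 0)
    {V : ℝ} (hV : V = (volume.real (ZSpan.fundamentalDomain (fractionalIdealLatticeBasis K 𝔞)))⁻¹) :
    (∑' α : nonzeroElements 𝔞, ENNReal.ofReal (f (mixedEmbedding K α)) ≤
      ENNReal.ofReal V * (ENNReal.ofReal (∫ v, f v) +
        ∑' β : nonzeroElements (dualIdeal 𝔞), ‖∫ v, mixedChar (mixedEmbedding K β) v * f v‖ₑ)) ∧
    ENNReal.ofReal V * ENNReal.ofReal (∫ v, f v) ≤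
      ∑' α : nonzeroElements 𝔞, ENNReal.ofReal (f (mixedEmbedding K α)) +
        ENNReal.ofReal V *
          ∑' β : nonzeroElements (dualIdeal 𝔞), ‖∫ v, mixedChar (mixedEmbedding K β) v * f v‖ₑ := by
  set b := fractionalIdealLatticeBasis K 𝔞 with hb
  have hVpos : 0 < V := by
    rw [hV, inv_pos, measureReal_def]
    exact ENNReal.toReal_pos (ZSpan.measure_fundamentalDomain_ne_zero b)
      (ZSpan.fundamentalDomain_isBounded b).measure_lt_top.ne
  set D := ∑' β : nonzeroElements (dualIdeal 𝔞), ‖∫ v, mixedChar (mixedEmbedding K β) v * f v‖ₑ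
    with hD
  have hVne : ENNReal.ofReal V ≠ 0 := by simpa using hVpos
  rcases eq_or_ne D ⊤ with hDt | hDt
  · rw [hDt]
    simp [ENNReal.mul_top hVne]
  let F : (Free.ChooseBasisIndex ℤ 𝔞 → ℝ) → ℂ := fun c => (f (∑ i, c i • b i) : ℂ)
  let L : (Free.ChooseBasisIndex ℤ 𝔞 → ℝ) ≃ₜ mixedSpace K :=
    b.equivFun.symm.toContinuousLinearEquiv.toHomeomorph
  have hL : ∀ c, L c = ∑ i, c i • b i := fun c => b.equivFun_symm_apply c
  have hFc : Continuous F := by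
    have : Continuous fun c => (f (L c) : ℂ) := by fun_prop
    simpa only [hL] using this
  have hFs : HasCompactSupport F := by
    have h1 : HasCompactSupport (f ∘ L) := hs.comp_homeomorph L
    have h2 : HasCompactSupport fun c => ((f ∘ L) c : ℂ) :=
      h1.comp_left (g := Complex.ofReal) (by simp)
    simpa only [Function.comp, hL] using h2
  let β : (Free.ChooseBasisIndex ℤ 𝔞 → ℤ) → K := fun m =>
    ∑ i, m i • (basisOfFractionalIdeal K 𝔞).traceDual i
  have hcoef : ∀ m, ∫ c, latticeChar m c * F c =
      V * ∫ v, mixedChar (mixedEmbedding K (β m)) v * f v := by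
    intro m
    rw [hV]
    push_cast
    rw [← integral_comp_basis_equivFun b]
    refine integral_congr_ae (Filter.Eventually.of_forall fun c => ?_)
    simp only [F, latticeChar_eq_mixedChar, β, hb]
  have hD' : D = ∑' m : {m : Free.ChooseBasisIndex ℤ 𝔞 → ℤ // m ≠ 0},
      ‖∫ v, mixedChar (mixedEmbedding K (β m)) v * f v‖ₑ := by
    rw [hD]
    exact (Equiv.tsum_eq (nonzeroElementsEquiv _ (dualIdeal 𝔞) (mem_span_traceDual_iff 𝔞)) _).symm
  have hVD : ENNReal.ofReal V * D = ∑' m : {m : Free.ChooseBasisIndex ℤ 𝔞 → ℤ // m ≠ 0},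
      ‖∫ c, latticeChar m.1 c * F c‖ₑ := by
    rw [hD', ← ENNReal.tsum_mul_left]
    refine tsum_congr fun m => ?_
    rw [hcoef, enorm_mul, ← ofReal_norm (V : ℂ), Complex.norm_real, norm_eq_abs,
      abs_of_pos hVpos]
  have hVDt : ENNReal.ofReal V * D ≠ ⊤ := ENNReal.mul_ne_top ENNReal.ofReal_ne_top hDt
  have hsum' : Summable fun m : {m : Free.ChooseBasisIndex ℤ 𝔞 → ℤ // m ≠ 0} =>
      ‖∫ c, latticeChar m.1 c * F c‖ := by
    rw [hVD] at hVDt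
    have := ENNReal.summable_toReal hVDt
    simpa using this
  have hsum : Summable fun m => ∫ c, latticeChar m c * F c := by
    have : Summable ((fun m => ∫ c, latticeChar m c * F c) ∘
        ((↑) : ↥({0}ᶜ : Set (Free.ChooseBasisIndex ℤ 𝔞 → ℤ)) → _)) := hsum'.of_norm
    exact (Set.finite_singleton _).summable_compl_iff.1 this
  have hP := hasSum_latticeChar_integral hFc hFs hsum
  have hzero : ∫ c, latticeChar 0 c * F c = ((V * ∫ v, f v : ℝ) : ℂ) := by
    rw [hcoef]
    have : ∀ v, mixedChar (mixedEmbedding K (β 0)) v = 1 := by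
      intro v
      have h1 : β 0 = 0 := by simp [β]
      rw [h1, map_zero, mixedChar]
      simp [mixedTrace]
    simp only [this, one_mul]
    rw [integral_complex_ofReal]
    push_cast
    rfl
  have hfin : (Function.support fun m : Free.ChooseBasisIndex ℤ 𝔞 → ℤ =>
      f (∑ i, (m i : ℝ) • b i)).Finite := by
    have := finite_support_translates hFs 0
    refine this.subset fun m hm => ?_
    have h1 : f (∑ i, (m i : ℝ) • b i) ≠ 0 := hm
    simpa [F] using h1
  set S := ∑ᶠ m : Free.ChooseBasisIndex ℤ 𝔞 → ℤ, f (∑ i, (m i : ℝ) • b i) with hSdef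
  have hS : (∑ᶠ m : Free.ChooseBasisIndex ℤ 𝔞 → ℤ, F fun i => (m i : ℝ)) = (S : ℂ) := by
    rw [hSdef, finsum_eq_sum_of_support_subset (fun m : Free.ChooseBasisIndex ℤ 𝔞 → ℤ =>
      f (∑ i, (m i : ℝ) • b i)) (s := hfin.toFinset) (by simp),
      finsum_eq_sum_of_support_subset _ (s := hfin.toFinset)]
    · push_cast
      rfl
    · intro m hm
      simpa [F] using hm
  have hS0 : 0 ≤ S := finsum_nonneg fun m => hf _
  have hSum : ∑' α : nonzeroElements 𝔞, ENNReal.ofReal (f (mixedEmbedding K α)) =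
      ENNReal.ofReal S := by
    rw [← Equiv.tsum_eq (nonzeroElementsEquiv (basisOfFractionalIdeal K 𝔞) 𝔞
      fun x => mem_span_basisOfFractionalIdeal K)]
    have h1 : ∀ m : Free.ChooseBasisIndex ℤ 𝔞 → ℤ,
        mixedEmbedding K (∑ i, m i • basisOfFractionalIdeal K 𝔞 i) = ∑ i, (m i : ℝ) • b i := by
      intro m
      rw [map_sum]
      refine Finset.sum_congr rfl fun i _ => ?_
      rw [map_zsmul, hb, fractionalIdealLatticeBasis_apply, Int.cast_smul_eq_zsmul]
    simp only [coe_nonzeroElementsEquiv, h1]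
    have h2 := tsum_subtype_eq_of_support_subset
      (f := fun m : Free.ChooseBasisIndex ℤ 𝔞 → ℤ => ENNReal.ofReal (f (∑ i, (m i : ℝ) • b i)))
      (s := {m | m ≠ 0}) (by
        intro m hm h
        have h' : m = 0 := h
        exact hm (by simp [h', h0]))
    refine h2.trans ?_
    rw [tsum_eq_sum (s := hfin.toFinset), hSdef,
      finsum_eq_sum_of_support_subset _ (s := hfin.toFinset) (by simp),
      ENNReal.ofReal_sum_of_nonneg fun m _ => hf _]
    intro m hm
    have : f (∑ i, (m i : ℝ) • b i) = 0 := by simpa using hm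
    rw [this, ENNReal.ofReal_zero]
  have hbound : ‖((S - V * ∫ v, f v : ℝ) : ℂ)‖ₑ ≤ ENNReal.ofReal V * D := by
    have h1 : HasSum (fun m : {m : Free.ChooseBasisIndex ℤ 𝔞 → ℤ // m ≠ 0} =>
        ∫ c, latticeChar m.1 c * F c) ((S - V * ∫ v, f v : ℝ) : ℂ) := by
      have h2 := (hasSum_unique fun m : ({0} : Set (Free.ChooseBasisIndex ℤ 𝔞 → ℤ)) =>
        ∫ c, latticeChar m.1 c * F c).hasSum_iff_compl
          (f := fun m => ∫ c, latticeChar m c * F c).1 hP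
      rw [hS] at h2
      have h3 : ∫ c, latticeChar
          (default : ({0} : Set (Free.ChooseBasisIndex ℤ 𝔞 → ℤ))).1 c * F c = _ := hzero
      rw [h3, ← Complex.ofReal_sub] at h2
      exact h2
    rw [hVD, ← h1.tsum_eq]
    exact enorm_tsum_le_tsum_enorm
  rw [hSum, mul_add]
  rw [← ofReal_norm, Complex.norm_real, norm_eq_abs] at hbound
  have hI : 0 ≤ V * ∫ v, f v := mul_nonneg hVpos.le (integral_nonneg hf)
  rw [← ENNReal.ofReal_mul hVpos.le]
  constructor
  · calc ENNReal.ofReal S ≤ ENNReal.ofReal ((V * ∫ v, f v) + |S - V * ∫ v, f v|) :=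
        ENNReal.ofReal_le_ofReal (by linarith [le_abs_self (S - V * ∫ v, f v)])
      _ = ENNReal.ofReal (V * ∫ v, f v) + ENNReal.ofReal |S - V * ∫ v, f v| :=
        ENNReal.ofReal_add hI (abs_nonneg _)
      _ ≤ _ := by gcongr
  · calc ENNReal.ofReal (V * ∫ v, f v) ≤ ENNReal.ofReal (S + |S - V * ∫ v, f v|) :=
        ENNReal.ofReal_le_ofReal (by linarith [neg_abs_le (S - V * ∫ v, f v)])
      _ = ENNReal.ofReal S + ENNReal.ofReal |S - V * ∫ v, f v| :=
        ENNReal.ofReal_add hS0 (abs_nonneg _)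
      _ ≤ _ := by gcongr

end IdealPoisson

section IdealClasses

open Module NumberField NumberField.InfinitePlace

variable {K : Type*} [Field K] [NumberField K] {X : Type*}

theorem unit_mul_mem_nonzeroElements (𝔞 : (FractionalIdeal (𝓞 K)⁰ K)ˣ) (u : (𝓞 K)ˣ) {α : K}
    (h : α ∈ nonzeroElements 𝔞) : (u : K) * α ∈ nonzeroElements 𝔞 := by
  refine ⟨?_, mul_ne_zero (by simp) h.2⟩
  have := Submodule.smul_mem ((𝔞 : FractionalIdeal (𝓞 K)⁰ K) : Submodule (𝓞 K) K) (u : 𝓞 K) h.1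
  rwa [Algebra.smul_def] at this

theorem exists_generator (𝔞 : X → (FractionalIdeal (𝓞 K)⁰ K)ˣ)
    (h : Function.Surjective fun x => ClassGroup.mk K (𝔞 x)) (J : (Ideal (𝓞 K))⁰) :
    ∃ p : Σ x, nonzeroElements (𝔞 x), FractionalIdeal.spanSingleton (𝓞 K)⁰ (p.2 : K) =
      (J : Ideal (𝓞 K)) * (𝔞 p.1 : FractionalIdeal (𝓞 K)⁰ K) := by
  obtain ⟨x, hx⟩ := h (ClassGroup.mk0 J)⁻¹
  have h1 : ClassGroup.mk K (FractionalIdeal.mk0 K J * 𝔞 x) = 1 := by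
    rw [map_mul, ClassGroup.mk_mk0]
    exact mul_eq_one_iff_inv_eq.2 hx.symm
  rw [ClassGroup.mk_eq_one_iff, FractionalIdeal.isPrincipal_iff] at h1
  obtain ⟨α, hα⟩ := h1
  rw [Units.val_mul, FractionalIdeal.coe_mk0] at hα
  refine ⟨⟨x, ⟨α, ?_, ?_⟩⟩, hα.symm⟩
  · have h2 : α ∈ FractionalIdeal.spanSingleton (𝓞 K)⁰ α :=
      FractionalIdeal.mem_spanSingleton_self _ _
    rw [← hα] at h2
    have h3 : ((J : Ideal (𝓞 K)) : FractionalIdeal (𝓞 K)⁰ K) * (𝔞 x : FractionalIdeal (𝓞 K)⁰ K) ≤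
        𝔞 x := mul_le_of_le_one_left' FractionalIdeal.coeIdeal_le_one
    exact h3 h2
  · rintro rfl
    rw [FractionalIdeal.spanSingleton_zero] at hα
    have : FractionalIdeal.mk0 K J * 𝔞 x ≠ (0 : FractionalIdeal (𝓞 K)⁰ K) :=
      (FractionalIdeal.mk0 K J * 𝔞 x).ne_zero
    exact this hα

/-- The nonzero elements of a system of representatives of the ideal classes correspond to pairs of
an integral ideal and a unit. -/
theorem exists_generator_equiv (𝔞 : X → (FractionalIdeal (𝓞 K)⁰ K)ˣ)
    (h : Function.Bijective fun x => ClassGroup.mk K (𝔞 x)) :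
    ∃ (g : (Ideal (𝓞 K))⁰ → Σ x, nonzeroElements (𝔞 x))
      (e : (Ideal (𝓞 K))⁰ × (𝓞 K)ˣ ≃ Σ x, nonzeroElements (𝔞 x)),
      (∀ J, |(Algebra.norm ℚ ((g J).2 : K) : ℝ)| =
        Ideal.absNorm (J : Ideal (𝓞 K)) * (FractionalIdeal.absNorm (𝔞 (g J).1).1 : ℝ)) ∧
      ∀ J u, e (J, u) = ⟨(g J).1, ⟨(u : K) * (g J).2,
        unit_mul_mem_nonzeroElements _ u (g J).2.2⟩⟩ := by
  choose g hg using exists_generator 𝔞 h.2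
  have hspan : ∀ (u : (𝓞 K)ˣ) (α : K), FractionalIdeal.spanSingleton (𝓞 K)⁰ ((u : K) * α) =
      FractionalIdeal.spanSingleton (𝓞 K)⁰ α := fun u α =>
    (FractionalIdeal.spanSingleton_eq_spanSingleton.2 ⟨u, by
      rw [Units.smul_def, Algebra.smul_def]⟩).symm
  let f : (Ideal (𝓞 K))⁰ × (𝓞 K)ˣ → Σ x, nonzeroElements (𝔞 x) := fun p =>
    ⟨(g p.1).1, ⟨(p.2 : K) * (g p.1).2, unit_mul_mem_nonzeroElements _ p.2 (g p.1).2.2⟩⟩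
  have hspan' : ∀ p, FractionalIdeal.spanSingleton (𝓞 K)⁰ ((f p).2 : K) =
      (p.1 : Ideal (𝓞 K)) * (𝔞 (f p).1 : FractionalIdeal (𝓞 K)⁰ K) := fun p => by
    rw [← hg p.1]
    exact hspan _ _
  have hf : Function.Bijective f := by
    constructor
    · rintro ⟨J, u⟩ ⟨J', u'⟩ he
      have h1 := hspan' (J, u)
      rw [he, hspan' (J', u')] at h1
      have h2 : J' = J := by
        have := (mul_left_inj' (𝔞 (f (J', u')).1).ne_zero).1 h1
        exact Subtype.ext (FractionalIdeal.coeIdeal_injective this)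
      subst h2
      have h3 : (u : K) * (g J').2 = (u' : K) * (g J').2 := by
        have : (f (J', u)).2 = (f (J', u')).2 := by
          simpa [f] using he
        exact congrArg Subtype.val this
      have h4 := mul_right_cancel₀ (g J').2.2.2 h3
      have h5 : u = u' := Units.ext (RingOfIntegers.ext h4)
      rw [h5]
    · rintro ⟨x, α, hα⟩
      let v : (FractionalIdeal (𝓞 K)⁰ K)ˣ := Units.mk0 (FractionalIdeal.spanSingleton (𝓞 K)⁰ α)
        (FractionalIdeal.spanSingleton_ne_zero_iff.2 hα.2) * (𝔞 x)⁻¹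
      have hv : (v : FractionalIdeal (𝓞 K)⁰ K) * 𝔞 x =
          FractionalIdeal.spanSingleton (𝓞 K)⁰ α := by
        simp [v]
      have hle : (v : FractionalIdeal (𝓞 K)⁰ K) ≤ 1 := by
        have h1 : FractionalIdeal.spanSingleton (𝓞 K)⁰ α ≤ 𝔞 x :=
          FractionalIdeal.spanSingleton_le_iff_mem.2 hα.1
        have h2 : FractionalIdeal.spanSingleton (𝓞 K)⁰ α * (𝔞 x)⁻¹ ≤
            (𝔞 x : FractionalIdeal (𝓞 K)⁰ K) * (𝔞 x)⁻¹ := mul_le_mul_left h1 _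
        simpa [v] using h2
      obtain ⟨I, hI⟩ := FractionalIdeal.le_one_iff_exists_coeIdeal.1 hle
      have hI0 : I ∈ (Ideal (𝓞 K))⁰ := by
        rw [mem_nonZeroDivisors_iff_ne_zero]
        rintro rfl
        exact v.ne_zero (by rw [← hI]; simp)
      let J : (Ideal (𝓞 K))⁰ := ⟨I, hI0⟩
      have hJ : FractionalIdeal.mk0 K J = v := Units.ext hI
      have hx : (g J).1 = x := by
        apply h.1
        have e1 : ClassGroup.mk K (FractionalIdeal.mk0 K J * 𝔞 (g J).1) = 1 := by
          rw [ClassGroup.mk_eq_one_iff, FractionalIdeal.isPrincipal_iff]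
          exact ⟨_, (hg J).symm⟩
        have e2 : ClassGroup.mk K (FractionalIdeal.mk0 K J * 𝔞 x) = 1 := by
          rw [ClassGroup.mk_eq_one_iff, FractionalIdeal.isPrincipal_iff, hJ]
          exact ⟨α, hv⟩
        rw [map_mul] at e1 e2
        exact mul_left_cancel (e1.trans e2.symm)
      subst hx
      have h1 : FractionalIdeal.spanSingleton (𝓞 K)⁰ ((g J).2 : K) =
          FractionalIdeal.spanSingleton (𝓞 K)⁰ α := by
        rw [hg J, ← hv, ← hI]
      obtain ⟨u, hu⟩ := FractionalIdeal.spanSingleton_eq_spanSingleton.1 h1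
      refine ⟨(J, u), ?_⟩
      simp only [f]
      congr 2
  refine ⟨g, Equiv.ofBijective f hf, fun J => ?_, fun J u => rfl⟩
  have h1 := congrArg FractionalIdeal.absNorm (hg J)
  rw [FractionalIdeal.absNorm_span_singleton, map_mul, FractionalIdeal.coeIdeal_absNorm] at h1
  exact_mod_cast h1

end IdealClasses

section UnitUnfolding

open MeasureTheory Module Real NumberField NumberField.InfinitePlace NumberField.Units
  NumberField.Units.dirichletUnitTheorem
open scoped Classical ENNReal

variable {K : Type*} [Field K] [NumberField K]

/-- The logarithms of the absolute values of an element. -/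
noncomputable def logPlaces (α : K) (w : InfinitePlace K) : ℝ := log (w α)

omit [NumberField K] in
theorem logPlaces_mul {α β : K} (hα : α ≠ 0) (hβ : β ≠ 0) :
    logPlaces (α * β) = logPlaces α + logPlaces β := by
  ext w
  simp [logPlaces, log_mul ((map_ne_zero w).2 hα) ((map_ne_zero w).2 hβ)]

variable (K) in
/-- The projection to the logarithmic space of the units. -/
noncomputable def toLogSpace : (InfinitePlace K → ℝ) →L[ℝ] logSpace K :=
  ContinuousLinearMap.pi fun w => (mult w.1 : ℝ) • ContinuousLinearMap.proj w.1

theorem toLogSpace_apply (s : InfinitePlace K → ℝ) (w : {w : InfinitePlace K // w ≠ w₀}) :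
    toLogSpace K s w = mult w.1 * s w.1 := rfl

theorem toLogSpace_logPlaces (u : (𝓞 K)ˣ) :
    toLogSpace K (logPlaces (u : K)) = logEmbedding K (Additive.ofMul u) := rfl

variable (K) in
/-- A basis of the logarithmic space generating the unit lattice. -/
noncomputable def unitLatticeRealBasis : Basis (Fin (rank K)) ℝ (logSpace K) :=
  (basisUnitLattice K).ofZLatticeBasis ℝ (unitLattice K)

theorem span_unitLatticeRealBasis :
    Submodule.span ℤ (Set.range (unitLatticeRealBasis K)) = unitLattice K :=
  (basisUnitLattice K).ofZLatticeBasis_span ℝ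

variable (K) in
/-- A fundamental domain for the action of the units modulo torsion. -/
def unitDomain : Set (InfinitePlace K → ℝ) :=
  toLogSpace K ⁻¹' ZSpan.fundamentalDomain (unitLatticeRealBasis K)

theorem measurableSet_unitDomain : MeasurableSet (unitDomain K) :=
  (toLogSpace K).continuous.measurable (ZSpan.fundamentalDomain_measurableSet _)

theorem card_unit_translates (s : InfinitePlace K → ℝ) :
    {u : (𝓞 K)ˣ | s - logPlaces (u : K) ∈ unitDomain K}.encard = torsionOrder K := by
  obtain ⟨v, hv, huniq⟩ :=
    ZSpan.exist_unique_vadd_mem_fundamentalDomain (unitLatticeRealBasis K) (toLogSpace K s)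
  have hmem : ∀ u : (𝓞 K)ˣ, -logEmbedding K (Additive.ofMul u) ∈
      Submodule.span ℤ (Set.range (unitLatticeRealBasis K)) := fun u => by
    rw [span_unitLatticeRealBasis]
    exact neg_mem ⟨Additive.ofMul u, trivial, rfl⟩
  obtain ⟨u₀, hu₀⟩ : ∃ u₀ : (𝓞 K)ˣ, logEmbedding K (Additive.ofMul u₀) = -(v : logSpace K) := by
    have h1 : -(v : logSpace K) ∈ unitLattice K := by
      rw [← span_unitLatticeRealBasis]
      exact neg_mem v.2
    obtain ⟨u, -, hu⟩ := h1
    exact ⟨u.toMul, hu⟩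
  have hiff : ∀ u : (𝓞 K)ˣ, s - logPlaces (u : K) ∈ unitDomain K ↔
      logEmbedding K (Additive.ofMul u) = logEmbedding K (Additive.ofMul u₀) := by
    intro u
    have e : toLogSpace K (s - logPlaces (u : K)) =
        -logEmbedding K (Additive.ofMul u) + toLogSpace K s := by
      rw [map_sub, toLogSpace_logPlaces]
      abel
    constructor
    · intro h
      have h1 := huniq ⟨_, hmem u⟩ (by
        rw [unitDomain, Set.mem_preimage, e] at h
        exact h)
      rw [hu₀, ← h1, neg_neg]
    · intro h
      rw [unitDomain, Set.mem_preimage, e, h, hu₀, neg_neg]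
      exact hv
  have hset : {u : (𝓞 K)ˣ | s - logPlaces (u : K) ∈ unitDomain K} =
      (fun ζ : (𝓞 K)ˣ => u₀ * ζ) '' (torsion K : Set (𝓞 K)ˣ) := by
    ext u
    rw [Set.mem_image]
    change s - logPlaces (u : K) ∈ unitDomain K ↔ _
    rw [hiff]
    constructor
    · intro h
      refine ⟨u₀⁻¹ * u, ?_, mul_inv_cancel_left _ _⟩
      rw [SetLike.mem_coe, ← logEmbedding_eq_zero_iff, ofMul_mul, ofMul_inv, map_add, map_neg, h,
        neg_add_cancel]
    · rintro ⟨ζ, hζ, rfl⟩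
      rw [SetLike.mem_coe, ← logEmbedding_eq_zero_iff] at hζ
      rw [ofMul_mul, map_add, hζ, add_zero]
  rw [hset, (mul_right_injective u₀).encard_image, torsionOrder]
  exact ENat.card_eq_coe_natCard (torsion K)

instance countable_units : Countable (𝓞 K)ˣ := by
  have h : Set.Countable {x : K | IsAlgebraic ℚ x} := Algebraic.countable ℚ K
  have h1 : {x : K | IsAlgebraic ℚ x} = Set.univ :=
    Set.eq_univ_of_forall fun x => Algebra.IsAlgebraic.isAlgebraic x
  rw [h1] at h
  have : Countable K := Set.countable_univ_iff.1 h
  exact (Function.Injective.countable (f := fun u : (𝓞 K)ˣ => (u : K)) fun u v huv =>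
    Units.ext (RingOfIntegers.ext huv))

theorem tsum_lintegral_unitDomain {h : (InfinitePlace K → ℝ) → ℝ≥0∞} (hm : Measurable h) :
    ∑' u : (𝓞 K)ˣ, ∫⁻ s in unitDomain K, h (s + logPlaces (u : K)) =
      torsionOrder K * ∫⁻ s, h s := by
  have h1 : ∀ u : (𝓞 K)ˣ, ∫⁻ s in unitDomain K, h (s + logPlaces (u : K)) =
      ∫⁻ s, (unitDomain K).indicator 1 (s - logPlaces (u : K)) * h s := by
    intro u
    rw [← lintegral_indicator measurableSet_unitDomain,
      ← lintegral_sub_right_eq_self _ (logPlaces (u : K))]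
    refine lintegral_congr fun s => ?_
    by_cases hs : s - logPlaces (u : K) ∈ unitDomain K
    · simp [hs]
    · simp [hs]
  rw [tsum_congr h1, ← lintegral_tsum, ← lintegral_const_mul _ hm]
  · refine lintegral_congr fun s => ?_
    rw [ENNReal.tsum_mul_right]
    congr 1
    have h2 : ∀ u : (𝓞 K)ˣ, (unitDomain K).indicator (1 : (InfinitePlace K → ℝ) → ℝ≥0∞) (s - logPlaces (u : K)) =
        {u : (𝓞 K)ˣ | s - logPlaces (u : K) ∈ unitDomain K}.indicator 1 u := fun u => by
      by_cases hs : s - logPlaces (u : K) ∈ unitDomain K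
      · rw [Set.indicator_of_mem hs, Set.indicator_of_mem (by exact hs)]; rfl
      · rw [Set.indicator_of_notMem hs, Set.indicator_of_notMem (by exact hs)]
    rw [tsum_congr h2, ← tsum_subtype]
    simp only [Pi.one_apply]
    rw [ENNReal.tsum_set_one, card_unit_translates]
    rfl
  · intro u
    refine AEMeasurable.mul (Measurable.aemeasurable ?_) hm.aemeasurable
    exact (measurable_one.indicator measurableSet_unitDomain).comp (measurable_id.sub_const _)

theorem tsum_lintegral_unitDomain_sub {h : (InfinitePlace K → ℝ) → ℝ≥0∞} (hm : Measurable h) :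
    ∑' u : (𝓞 K)ˣ, ∫⁻ s in unitDomain K, h (s - logPlaces (u : K)) =
      torsionOrder K * ∫⁻ s, h s := by
  rw [← tsum_lintegral_unitDomain hm, ← (Equiv.inv (𝓞 K)ˣ).tsum_eq]
  refine tsum_congr fun u => lintegral_congr fun s => ?_
  have h1 : logPlaces ((u⁻¹ : (𝓞 K)ˣ) : K) = -logPlaces (u : K) := by
    rw [eq_neg_iff_add_eq_zero, ← logPlaces_mul (by simp) (by simp), ← map_mul]
    ext w
    simp [logPlaces]
  rw [Equiv.inv_apply, h1, sub_neg_eq_add]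

/-- Unfolding of a sum over the nonzero elements of representatives of the ideal classes. -/
theorem tsum_tsum_lintegral_unitDomain {X : Type*} (𝔞 : X → (FractionalIdeal (𝓞 K)⁰ K)ˣ)
    (h𝔞 : Function.Bijective fun x => ClassGroup.mk K (𝔞 x))
    {f : X → K → (InfinitePlace K → ℝ) → ℝ≥0∞}
    (hu : ∀ x α, α ≠ 0 → ∑' u : (𝓞 K)ˣ, ∫⁻ s in unitDomain K, f x ((u : K) * α) s =
      torsionOrder K * ∫⁻ s, f x α s)
    {Ψ : ℝ → ℝ≥0∞} (hΨ : ∀ x α, α ≠ 0 → ∫⁻ s, f x α s =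
      Ψ (|(Algebra.norm ℚ α : ℝ)| / (FractionalIdeal.absNorm (𝔞 x).1 : ℝ))) :
    ∑' x, ∑' α : nonzeroElements (𝔞 x), ∫⁻ s in unitDomain K, f x α s =
      torsionOrder K * ∑' J : (Ideal (𝓞 K))⁰, Ψ (Ideal.absNorm (J : Ideal (𝓞 K))) := by
  obtain ⟨g, e, hg, he⟩ := exists_generator_equiv 𝔞 h𝔞
  rw [← ENNReal.tsum_sigma fun x (α : nonzeroElements (𝔞 x)) => ∫⁻ s in unitDomain K, f x α s,
    ← e.tsum_eq, ENNReal.tsum_prod', ← ENNReal.tsum_mul_left]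
  refine tsum_congr fun J => ?_
  have h1 : ∀ u, ∫⁻ s in unitDomain K, f (e (J, u)).1 (e (J, u)).2 s =
      ∫⁻ s in unitDomain K, f (g J).1 ((u : K) * (g J).2) s := fun u => by rw [he]
  rw [tsum_congr h1, hu _ _ (g J).2.2.2, hΨ _ _ (g J).2.2.2, hg]
  congr 2
  have : (FractionalIdeal.absNorm (𝔞 (g J).1).1 : ℝ) ≠ 0 := by
    rw [Rat.cast_ne_zero, Ne, FractionalIdeal.absNorm_eq_zero_iff]
    exact (𝔞 (g J).1).ne_zero
  field_simp

end UnitUnfolding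

section ScaledPoisson

open MeasureTheory Module Real NumberField NumberField.InfinitePlace NumberField.mixedEmbedding
open scoped Classical ENNReal

variable {K : Type*} [Field K] [NumberField K]

/-- The covolume of the lattice of a fractional ideal. -/
noncomputable def idealCovolume (𝔞 : (FractionalIdeal (𝓞 K)⁰ K)ˣ) : ℝ :=
  (FractionalIdeal.absNorm 𝔞.1 : ℝ) * ((2⁻¹ : ℝ) ^ nrComplexPlaces K * √(absDiscr K))

theorem absDiscr_pos : 0 < absDiscr K := by
  rw [absDiscr, abs_pos, Int.cast_ne_zero]
  exact discr_ne_zero K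

theorem one_le_absDiscr : 1 ≤ absDiscr K := by
  have h := Int.one_le_abs (discr_ne_zero K)
  rw [absDiscr, ← Int.cast_abs]
  exact_mod_cast h

theorem absNorm_pos (𝔞 : (FractionalIdeal (𝓞 K)⁰ K)ˣ) :
    0 < (FractionalIdeal.absNorm 𝔞.1 : ℝ) := by
  have h1 := FractionalIdeal.absNorm_nonneg 𝔞.1
  have h2 : FractionalIdeal.absNorm 𝔞.1 ≠ 0 := by
    rw [Ne, FractionalIdeal.absNorm_eq_zero_iff]
    exact 𝔞.ne_zero
  exact_mod_cast h1.lt_of_ne h2.symm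

theorem idealCovolume_pos (𝔞 : (FractionalIdeal (𝓞 K)⁰ K)ˣ) : 0 < idealCovolume 𝔞 :=
  mul_pos (absNorm_pos 𝔞) (mul_pos (by positivity) (sqrt_pos.2 absDiscr_pos))

theorem volume_real_fundamentalDomain_fractionalIdeal (𝔞 : (FractionalIdeal (𝓞 K)⁰ K)ˣ) :
    volume.real (ZSpan.fundamentalDomain (fractionalIdealLatticeBasis K 𝔞)) = idealCovolume 𝔞 := by
  rw [measureReal_def, volume_fundamentalDomain_fractionalIdealLatticeBasis, ENNReal.toReal_mul,
    volume_fundamentalDomain_latticeBasis, ENNReal.toReal_ofReal (absNorm_pos 𝔞).le,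
    ENNReal.toReal_mul, ENNReal.toReal_pow, ENNReal.toReal_inv, ENNReal.toReal_ofNat, idealCovolume]
  congr 2
  rw [absDiscr, ENNReal.coe_toReal, coe_sqrt, coe_nnnorm, Int.norm_eq_abs]

theorem absNorm_dualIdeal (𝔞 : (FractionalIdeal (𝓞 K)⁰ K)ˣ) :
    (FractionalIdeal.absNorm (dualIdeal 𝔞).1 : ℝ) =
      ((FractionalIdeal.absNorm 𝔞.1 : ℝ) * absDiscr K)⁻¹ := by
  have h1 := FractionalIdeal.coeIdeal_absNorm (K := K) (differentIdeal ℤ (𝓞 K))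
  rw [coeIdeal_differentIdeal (K := ℚ), absNorm_differentIdeal K, map_inv₀] at h1
  rw [dualIdeal, Units.val_mk0, FractionalIdeal.dual_eq_mul_inv, map_mul, map_inv₀,
    ← inv_inv (FractionalIdeal.absNorm (FractionalIdeal.dual ℤ ℚ 1)), h1, absDiscr]
  push_cast
  rw [mul_inv, mul_comm, Nat.cast_natAbs, Int.cast_abs]

theorem bijective_mk_dualIdeal {X : Type*} {𝔞 : X → (FractionalIdeal (𝓞 K)⁰ K)ˣ}
    (h : Function.Bijective fun x => ClassGroup.mk K (𝔞 x)) :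
    Function.Bijective fun x => ClassGroup.mk K (dualIdeal (𝔞 x)) := by
  have h1 : ∀ 𝔟 : (FractionalIdeal (𝓞 K)⁰ K)ˣ, dualIdeal 𝔟 = dualIdeal 1 * 𝔟⁻¹ := by
    intro 𝔟
    refine Units.ext ?_
    rw [Units.val_mul, dualIdeal, dualIdeal, Units.val_mk0, Units.val_mk0,
      FractionalIdeal.dual_eq_mul_inv]
    simp
  have h2 : (fun x => ClassGroup.mk K (dualIdeal (𝔞 x))) =
      (fun c => ClassGroup.mk K (dualIdeal 1) * c⁻¹) ∘ fun x => ClassGroup.mk K (𝔞 x) := by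
    funext x
    rw [h1, map_mul, map_inv]
    rfl
  rw [h2]
  exact ((Group.mulLeft_bijective _).comp (Equiv.inv _).bijective).comp h

/-- The sum of the Fourier transforms over the dual lattice, without the origin. -/
noncomputable def dualSum (𝔞 : (FractionalIdeal (𝓞 K)⁰ K)ˣ) (T l : ℝ) (s : InfinitePlace K → ℝ) :
    ℝ≥0∞ :=
  ∑' β : nonzeroElements (dualIdeal 𝔞),
    ‖∫ v, mixedChar (placeScale (-s) (mixedEmbedding K β)) v * normCutoff T l v‖ₑ

theorem normCutoff_zero (T l : ℝ) : normCutoff T l (0 : mixedSpace K) = 0 := by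
  by_contra h
  have h1 : mixedWeight (0 : mixedSpace K) ≠ 0 := right_ne_zero_of_mul h
  have h2 := (mixedNorm_bounds h1).1
  rw [mixedNorm_eq_norm, map_zero] at h2
  norm_num at h2

theorem poisson_normCutoff (𝔞 : (FractionalIdeal (𝓞 K)⁰ K)ˣ) {T : ℝ} (hT : 1 ≤ T) (l : ℝ)
    (s : InfinitePlace K → ℝ) :
    (∑' α : nonzeroElements 𝔞, ENNReal.ofReal (normCutoff T l (placeScale s (mixedEmbedding K α))) ≤
      ENNReal.ofReal ((idealCovolume 𝔞)⁻¹ * exp (-degreeSum s)) *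
        (ENNReal.ofReal (∫ v : mixedSpace K, normCutoff T l v) + dualSum 𝔞 T l s)) ∧
    ENNReal.ofReal ((idealCovolume 𝔞)⁻¹ * exp (-degreeSum s)) *
        ENNReal.ofReal (∫ v : mixedSpace K, normCutoff T l v) ≤
      ∑' α : nonzeroElements 𝔞, ENNReal.ofReal (normCutoff T l (placeScale s (mixedEmbedding K α))) +
        ENNReal.ofReal ((idealCovolume 𝔞)⁻¹ * exp (-degreeSum s)) * dualSum 𝔞 T l s := by
  have hV := volume_real_fundamentalDomain_fractionalIdeal 𝔞
  have hVpos := idealCovolume_pos 𝔞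
  have hint : ∫ v, normCutoff T l (placeScale s v) =
      exp (-degreeSum s) * ∫ v : mixedSpace K, normCutoff T l v := by
    have h := integral_comp_placeScale s fun v => (normCutoff T l v : ℂ)
    rw [integral_complex_ofReal, integral_complex_ofReal] at h
    exact_mod_cast h
  have hchar : ∀ ξ : mixedSpace K, ∫ v, mixedChar ξ v * (normCutoff T l (placeScale s v) : ℝ) =
      (exp (-degreeSum s) : ℂ) * ∫ v, mixedChar (placeScale (-s) ξ) v * normCutoff T l v := by
    intro ξ
    rw [← integral_comp_placeScale s fun v => mixedChar (placeScale (-s) ξ) v * normCutoff T l v]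
    refine integral_congr_ae (Filter.Eventually.of_forall fun v => ?_)
    simp only [mixedChar, mixedTrace_placeScale]
  have hc : Continuous fun v : mixedSpace K => normCutoff T l (placeScale s v) :=
    (continuous_normCutoff T l).comp (continuous_placeScale s)
  have hs : HasCompactSupport fun v : mixedSpace K => normCutoff T l (placeScale s v) := by
    let e : mixedSpace K ≃ₜ mixedSpace K := (placeScaleEquiv s).toContinuousLinearEquiv.toHomeomorph
    have h : HasCompactSupport ((normCutoff T l : mixedSpace K → ℝ) ∘ e) :=
      (hasCompactSupport_normCutoff T l).comp_homeomorph e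
    exact h
  have hP := poisson_fractionalIdeal 𝔞 hc hs (fun v => normCutoff_nonneg hT l _)
    (by rw [placeScale_zero, normCutoff_zero]) rfl
  rw [hV, hint] at hP
  have hE : ENNReal.ofReal (idealCovolume 𝔞)⁻¹ * ∑' β : nonzeroElements (dualIdeal 𝔞),
      ‖∫ v, mixedChar (mixedEmbedding K β) v * (normCutoff T l (placeScale s v) : ℝ)‖ₑ =
      ENNReal.ofReal ((idealCovolume 𝔞)⁻¹ * exp (-degreeSum s)) * dualSum 𝔞 T l s := by
    have h : ∑' β : nonzeroElements (dualIdeal 𝔞),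
        ‖∫ v, mixedChar (mixedEmbedding K β) v * (normCutoff T l (placeScale s v) : ℝ)‖ₑ =
        ENNReal.ofReal (exp (-degreeSum s)) * dualSum 𝔞 T l s := by
      rw [dualSum, ← ENNReal.tsum_mul_left]
      refine tsum_congr fun β => ?_
      rw [hchar, enorm_mul, ← ofReal_norm (exp (-degreeSum s) : ℂ), Complex.norm_real, norm_eq_abs,
        abs_exp]
    rw [ENNReal.ofReal_mul (inv_nonneg.2 hVpos.le), mul_assoc, h]
  have hM : ENNReal.ofReal (idealCovolume 𝔞)⁻¹ *
      ENNReal.ofReal (exp (-degreeSum s) * ∫ v : mixedSpace K, normCutoff T l v) =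
      ENNReal.ofReal ((idealCovolume 𝔞)⁻¹ * exp (-degreeSum s)) *
        ENNReal.ofReal (∫ v : mixedSpace K, normCutoff T l v) := by
    rw [ENNReal.ofReal_mul (inv_nonneg.2 hVpos.le), ENNReal.ofReal_mul (exp_pos _).le, mul_assoc]
  rw [mul_add, hE, hM, ← mul_add] at hP
  exact hP

end ScaledPoisson

section CountingSide

open MeasureTheory Module Real NumberField NumberField.InfinitePlace NumberField.mixedEmbedding
open NumberField.Units
open scoped Classical ENNReal

variable {K : Type*} [Field K] [NumberField K]

/-- The local weight at an infinite place in logarithmic coordinates. -/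
noncomputable def logWeight (w : InfinitePlace K) (t : ℝ) : ℝ :=
  if IsReal w then localWeight ℝ (exp t) else localWeight ℂ (exp t : ℂ)

/-- The weight of a point with the given logarithmic absolute values. -/
noncomputable def placeWeight (s : InfinitePlace K → ℝ) : ℝ := ∏ w, logWeight w (s w)

variable (K) in
/-- The total mass of `placeWeight`. -/
noncomputable def placeMass : ℝ≥0∞ := ∫⁻ s : InfinitePlace K → ℝ, ENNReal.ofReal (placeWeight s)

omit [NumberField K] in
theorem continuous_logWeight (w : InfinitePlace K) : Continuous (logWeight w) := by
  have h1 : Continuous (localWeight ℝ) := continuous_localWeight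
  have h2 : Continuous (localWeight ℂ) := continuous_localWeight
  by_cases hw : IsReal w
  · have : logWeight w = fun t => localWeight ℝ (exp t) := by ext t; simp [logWeight, hw]
    rw [this]; fun_prop
  · have : logWeight w = fun t => localWeight ℂ (exp t : ℂ) := by ext t; simp only [logWeight, hw, if_false]
    rw [this]; fun_prop

omit [NumberField K] in
theorem logWeight_nonneg (w : InfinitePlace K) (t : ℝ) : 0 ≤ logWeight w t := by
  rw [logWeight]
  split_ifs
  · exact localWeight_nonneg _
  · exact localWeight_nonneg _

omit [NumberField K] in
theorem hasCompactSupport_logWeight (w : InfinitePlace K) : HasCompactSupport (logWeight w) := by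
  refine HasCompactSupport.intro (isCompact_Icc (a := 0) (b := log 3)) fun t ht => ?_
  by_contra h
  have h1 : 1 < exp t ∧ exp t < 3 := by
    rw [logWeight] at h
    split_ifs at h
    · have := norm_mem_of_localWeight_ne_zero h
      rwa [norm_eq_abs, abs_exp] at this
    · have := norm_mem_of_localWeight_ne_zero h
      rwa [Complex.norm_real, norm_eq_abs, abs_exp] at this
  exact ht ⟨(one_lt_exp_iff.1 h1.1).le, ((lt_log_iff_exp_lt (by norm_num)).2 h1.2).le⟩

theorem continuous_placeWeight : Continuous (placeWeight : (InfinitePlace K → ℝ) → ℝ) := by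
  unfold placeWeight
  exact continuous_finsetProd _ fun w _ => (continuous_logWeight w).comp (continuous_apply w)

theorem placeWeight_nonneg (s : InfinitePlace K → ℝ) : 0 ≤ placeWeight s :=
  Finset.prod_nonneg fun w _ => logWeight_nonneg w _

theorem placeMass_eq : placeMass K = ENNReal.ofReal (∏ w : InfinitePlace K, ∫ t, logWeight w t) := by
  have h1 := integral_fintype_prod_volume_eq_prod (𝕜 := ℝ)
    (fun (w : InfinitePlace K) (t : ℝ) => logWeight w t)
  have hi : Integrable fun s : InfinitePlace K → ℝ => ∏ w, logWeight w (s w) :=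
    Integrable.fintype_prod fun w =>
      (continuous_logWeight w).integrable_of_hasCompactSupport (hasCompactSupport_logWeight w)
  rw [placeMass, ← h1, ofReal_integral_eq_lintegral_ofReal hi
    (Filter.Eventually.of_forall placeWeight_nonneg)]
  rfl

theorem placeMass_ne_top : placeMass K ≠ ⊤ := by
  rw [placeMass_eq]
  exact ENNReal.ofReal_ne_top

theorem exists_le_placeMass : ∃ c : ℝ, 0 < c ∧ c ≤ 1 ∧ ∀ (K : Type*) [Field K] [NumberField K],
    ENNReal.ofReal (c ^ Fintype.card (InfinitePlace K)) ≤ placeMass K := by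
  have h1 : Continuous (localWeight ℝ) := continuous_localWeight
  have h2 : Continuous (localWeight ℂ) := continuous_localWeight
  have hpos : ∀ g : ℝ → ℝ, Continuous g → HasCompactSupport g → (∀ t, 0 ≤ g t) →
      g (log 2) ≠ 0 → 0 < ∫ t, g t := fun g hc hs hn h =>
    hc.integral_pos_of_hasCompactSupport_nonneg_nonzero hs hn h
  have cs : ∀ g : ℝ → ℝ, (∀ t, g t ≠ 0 → 1 < exp t ∧ exp t < 3) → HasCompactSupport g := by
    intro g hg
    refine HasCompactSupport.intro (isCompact_Icc (a := 0) (b := log 3)) fun t ht => ?_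
    by_contra h
    have h1 := hg t h
    exact ht ⟨(one_lt_exp_iff.1 h1.1).le, ((lt_log_iff_exp_lt (by norm_num)).2 h1.2).le⟩
  have hR : 0 < ∫ t, localWeight ℝ (exp t) := by
    refine hpos _ (by fun_prop) (cs _ fun t ht => ?_) (fun t => localWeight_nonneg _) ?_
    · have := norm_mem_of_localWeight_ne_zero ht
      rwa [norm_eq_abs, abs_exp] at this
    · exact (localWeight_pos (by rw [norm_eq_abs, abs_exp, exp_log (by norm_num)])).ne'
  have hC : 0 < ∫ t, localWeight ℂ (exp t : ℂ) := by
    refine hpos _ (by fun_prop) (cs _ fun t ht => ?_) (fun t => localWeight_nonneg _) ?_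
    · have := norm_mem_of_localWeight_ne_zero ht
      rwa [Complex.norm_real, norm_eq_abs, abs_exp] at this
    · exact (localWeight_pos (by
        rw [Complex.norm_real, norm_eq_abs, abs_exp, exp_log (by norm_num)])).ne'
  refine ⟨min 1 (min (∫ t, localWeight ℝ (exp t)) (∫ t, localWeight ℂ (exp t : ℂ))),
    lt_min one_pos (lt_min hR hC), min_le_left _ _, fun K _ _ => ?_⟩
  rw [placeMass_eq, ← Finset.card_univ, ← Finset.prod_const]
  refine ENNReal.ofReal_le_ofReal (Finset.prod_le_prod (fun w _ => ?_) fun w _ => ?_)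
  · exact (lt_min one_pos (lt_min hR hC)).le
  · by_cases hw : IsReal w
    · simp only [logWeight, hw, if_true]
      exact (min_le_right _ _).trans (min_le_left _ _)
    · simp only [logWeight, hw, if_false]
      exact (min_le_right _ _).trans (min_le_right _ _)

theorem mixedWeight_placeScale {α : K} (hα : α ≠ 0) (s : InfinitePlace K → ℝ) :
    mixedWeight (placeScale s (mixedEmbedding K α)) = placeWeight (s + logPlaces α) := by
  have hpos : ∀ w : InfinitePlace K, 0 < w α := fun w => pos_iff.2 hα
  have hexp : ∀ w : InfinitePlace K, exp ((s + logPlaces α) w) = exp (s w) * w α := fun w => by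
    rw [Pi.add_apply, logPlaces, exp_add, exp_log (hpos w)]
  rw [placeWeight, prod_eq_prod_mul_prod, mixedWeight]
  congr 1
  · refine Finset.prod_congr rfl fun w _ => ?_
    rw [logWeight, if_pos w.2]
    refine localWeight_eq_of_norm_eq ?_
    rw [hexp, placeScale, norm_mul, norm_mul, mixedEmbedding_apply_isReal,
      norm_embedding_of_isReal, norm_eq_abs (w.1 α), abs_of_pos (hpos _)]
  · refine Finset.prod_congr rfl fun w _ => ?_
    rw [logWeight, if_neg (not_isReal_iff_isComplex.2 w.2)]
    refine localWeight_eq_of_norm_eq ?_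
    rw [hexp, placeScale, norm_mul, Complex.ofReal_mul, norm_mul, mixedEmbedding_apply_isComplex,
      norm_embedding_eq, Complex.norm_real (w.1 α), norm_eq_abs (w.1 α), abs_of_pos (hpos _)]

theorem abs_norm_pos {α : K} (hα : α ≠ 0) : 0 < |(Algebra.norm ℚ α : ℝ)| := by
  rw [abs_pos, Rat.cast_ne_zero]
  exact Algebra.norm_ne_zero_iff.2 hα

theorem normCutoff_placeScale {α : K} (hα : α ≠ 0) (T y : ℝ) (s : InfinitePlace K → ℝ) :
    normCutoff T (-degreeSum s - y) (placeScale s (mixedEmbedding K α)) =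
      logStep T (log |(Algebra.norm ℚ α : ℝ)| - y) * placeWeight (s + logPlaces α) := by
  rw [normCutoff, mixedWeight_placeScale hα, mixedNorm_placeScale, mixedNorm_mixedEmbedding,
    log_mul (exp_pos _).ne' (abs_norm_pos hα).ne', log_exp]
  congr 2
  ring

variable (K) in
/-- The smoothed number of ideals of norm at most `x`. -/
noncomputable def smoothCount (T x : ℝ) : ℝ≥0∞ :=
  ∑' J : (Ideal (𝓞 K))⁰,
    ENNReal.ofReal (logStep T (log (Ideal.absNorm (J : Ideal (𝓞 K))) - log x))

/-- Unfolding of the smoothed number of ideals. -/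
theorem tsum_lintegral_normCutoff {X : Type*} {𝔞 : X → (FractionalIdeal (𝓞 K)⁰ K)ˣ}
    (h𝔞 : Function.Bijective fun x => ClassGroup.mk K (𝔞 x)) {T x : ℝ} (hT : 1 ≤ T) (hx : 0 < x) :
    ∑' c, ∑' α : nonzeroElements (𝔞 c), ∫⁻ s in unitDomain K,
      ENNReal.ofReal (normCutoff T (-degreeSum s - log (x * FractionalIdeal.absNorm (𝔞 c).1))
        (placeScale s (mixedEmbedding K α))) =
      torsionOrder K * (smoothCount K T x * placeMass K) := by
  let f : X → K → (InfinitePlace K → ℝ) → ℝ≥0∞ := fun c α s =>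
    ENNReal.ofReal (logStep T (log |(Algebra.norm ℚ α : ℝ)| -
      log (x * FractionalIdeal.absNorm (𝔞 c).1))) * ENNReal.ofReal (placeWeight (s + logPlaces α))
  have hm : ∀ c α, Measurable (f c α) := fun c α =>
    ((continuous_placeWeight.comp (continuous_add_const _)).measurable.ennreal_ofReal).const_mul _
  have h := tsum_tsum_lintegral_unitDomain 𝔞 h𝔞 (f := f)
    (Ψ := fun y => ENNReal.ofReal (logStep T (log y - log x)) * placeMass K) ?_ ?_
  · rw [ENNReal.tsum_mul_right] at h
    rw [smoothCount, ← h]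
    refine tsum_congr fun c => tsum_congr fun α => lintegral_congr fun s => ?_
    rw [normCutoff_placeScale α.2.2, ENNReal.ofReal_mul (logStep_nonneg hT _)]
  · intro c α hα
    rw [← tsum_lintegral_unitDomain (hm c α)]
    refine tsum_congr fun u => lintegral_congr fun s => ?_
    have hn : |(Algebra.norm ℚ ((u : K) * α) : ℝ)| = |(Algebra.norm ℚ α : ℝ)| := by
      have := NumberField.Units.norm (K := K) u
      rw [map_mul, Rat.cast_mul, abs_mul]
      rw [show |(Algebra.norm ℚ (u : K) : ℝ)| = 1 by exact_mod_cast this, one_mul]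
    simp only [f]
    rw [hn, logPlaces_mul (by simp) hα, add_assoc]
  · intro c α hα
    have hmeas : Measurable fun s => ENNReal.ofReal (placeWeight (s + logPlaces α)) :=
      (continuous_placeWeight.comp (continuous_add_const _)).measurable.ennreal_ofReal
    simp only [f]
    rw [lintegral_const_mul _ hmeas,
      lintegral_add_right_eq_self fun s => ENNReal.ofReal (placeWeight s), placeMass]
    congr 3
    rw [log_mul hx.ne' (absNorm_pos _).ne', log_div (abs_norm_pos hα).ne' (absNorm_pos _).ne']
    ring

end CountingSide

section MainTerm

open MeasureTheory Module Real NumberField NumberField.InfinitePlace NumberField.mixedEmbedding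
open NumberField.Units NumberField.Units.dirichletUnitTheorem
open scoped Classical ENNReal

variable {K : Type*} [Field K] [NumberField K]

theorem continuous_degreeSum : Continuous (degreeSum : (InfinitePlace K → ℝ) → ℝ) := by
  unfold degreeSum
  fun_prop

theorem setLIntegral_unitDomain_shift (h : ℝ → ℝ≥0∞) (c : ℝ) :
    ∫⁻ s in unitDomain K, h (degreeSum s + c) = ∫⁻ s in unitDomain K, h (degreeSum s) := by
  let e : InfinitePlace K → ℝ := Pi.single w₀ (c / mult (w₀ : InfinitePlace K))
  have he : degreeSum e = c := by
    have hm : (mult (w₀ : InfinitePlace K) : ℝ) ≠ 0 := by exact_mod_cast mult_ne_zero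
    rw [degreeSum, Finset.sum_eq_single w₀]
    · simp only [e, Pi.single_eq_same]
      field_simp
    · intro w _ hw
      simp [e, hw]
    · simp
  have hmem : ∀ s, s + e ∈ unitDomain K ↔ s ∈ unitDomain K := by
    intro s
    have h0 : toLogSpace K e = 0 := by
      ext w
      rw [toLogSpace_apply]
      simp [e, w.2]
    rw [unitDomain, Set.mem_preimage, Set.mem_preimage, map_add, h0, add_zero]
  rw [← lintegral_indicator measurableSet_unitDomain,
    ← lintegral_indicator measurableSet_unitDomain]
  symm
  rw [← lintegral_add_right_eq_self _ e]
  refine lintegral_congr fun s => ?_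
  by_cases hs : s ∈ unitDomain K
  · rw [Set.indicator_of_mem hs, Set.indicator_of_mem ((hmem s).2 hs), degreeSum_add, he]
  · rw [Set.indicator_of_notMem hs, Set.indicator_of_notMem (mt (hmem s).1 hs)]

variable (K) in
/-- The mass of a radial function on the unit domain. -/
noncomputable def radialMass (h : ℝ → ℝ≥0∞) : ℝ≥0∞ :=
  ∫⁻ s in unitDomain K, ENNReal.ofReal (exp (-degreeSum s)) * h (-degreeSum s)

theorem radialMass_mono {h h' : ℝ → ℝ≥0∞} (hh : ∀ u, h u ≤ h' u) :
    radialMass K h ≤ radialMass K h' :=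
  lintegral_mono fun _ => mul_le_mul_right (hh _) _

theorem radialMass_shift (h : ℝ → ℝ≥0∞) (c : ℝ) :
    radialMass K (fun u => h (u + c)) = ENNReal.ofReal (exp (-c)) * radialMass K h := by
  rw [radialMass, radialMass, ← lintegral_const_mul' _ _ ENNReal.ofReal_ne_top,
    ← setLIntegral_unitDomain_shift
      (fun t => ENNReal.ofReal (exp (-t)) * h (-t + c)) c]
  refine lintegral_congr fun s => ?_
  rw [← mul_assoc, ← ENNReal.ofReal_mul (exp_pos _).le, ← exp_add]
  congr 3 <;> ring

/-- The mass of the half line. -/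
noncomputable def halfLineIndicator (u : ℝ) : ℝ≥0∞ := (Set.Iic (0 : ℝ)).indicator 1 u

theorem measurable_halfLineIndicator : Measurable halfLineIndicator :=
  measurable_one.indicator measurableSet_Iic

theorem measurable_logStep (T : ℝ) : Measurable (logStep T) :=
  (contDiff_logStep T).continuous.measurable

theorem radialMass_halfLine_le {T : ℝ} (hT : 1 ≤ T) :
    radialMass K halfLineIndicator ≤ radialMass K (fun u => ENNReal.ofReal (logStep T u)) +
      ENNReal.ofReal T⁻¹ * radialMass K halfLineIndicator := by
  have h1 : ENNReal.ofReal T⁻¹ * radialMass K halfLineIndicator =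
      radialMass K fun u => halfLineIndicator (u + log T) := by
    rw [radialMass_shift, exp_neg, exp_log (by linarith)]
  rw [h1, radialMass, radialMass, radialMass, ← lintegral_add_right]
  · refine lintegral_mono fun s => ?_
    rw [← mul_add]
    refine mul_le_mul_right ?_ _
    simp only [halfLineIndicator]
    by_cases hu : -degreeSum s ≤ 0
    · by_cases hu' : -degreeSum s + log T ≤ 0
      · rw [Set.indicator_of_mem (show -degreeSum s + log T ∈ Set.Iic (0 : ℝ) from hu')]
        exact (Set.indicator_le_self' (by simp) _).trans le_add_self
      · rw [logStep_eq_one hT (by linarith) hu, ENNReal.ofReal_one]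
        exact (Set.indicator_le_self' (by simp) _).trans le_self_add
    · rw [Set.indicator_of_notMem (by exact hu)]
      exact zero_le
  · exact (((continuous_degreeSum.neg).rexp.measurable.ennreal_ofReal).mul
      (measurable_halfLineIndicator.comp
        ((continuous_degreeSum.neg).add continuous_const).measurable))

theorem radialMass_logStep_le {T : ℝ} (hT : 1 ≤ T) :
    radialMass K (fun u => ENNReal.ofReal (logStep T u)) ≤
      ENNReal.ofReal (exp (1 / T)) * radialMass K halfLineIndicator := by
  have h1 := radialMass_shift (K := K) halfLineIndicator (-(1 / T))
  rw [neg_neg] at h1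
  rw [← h1]
  refine radialMass_mono fun u => ?_
  by_cases hu : 1 / T ≤ u
  · rw [logStep_eq_zero_of_le hT hu, ENNReal.ofReal_zero]
    exact zero_le
  · rw [halfLineIndicator, Set.indicator_of_mem (by
      change u + -(1 / T) ≤ 0
      linarith [not_le.1 hu])]
    exact ENNReal.ofReal_le_one.2 (logStep_le_one T u)

theorem radialMass_halfLine_le_mul :
    radialMass K halfLineIndicator ≤ 2 * radialMass K (fun u => ENNReal.ofReal (logStep 2 u)) := by
  have h1 : ∀ k : ℕ, radialMass K (fun u => ENNReal.ofReal (logStep 2 (u + k * log 2))) =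
      (2⁻¹ : ℝ≥0∞) ^ k * radialMass K (fun u => ENNReal.ofReal (logStep 2 u)) := by
    intro k
    rw [radialMass_shift fun u => ENNReal.ofReal (logStep 2 u)]
    congr 1
    rw [← mul_neg, exp_nat_mul, exp_neg, exp_log (by norm_num),
      ENNReal.ofReal_pow (by norm_num), ENNReal.ofReal_inv_of_pos (by norm_num), ENNReal.ofReal_ofNat]
  calc radialMass K halfLineIndicator
      ≤ radialMass K fun u => ∑' k : ℕ, ENNReal.ofReal (logStep 2 (u + k * log 2)) := by
        refine radialMass_mono fun u => ?_
        by_cases hu : u ≤ 0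
        · rw [halfLineIndicator, Set.indicator_of_mem (by exact hu)]
          have hl : 0 < log 2 := log_pos one_lt_two
          have hk := Nat.floor_le (a := -u / log 2) (by
            apply div_nonneg <;> linarith)
          have hk' := Nat.lt_floor_add_one (-u / log 2)
          rw [le_div_iff₀ hl] at hk
          rw [div_lt_iff₀ hl] at hk'
          refine le_trans ?_ (ENNReal.le_tsum ⌊-u / log 2⌋₊)
          rw [logStep_eq_one one_le_two (by linarith) (by linarith), ENNReal.ofReal_one]
          rfl
        · rw [halfLineIndicator, Set.indicator_of_notMem (by exact hu)]
          exact zero_le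
    _ = ∑' k : ℕ, radialMass K fun u => ENNReal.ofReal (logStep 2 (u + k * log 2)) := by
        simp only [radialMass, ← ENNReal.tsum_mul_left]
        rw [lintegral_tsum]
        intro k
        refine (((continuous_degreeSum.neg).rexp.measurable.ennreal_ofReal).mul ?_).aemeasurable
        exact ((measurable_logStep 2).comp
          ((continuous_degreeSum.neg).add continuous_const).measurable).ennreal_ofReal
    _ = 2 * radialMass K (fun u => ENNReal.ofReal (logStep 2 u)) := by
        rw [tsum_congr h1, ENNReal.tsum_mul_right, ENNReal.tsum_geometric, ENNReal.one_sub_inv_two,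
          inv_inv]

variable (K) in
/-- The mass of the weight with respect to the multiplicative measure. -/
noncomputable def normMass : ℝ≥0∞ :=
  ∫⁻ v : mixedSpace K, ENNReal.ofReal (mixedWeight v) * ENNReal.ofReal (mixedNorm v)⁻¹

variable (K) in
/-- The coefficient of the main term attached to a radial function. -/
noncomputable def mainMass (h : ℝ → ℝ≥0∞) : ℝ≥0∞ :=
  ENat.card (ClassGroup (𝓞 K)) * (ENNReal.ofReal ((2⁻¹ : ℝ) ^ nrComplexPlaces K * √(absDiscr K))⁻¹ *
    normMass K * radialMass K h)

theorem lintegral_normCutoff (T l : ℝ) (hT : 1 ≤ T) :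
    ENNReal.ofReal (∫ v : mixedSpace K, normCutoff T l v) =
      ∫⁻ v : mixedSpace K, ENNReal.ofReal (mixedWeight v) *
        ENNReal.ofReal (logStep T (log (mixedNorm v) + l)) := by
  have hi : Integrable (normCutoff T l : mixedSpace K → ℝ) :=
    (continuous_normCutoff T l).integrable_of_hasCompactSupport (hasCompactSupport_normCutoff T l)
  rw [ofReal_integral_eq_lintegral_ofReal hi
    (Filter.Eventually.of_forall fun v => normCutoff_nonneg hT l v)]
  refine lintegral_congr fun v => ?_
  rw [normCutoff, mul_comm, ENNReal.ofReal_mul (mixedWeight_nonneg v)]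

/-- The integrand of the main term. -/
noncomputable def mainDensity (𝔞 : (FractionalIdeal (𝓞 K)⁰ K)ˣ) (T x : ℝ)
    (s : InfinitePlace K → ℝ) : ℝ≥0∞ :=
  ENNReal.ofReal ((idealCovolume 𝔞)⁻¹ * exp (-degreeSum s)) * ENNReal.ofReal
    (∫ v : mixedSpace K, normCutoff T (-degreeSum s - log (x * FractionalIdeal.absNorm 𝔞.1)) v)

theorem measurable_kernel (T y : ℝ) : Measurable fun p : (InfinitePlace K → ℝ) × mixedSpace K =>
    ENNReal.ofReal (mixedWeight p.2) *
      ENNReal.ofReal (logStep T (log (mixedNorm p.2) + (-degreeSum p.1 - y))) := by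
  have h1 : Measurable fun p : (InfinitePlace K → ℝ) × mixedSpace K => mixedWeight p.2 :=
    continuous_mixedWeight.measurable.comp measurable_snd
  have h2 : Measurable fun p : (InfinitePlace K → ℝ) × mixedSpace K => log (mixedNorm p.2) :=
    (continuous_mixedNorm.measurable.comp measurable_snd).log
  have h3 : Measurable fun p : (InfinitePlace K → ℝ) × mixedSpace K => degreeSum p.1 :=
    continuous_degreeSum.measurable.comp measurable_fst
  exact h1.ennreal_ofReal.mul
    ((measurable_logStep T).comp (h2.add (h3.neg.sub_const y))).ennreal_ofReal

theorem measurable_mainDensity (𝔞 : (FractionalIdeal (𝓞 K)⁰ K)ˣ) {T : ℝ} (hT : 1 ≤ T) (x : ℝ) :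
    Measurable (mainDensity 𝔞 T x) := by
  unfold mainDensity
  simp only [lintegral_normCutoff T _ hT]
  refine Measurable.mul ?_ (measurable_kernel T _).lintegral_prod_right'
  exact ((continuous_degreeSum.neg.rexp).const_mul _).measurable.ennreal_ofReal

theorem setLIntegral_mainDensity (𝔞 : (FractionalIdeal (𝓞 K)⁰ K)ˣ) {T x : ℝ} (hT : 1 ≤ T)
    (hx : 0 < x) :
    ∫⁻ s in unitDomain K, mainDensity 𝔞 T x s = ENNReal.ofReal x *
      (ENNReal.ofReal ((2⁻¹ : ℝ) ^ nrComplexPlaces K * √(absDiscr K))⁻¹ * normMass K *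
        radialMass K fun u => ENNReal.ofReal (logStep T u)) := by
  have hN := absNorm_pos 𝔞
  set N : ℝ := ((FractionalIdeal.absNorm 𝔞.1 : ℚ) : ℝ)
  have hV := idealCovolume_pos 𝔞
  have hD : 0 < (2⁻¹ : ℝ) ^ nrComplexPlaces K * √(absDiscr K) := by
    have := sqrt_pos.2 (absDiscr_pos (K := K))
    positivity
  have hexp : Measurable fun s : InfinitePlace K → ℝ => ENNReal.ofReal (exp (-degreeSum s)) :=
    (continuous_degreeSum.neg.rexp).measurable.ennreal_ofReal
  have h1 : ∀ s, mainDensity 𝔞 T x s = ENNReal.ofReal (idealCovolume 𝔞)⁻¹ *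
      ∫⁻ v : mixedSpace K, ENNReal.ofReal (exp (-degreeSum s)) * (ENNReal.ofReal (mixedWeight v) *
        ENNReal.ofReal (logStep T (log (mixedNorm v) + (-degreeSum s - log (x * N))))) := by
    intro s
    rw [mainDensity, lintegral_normCutoff T _ hT, ENNReal.ofReal_mul (inv_nonneg.2 hV.le), mul_assoc,
      lintegral_const_mul' _ _ ENNReal.ofReal_ne_top]
  have h2 : ∀ v : mixedSpace K, ∫⁻ s in unitDomain K, ENNReal.ofReal (exp (-degreeSum s)) *
      (ENNReal.ofReal (mixedWeight v) *
        ENNReal.ofReal (logStep T (log (mixedNorm v) + (-degreeSum s - log (x * N))))) =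
      ENNReal.ofReal (x * N) * (ENNReal.ofReal (mixedWeight v) * ENNReal.ofReal (mixedNorm v)⁻¹) *
        radialMass K fun u => ENNReal.ofReal (logStep T u) := by
    intro v
    by_cases hv : mixedWeight v = 0
    · simp [hv]
    have hNv : 0 < mixedNorm v := lt_of_lt_of_le one_pos (mixedNorm_bounds hv).1
    have h3 := radialMass_shift (K := K) (fun u => ENNReal.ofReal (logStep T u))
      (log (mixedNorm v) - log (x * N))
    have h4 : exp (-(log (mixedNorm v) - log (x * N))) = x * N * (mixedNorm v)⁻¹ := by
      rw [neg_sub, exp_sub, exp_log (mul_pos hx hN), exp_log hNv, div_eq_mul_inv]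
    rw [h4, ENNReal.ofReal_mul (mul_pos hx hN).le] at h3
    calc _ = ENNReal.ofReal (mixedWeight v) *
          radialMass K (fun u => ENNReal.ofReal (logStep T (u + (log (mixedNorm v) - log (x * N))))) := by
          rw [radialMass, ← lintegral_const_mul' _ _ ENNReal.ofReal_ne_top]
          refine lintegral_congr fun s => ?_
          rw [mul_left_comm]
          congr 4
          ring
      _ = _ := by rw [h3]; ring
  have h5 : Measurable fun p : (InfinitePlace K → ℝ) × mixedSpace K =>
      ENNReal.ofReal (exp (-degreeSum p.1)) * (ENNReal.ofReal (mixedWeight p.2) *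
        ENNReal.ofReal (logStep T (log (mixedNorm p.2) + (-degreeSum p.1 - log (x * N))))) :=
    (hexp.comp measurable_fst).mul (measurable_kernel T _)
  have h6 : Measurable fun v : mixedSpace K =>
      ENNReal.ofReal (mixedWeight v) * ENNReal.ofReal (mixedNorm v)⁻¹ :=
    continuous_mixedWeight.measurable.ennreal_ofReal.mul
      continuous_mixedNorm.measurable.inv.ennreal_ofReal
  rw [lintegral_congr h1, lintegral_const_mul' _ _ ENNReal.ofReal_ne_top,
    lintegral_lintegral_swap h5.aemeasurable, lintegral_congr h2,
    lintegral_mul_const _ (h6.const_mul _), lintegral_const_mul _ h6, ← normMass]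
  have h7 : ENNReal.ofReal (idealCovolume 𝔞)⁻¹ * ENNReal.ofReal (x * N) = ENNReal.ofReal x *
      ENNReal.ofReal ((2⁻¹ : ℝ) ^ nrComplexPlaces K * √(absDiscr K))⁻¹ := by
    rw [← ENNReal.ofReal_mul (inv_nonneg.2 hV.le), ← ENNReal.ofReal_mul hx.le, idealCovolume]
    congr 1
    have : N ≠ 0 := hN.ne'
    rw [mul_inv]
    change N⁻¹ * _ * (x * N) = _
    field_simp
  rw [← mul_assoc, ← mul_assoc, h7]
  ring

theorem tsum_setLIntegral_mainDensity (𝔞 : ClassGroup (𝓞 K) → (FractionalIdeal (𝓞 K)⁰ K)ˣ)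
    {T x : ℝ} (hT : 1 ≤ T) (hx : 0 < x) :
    ∑' c, ∫⁻ s in unitDomain K, mainDensity (𝔞 c) T x s =
      ENNReal.ofReal x * mainMass K fun u => ENNReal.ofReal (logStep T u) := by
  simp only [setLIntegral_mainDensity _ hT hx]
  rw [ENNReal.tsum_const, mainMass]
  ring

end MainTerm

section ErrorTerm

open MeasureTheory Module Real NumberField NumberField.InfinitePlace NumberField.mixedEmbedding
open NumberField.Units NumberField.Units.dirichletUnitTheorem
open scoped Classical ENNReal

variable {K : Type*} [Field K] [NumberField K]

theorem ofReal_integral_le_lintegral {α : Type*} [MeasurableSpace α] {μ : Measure α} {g : α → ℝ}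
    (hg : ∀ a, 0 ≤ g a) : ENNReal.ofReal (∫ a, g a ∂μ) ≤ ∫⁻ a, ENNReal.ofReal (g a) ∂μ := by
  by_cases hi : Integrable g μ
  · exact (ofReal_integral_eq_lintegral_ofReal hi (Filter.Eventually.of_forall hg)).le
  · rw [integral_undef hi, ENNReal.ofReal_zero]
    exact zero_le

theorem integral_exp_neg_abs_sub (c : ℝ) : ∫ t : ℝ, exp (-|c - t| / 4) = 8 := by
  have h1 : ∫ t : ℝ, exp (-|t|) = 2 := by
    rw [integral_comp_abs (f := fun x => exp (-x)), integral_exp_neg_Ioi_zero, mul_one]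
  have h2 := integral_sub_left_eq_self (fun t : ℝ => exp (-|t| / 4)) volume c
  have h3 := Measure.integral_comp_div (fun t : ℝ => exp (-|t|)) 4
  rw [h2]
  have h4 : (fun t : ℝ => exp (-|t| / 4)) = fun t => exp (-|t / 4|) := by
    ext t
    rw [abs_div, abs_of_pos (by norm_num : (0 : ℝ) < 4), neg_div]
  rw [h4, h3, h1]
  norm_num

theorem mixedEnvelope_placeScale (t : ℝ) {β : K} (hβ : β ≠ 0) :
    ∃ c : InfinitePlace K → ℝ, ∀ s, mixedEnvelope t (placeScale (-s) (mixedEmbedding K β)) =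
      ∏ w, exp (-|c w - s w| / 4) := by
  have hpos : ∀ w : InfinitePlace K, 0 < w β := fun w => pos_iff.2 hβ
  refine ⟨fun w => log (mult w * w β / (1 + 2 * π * mult w * |t|)), fun s => ?_⟩
  have h1 : ∀ (w : InfinitePlace K) (d : ℝ), d = mult w →
      envelope (d * (exp (-s w) * w β) / (1 + 2 * π * d * |t|)) =
      exp (-|log (mult w * w β / (1 + 2 * π * mult w * |t|)) - s w| / 4) := by
    rintro w d rfl
    have hm : (0 : ℝ) < mult w := by exact_mod_cast mult_pos
    have hd : 0 < 1 + 2 * π * mult w * |t| := by positivity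
    have hp : 0 < mult w * w β / (1 + 2 * π * mult w * |t|) := by
      have := hpos w
      positivity
    have e : (mult w : ℝ) * (exp (-s w) * w β) / (1 + 2 * π * mult w * |t|) =
        mult w * w β / (1 + 2 * π * mult w * |t|) * exp (-s w) := by ring
    rw [envelope, e, log_mul hp.ne' (exp_pos _).ne', log_exp, ← sub_eq_add_neg]
  rw [mixedEnvelope, prod_eq_prod_mul_prod]
  congr 1
  · refine Finset.prod_congr rfl fun w _ => ?_
    rw [← h1 w (finrank ℝ ℝ) (by simp [mult_isReal]), placeScale, norm_mul,
      mixedEmbedding_apply_isReal, norm_embedding_of_isReal, norm_eq_abs, abs_exp, Pi.neg_apply]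
  · refine Finset.prod_congr rfl fun w _ => ?_
    rw [← h1 w (finrank ℝ ℂ) (by simp [mult_isComplex]), placeScale, norm_mul,
      mixedEmbedding_apply_isComplex, norm_embedding_eq, Complex.norm_real, norm_eq_abs, abs_exp,
      Pi.neg_apply]

theorem lintegral_mixedEnvelope_placeScale (t : ℝ) {β : K} (hβ : β ≠ 0) :
    ∫⁻ s, ENNReal.ofReal (mixedEnvelope t (placeScale (-s) (mixedEmbedding K β))) =
      ENNReal.ofReal (8 ^ Fintype.card (InfinitePlace K)) := by
  obtain ⟨c, hc⟩ := mixedEnvelope_placeScale t hβ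
  have h1 := integral_fintype_prod_volume_eq_prod (𝕜 := ℝ)
    (fun (w : InfinitePlace K) (t : ℝ) => exp (-|c w - t| / 4))
  have hi : Integrable fun s : InfinitePlace K → ℝ => ∏ w, exp (-|c w - s w| / 4) :=
    Integrable.fintype_prod (f := fun w t => exp (-|c w - t| / 4)) fun w => by
      by_contra h
      have := integral_undef h
      rw [integral_exp_neg_abs_sub] at this
      norm_num at this
  simp only [hc]
  rw [← ofReal_integral_eq_lintegral_ofReal hi (Filter.Eventually.of_forall fun s =>
    Finset.prod_nonneg fun _ _ => (exp_pos _).le), h1]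
  simp only [integral_exp_neg_abs_sub, Finset.prod_const, Finset.card_univ]

variable (K) in
/-- The weighted mass of the Fourier transform of the step function. -/
noncomputable def stepMass (T e : ℝ) : ℝ≥0∞ :=
  ∫⁻ t, ENNReal.ofReal (‖logStepFourier T t‖ * (1 + |t|) ^ ((finrank ℚ K : ℝ) * (1 / 2 + e)))

variable (K) in
/-- The sum of the `-(1 + e)`-th powers of the norms of the ideals. -/
noncomputable def idealZeta (e : ℝ) : ℝ≥0∞ :=
  ∑' J : (Ideal (𝓞 K))⁰, ENNReal.ofReal ((Ideal.absNorm (J : Ideal (𝓞 K)) : ℝ) ^ (-(1 + e)))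

/-- The weight of an element in the error term. -/
noncomputable def errorKernel (T e : ℝ) (β : K) (s : InfinitePlace K → ℝ) : ℝ≥0∞ :=
  ∫⁻ t, ENNReal.ofReal (‖logStepFourier T t‖ * (1 + |t|) ^ ((finrank ℚ K : ℝ) * (1 / 2 + e))) *
    ENNReal.ofReal (mixedEnvelope t (placeScale (-s) (mixedEmbedding K β)))

theorem measurable_placeScale_neg (β : K) :
    Measurable fun s : InfinitePlace K → ℝ => placeScale (-s) (mixedEmbedding K β) := by
  have : Continuous fun s : InfinitePlace K → ℝ => placeScale (-s) (mixedEmbedding K β) := by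
    unfold placeScale
    simp only [Pi.neg_apply]
    fun_prop
  exact this.measurable

theorem measurable_stepWeight {T : ℝ} (hT : 1 ≤ T) (A : ℝ) :
    Measurable fun t : ℝ => ENNReal.ofReal (‖logStepFourier T t‖ * (1 + |t|) ^ A) :=
  ((continuous_logStepFourier hT).norm.measurable.mul
    ((measurable_const.add measurable_norm).pow_const _)).ennreal_ofReal

theorem measurable_mixedEnvelope_placeScale (β : K) :
    Measurable fun p : (InfinitePlace K → ℝ) × ℝ =>
      ENNReal.ofReal (mixedEnvelope p.2 (placeScale (-p.1) (mixedEmbedding K β))) := by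
  have h1 : Measurable fun p : (InfinitePlace K → ℝ) × ℝ =>
      (p.2, placeScale (-p.1) (mixedEmbedding K β)) :=
    measurable_snd.prodMk ((measurable_placeScale_neg β).comp measurable_fst)
  have h2 : Measurable fun q : ℝ × mixedSpace K => mixedEnvelope q.1 q.2 := measurable_mixedEnvelope
  exact (h2.comp h1).ennreal_ofReal

theorem measurable_errorIntegrand {T : ℝ} (hT : 1 ≤ T) (e : ℝ) (β : K) :
    Measurable fun p : (InfinitePlace K → ℝ) × ℝ =>
      ENNReal.ofReal (‖logStepFourier T p.2‖ * (1 + |p.2|) ^ ((finrank ℚ K : ℝ) * (1 / 2 + e))) *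
      ENNReal.ofReal (mixedEnvelope p.2 (placeScale (-p.1) (mixedEmbedding K β))) :=
  ((measurable_stepWeight hT _).comp measurable_snd).mul (measurable_mixedEnvelope_placeScale β)

theorem measurable_errorKernel {T : ℝ} (hT : 1 ≤ T) (e : ℝ) (β : K) :
    Measurable (errorKernel T e β) :=
  (measurable_errorIntegrand hT e β).lintegral_prod_right'

theorem lintegral_errorKernel {T : ℝ} (hT : 1 ≤ T) (e : ℝ) {β : K} (hβ : β ≠ 0) :
    ∫⁻ s, errorKernel T e β s =
      stepMass K T e * ENNReal.ofReal (8 ^ Fintype.card (InfinitePlace K)) := by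
  unfold errorKernel
  rw [lintegral_lintegral_swap (measurable_errorIntegrand hT e β).aemeasurable, stepMass,
    ← lintegral_mul_const']
  · refine lintegral_congr fun t => ?_
    rw [lintegral_const_mul' _ _ ENNReal.ofReal_ne_top, lintegral_mixedEnvelope_placeScale t hβ]
  · exact ENNReal.ofReal_ne_top

theorem placeScale_neg_mul (u : (𝓞 K)ˣ) (β : K) (s : InfinitePlace K → ℝ) (t : ℝ) :
    mixedEnvelope t (placeScale (-s) (mixedEmbedding K ((u : K) * β))) =
      mixedEnvelope t (placeScale (-(s - logPlaces (u : K))) (mixedEmbedding K β)) := by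
  have hpos : ∀ w : InfinitePlace K, 0 < w (u : K) := fun w => pos_iff.2 (by simp)
  have hexp : ∀ w : InfinitePlace K, exp ((-(s - logPlaces (u : K))) w) =
      exp ((-s) w) * w (u : K) := fun w => by
    rw [neg_sub, sub_eq_add_neg, Pi.add_apply, exp_add, logPlaces, exp_log (hpos w), mul_comm]
  rw [mixedEnvelope, mixedEnvelope]
  congr 1
  · refine Finset.prod_congr rfl fun w _ => ?_
    simp only [placeScale]
    rw [hexp, map_mul, Prod.fst_mul, Pi.mul_apply, norm_mul, norm_mul, norm_mul, norm_mul,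
      mixedEmbedding_apply_isReal K (u : K) w, norm_embedding_of_isReal, norm_eq_abs (w.1 (u : K)),
      abs_of_pos (hpos _)]
    simp only [mul_assoc]
  · refine Finset.prod_congr rfl fun w _ => ?_
    simp only [placeScale]
    rw [hexp, map_mul, Prod.snd_mul, Pi.mul_apply, norm_mul, norm_mul, norm_mul,
      mixedEmbedding_apply_isComplex K (u : K) w, norm_embedding_eq, Complex.ofReal_mul, norm_mul,
      Complex.norm_real (w.1 (u : K)), norm_eq_abs (w.1 (u : K)), abs_of_pos (hpos _)]
    simp only [mul_assoc]

theorem errorKernel_unit_mul (T e : ℝ) (u : (𝓞 K)ˣ) (β : K) (s : InfinitePlace K → ℝ) :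
    errorKernel T e ((u : K) * β) s = errorKernel T e β (s - logPlaces (u : K)) := by
  simp only [errorKernel, placeScale_neg_mul]

/-- Unfolding of the error term. -/
theorem tsum_setLIntegral_errorKernel {X : Type*} {𝔟 : X → (FractionalIdeal (𝓞 K)⁰ K)ˣ}
    (h𝔟 : Function.Bijective fun x => ClassGroup.mk K (𝔟 x)) {T : ℝ} (hT : 1 ≤ T) (e A : ℝ) (hA : 0 ≤ A) :
    ∑' c, ∑' β : nonzeroElements (𝔟 c), ∫⁻ s in unitDomain K, ENNReal.ofReal
      (A * (|(Algebra.norm ℚ (β : K) : ℝ)| / FractionalIdeal.absNorm (𝔟 c).1) ^ (-(1 + e))) *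
        errorKernel T e (β : K) s =
      torsionOrder K * (ENNReal.ofReal A * ENNReal.ofReal (8 ^ Fintype.card (InfinitePlace K)) *
        stepMass K T e * idealZeta K e) := by
  let f : X → K → (InfinitePlace K → ℝ) → ℝ≥0∞ := fun c β s => ENNReal.ofReal
      (A * (|(Algebra.norm ℚ β : ℝ)| / FractionalIdeal.absNorm (𝔟 c).1) ^ (-(1 + e))) *
        errorKernel T e β s
  have h := tsum_tsum_lintegral_unitDomain 𝔟 h𝔟 (f := f)
    (Ψ := fun y => ENNReal.ofReal (A * y ^ (-(1 + e))) *
      (stepMass K T e * ENNReal.ofReal (8 ^ Fintype.card (InfinitePlace K)))) ?_ ?_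
  · refine h.trans ?_
    congr 1
    rw [ENNReal.tsum_mul_right, idealZeta]
    simp only [ENNReal.ofReal_mul hA]
    rw [ENNReal.tsum_mul_left]
    ring
  · intro c β hβ
    have hm : Measurable (f c β) := (measurable_errorKernel hT e β).const_mul _
    rw [← tsum_lintegral_unitDomain_sub hm]
    refine tsum_congr fun u => lintegral_congr fun s => ?_
    have hn : |(Algebra.norm ℚ ((u : K) * β) : ℝ)| = |(Algebra.norm ℚ β : ℝ)| := by
      have := NumberField.Units.norm (K := K) u
      rw [map_mul, Rat.cast_mul, abs_mul]
      rw [show |(Algebra.norm ℚ (u : K) : ℝ)| = 1 by exact_mod_cast this, one_mul]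
    simp only [f, errorKernel_unit_mul, hn]
  · intro c β hβ
    simp only [f]
    rw [lintegral_const_mul' _ _ ENNReal.ofReal_ne_top, lintegral_errorKernel hT e hβ]

end ErrorTerm

section PoissonBound

open MeasureTheory Module Real NumberField NumberField.InfinitePlace NumberField.mixedEmbedding
open NumberField.Units NumberField.Units.dirichletUnitTheorem
open scoped Classical ENNReal

theorem exists_enorm_fourier_normCutoff_le :
    ∃ C : ℝ, 1 ≤ C ∧ ∀ (K : Type*) [Field K] [NumberField K] (T : ℝ), 1 ≤ T →
      ∀ (l : ℝ) (β : K), β ≠ 0 → ∀ (s : InfinitePlace K → ℝ) (e : ℝ), 0 < e → e ≤ 1 / 4 →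
      ‖∫ v, mixedChar (placeScale (-s) (mixedEmbedding K β)) v * normCutoff T l v‖ₑ ≤
        ENNReal.ofReal (C ^ Fintype.card (InfinitePlace K) *
          (exp (-degreeSum s) * |(Algebra.norm ℚ β : ℝ)|) ^ (-(1 + e))) * errorKernel T e β s := by
  obtain ⟨C, hC, h⟩ := exists_norm_fourier_normCutoff_le
  refine ⟨C, hC, fun K _ _ T hT l β hβ s e he he' => ?_⟩
  have hneg : degreeSum (-s) = -degreeSum s := by simp [degreeSum]
  have hN : mixedNorm (placeScale (-s) (mixedEmbedding K β)) =
      exp (-degreeSum s) * |(Algebra.norm ℚ β : ℝ)| := by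
    rw [mixedNorm_placeScale, mixedNorm_mixedEmbedding, hneg]
  have hpos : 0 < exp (-degreeSum s) * |(Algebra.norm ℚ β : ℝ)| :=
    mul_pos (exp_pos _) (abs_norm_pos hβ)
  have h1 := h {w : InfinitePlace K // IsReal w} {w : InfinitePlace K // IsComplex w} T hT l
    (placeScale (-s) (mixedEmbedding K β)) (by rw [hN]; exact hpos.ne') e he he'
  have hc1 : Fintype.card {w : InfinitePlace K // IsReal w} +
      Fintype.card {w : InfinitePlace K // IsComplex w} = Fintype.card (InfinitePlace K) :=
    (card_eq_nrRealPlaces_add_nrComplexPlaces K).symm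
  have hc2 : Fintype.card {w : InfinitePlace K // IsReal w} +
      2 * Fintype.card {w : InfinitePlace K // IsComplex w} = finrank ℚ K :=
    card_add_two_mul_card_eq_rank K
  rw [hc1, hc2, hN] at h1
  rw [← ofReal_norm]
  refine (ENNReal.ofReal_le_ofReal h1).trans ?_
  have hnn : 0 ≤ C ^ Fintype.card (InfinitePlace K) *
      (exp (-degreeSum s) * |(Algebra.norm ℚ β : ℝ)|) ^ (-(1 + e)) :=
    mul_nonneg (by positivity) (rpow_nonneg hpos.le _)
  rw [← mul_assoc, ENNReal.ofReal_mul hnn]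
  refine mul_le_mul_right ?_ _
  refine (ofReal_integral_le_lintegral fun t => mul_nonneg (by positivity)
    (mixedEnvelope_nonneg _ _)).trans_eq ?_
  rw [errorKernel]
  refine lintegral_congr fun t => ?_
  rw [ENNReal.ofReal_mul (by positivity)]

variable (K : Type*) [Field K] [NumberField K]

/-- The coefficient of the error term. -/
noncomputable def errorCoeff (C T x e : ℝ) : ℝ :=
  C ^ Fintype.card (InfinitePlace K) * ((2⁻¹ : ℝ) ^ nrComplexPlaces K * √(absDiscr K))⁻¹ *
    absDiscr K ^ (1 + e) * (3 ^ finrank ℚ K * exp 1 * T / x) ^ e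

variable {K}

theorem errorCoeff_nonneg {C T x e : ℝ} (hC : 1 ≤ C) (hT : 1 ≤ T) (hx : 0 < x) :
    0 ≤ errorCoeff K C T x e := by
  have := absDiscr_pos (K := K)
  unfold errorCoeff
  positivity

/-- The density of the error term. -/
noncomputable def errorDensity (𝔞 : (FractionalIdeal (𝓞 K)⁰ K)ˣ) (C T x e : ℝ)
    (s : InfinitePlace K → ℝ) : ℝ≥0∞ :=
  ∑' β : nonzeroElements (dualIdeal 𝔞), ENNReal.ofReal (errorCoeff K C T x e *
    (|(Algebra.norm ℚ (β : K) : ℝ)| / FractionalIdeal.absNorm (dualIdeal 𝔞).1) ^ (-(1 + e))) *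
      errorKernel T e (β : K) s

/-- The density of the smoothed counting function. -/
noncomputable def countDensity (𝔞 : (FractionalIdeal (𝓞 K)⁰ K)ˣ) (T x : ℝ)
    (s : InfinitePlace K → ℝ) : ℝ≥0∞ :=
  ∑' α : nonzeroElements 𝔞,
    ENNReal.ofReal (normCutoff T (-degreeSum s - log (x * FractionalIdeal.absNorm 𝔞.1))
      (placeScale s (mixedEmbedding K α)))

theorem errorCoeff_bound (𝔞 : (FractionalIdeal (𝓞 K)⁰ K)ˣ) {C T x e σ N : ℝ} (hC : 1 ≤ C)
    (hT : 1 ≤ T) (hx : 0 < x) (he : 0 < e) (hN : 0 < N)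
    (hσ : exp σ ≤ 3 ^ finrank ℚ K * exp 1 * T / (x * FractionalIdeal.absNorm 𝔞.1)) :
    (idealCovolume 𝔞)⁻¹ * exp (-σ) * (C ^ Fintype.card (InfinitePlace K) *
      (exp (-σ) * N) ^ (-(1 + e))) ≤
      errorCoeff K C T x e * (N / FractionalIdeal.absNorm (dualIdeal 𝔞).1) ^ (-(1 + e)) := by
  have hD := absDiscr_pos (K := K)
  have hA := absNorm_pos 𝔞
  rw [absNorm_dualIdeal, idealCovolume, errorCoeff, div_inv_eq_mul]
  set A : ℝ := ((FractionalIdeal.absNorm 𝔞.1 : ℚ) : ℝ)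
  set D := absDiscr K
  set q := (2⁻¹ : ℝ) ^ nrComplexPlaces K * √D
  have hq : 0 < q := mul_pos (by positivity) (sqrt_pos.2 hD)
  set Y : ℝ := 3 ^ finrank ℚ K * exp 1 * T with hY
  have hYpos : 0 < Y := by positivity
  set c := C ^ Fintype.card (InfinitePlace K)
  have hc : 0 < c := by positivity
  rw [mul_rpow (exp_pos _).le hN.le, mul_rpow hN.le (by positivity), mul_rpow hA.le hD.le]
  have h1 : exp (-σ) * exp (-σ) ^ (-(1 + e)) = exp σ ^ e := by
    rw [← exp_mul, ← exp_mul, ← exp_add]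
    congr 1
    ring
  have h2 : exp σ ^ e ≤ (Y / x) ^ e * A ^ (-e) := by
    have : exp σ ^ e ≤ (Y / (x * A)) ^ e := rpow_le_rpow (exp_pos _).le hσ he.le
    refine this.trans_eq ?_
    rw [rpow_neg hA.le, ← inv_rpow hA.le, ← mul_rpow (by positivity) (by positivity)]
    congr 1
    field_simp
  have h3 : D ^ (1 + e) * D ^ (-(1 + e)) = 1 := by
    rw [← rpow_add hD, add_neg_cancel, rpow_zero]
  have h4 : A ^ (-(1 + e)) = A⁻¹ * A ^ (-e) := by
    rw [neg_add, rpow_add hA, rpow_neg_one]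
  calc (A * q)⁻¹ * exp (-σ) * (c * (exp (-σ) ^ (-(1 + e)) * N ^ (-(1 + e))))
      = c * q⁻¹ * A⁻¹ * N ^ (-(1 + e)) * (exp (-σ) * exp (-σ) ^ (-(1 + e))) := by
        rw [mul_inv]; ring
    _ ≤ c * q⁻¹ * A⁻¹ * N ^ (-(1 + e)) * ((Y / x) ^ e * A ^ (-e)) := by
        rw [h1]
        exact mul_le_mul_of_nonneg_left h2 (by positivity)
    _ = c * q⁻¹ * (D ^ (1 + e) * D ^ (-(1 + e))) * (Y / x) ^ e *
          (N ^ (-(1 + e)) * (A⁻¹ * A ^ (-e))) := by rw [h3]; ring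
    _ = _ := by rw [← h4]; ring

/-- Poisson summation in terms of densities. -/
theorem exists_poisson_density :
    ∃ C : ℝ, 1 ≤ C ∧ ∀ (K : Type*) [Field K] [NumberField K] (𝔞 : (FractionalIdeal (𝓞 K)⁰ K)ˣ)
      (T x e : ℝ), 1 ≤ T → 0 < x → 0 < e → e ≤ 1 / 4 → ∀ s : InfinitePlace K → ℝ,
      countDensity 𝔞 T x s ≤ mainDensity 𝔞 T x s + errorDensity 𝔞 C T x e s ∧
      mainDensity 𝔞 T x s ≤ countDensity 𝔞 T x s + errorDensity 𝔞 C T x e s := by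
  obtain ⟨C, hC, h⟩ := exists_enorm_fourier_normCutoff_le
  refine ⟨C, hC, fun K _ _ 𝔞 T x e hT hx he he' s => ?_⟩
  have hA := absNorm_pos 𝔞
  have hc2 : Fintype.card {w : InfinitePlace K // IsReal w} +
      2 * Fintype.card {w : InfinitePlace K // IsComplex w} = finrank ℚ K :=
    card_add_two_mul_card_eq_rank K
  set l := -degreeSum s - log (x * FractionalIdeal.absNorm 𝔞.1) with hl
  by_cases hs : exp (degreeSum s) ≤
      3 ^ finrank ℚ K * exp 1 * T / (x * FractionalIdeal.absNorm 𝔞.1)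
  · have hE : ENNReal.ofReal ((idealCovolume 𝔞)⁻¹ * exp (-degreeSum s)) * dualSum 𝔞 T l s ≤
        errorDensity 𝔞 C T x e s := by
      rw [dualSum, ← ENNReal.tsum_mul_left, errorDensity]
      refine ENNReal.tsum_le_tsum fun β => ?_
      refine (mul_le_mul_right (h K T hT l β β.2.2 s e he he') _).trans ?_
      rw [← mul_assoc, ← ENNReal.ofReal_mul
        (mul_nonneg (inv_nonneg.2 (idealCovolume_pos 𝔞).le) (exp_pos _).le)]
      exact mul_le_mul_left (ENNReal.ofReal_le_ofReal
        (errorCoeff_bound 𝔞 hC hT hx he (abs_norm_pos β.2.2) hs)) _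
    obtain ⟨h1, h2⟩ := poisson_normCutoff 𝔞 hT l s
    rw [mul_add] at h1
    exact ⟨h1.trans (by gcongr; exact le_rfl), h2.trans (by gcongr; exact le_rfl)⟩
  · have hz : ∀ v : mixedSpace K, normCutoff T l v = 0 := by
      intro v
      rw [normCutoff]
      by_cases hv : mixedWeight v = 0
      · rw [hv, mul_zero]
      have hb := mixedNorm_bounds hv
      rw [hc2] at hb
      have hNv : 0 < mixedNorm v := lt_of_lt_of_le one_pos hb.1
      rw [logStep_eq_zero_of_ge hT, zero_mul]
      have h1 : log (mixedNorm v) ≤ log (3 ^ finrank ℚ K) := log_le_log hNv hb.2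
      have h2 := log_lt_log (by positivity) (not_le.1 hs)
      rw [log_exp, log_div (by positivity) (by positivity), log_mul (by positivity) (by positivity),
        log_mul (by positivity) (exp_pos _).ne', log_exp] at h2
      rw [hl]
      linarith
    have h1 : countDensity 𝔞 T x s = 0 := by
      rw [countDensity, ENNReal.tsum_eq_zero]
      intro α
      rw [← hl, hz, ENNReal.ofReal_zero]
    have h2 : mainDensity 𝔞 T x s = 0 := by
      rw [mainDensity, ← hl]
      simp [hz]
    rw [h1, h2]
    exact ⟨zero_le, zero_le⟩

instance countable_nonzeroElements (𝔞 : (FractionalIdeal (𝓞 K)⁰ K)ˣ) :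
    Countable (nonzeroElements 𝔞) := by
  have h : Set.Countable {x : K | IsAlgebraic ℚ x} := Algebraic.countable ℚ K
  have h1 : {x : K | IsAlgebraic ℚ x} = Set.univ :=
    Set.eq_univ_of_forall fun x => Algebra.IsAlgebraic.isAlgebraic x
  rw [h1] at h
  have : Countable K := Set.countable_univ_iff.1 h
  infer_instance

theorem measurable_countTerm (𝔞 : (FractionalIdeal (𝓞 K)⁰ K)ˣ) (T x : ℝ) (α : nonzeroElements 𝔞) :
    Measurable fun s : InfinitePlace K → ℝ =>
      ENNReal.ofReal (normCutoff T (-degreeSum s - log (x * FractionalIdeal.absNorm 𝔞.1))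
        (placeScale s (mixedEmbedding K (α : K)))) := by
  simp only [normCutoff_placeScale α.2.2]
  exact ((continuous_placeWeight.comp (continuous_add_const _)).const_mul _).measurable.ennreal_ofReal

/-- The smoothed count of ideals equals its main term up to the error term. -/
theorem exists_smoothCount_bounds :
    ∃ C : ℝ, 1 ≤ C ∧ ∀ (K : Type*) [Field K] [NumberField K] (T x e : ℝ), 1 ≤ T → 0 < x → 0 < e →
      e ≤ 1 / 4 →
      torsionOrder K * (smoothCount K T x * placeMass K) ≤
        ENNReal.ofReal x * mainMass K (fun u => ENNReal.ofReal (logStep T u)) +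
        torsionOrder K * (ENNReal.ofReal (errorCoeff K C T x e) *
          ENNReal.ofReal (8 ^ Fintype.card (InfinitePlace K)) * stepMass K T e * idealZeta K e) ∧
      ENNReal.ofReal x * mainMass K (fun u => ENNReal.ofReal (logStep T u)) ≤
        torsionOrder K * (smoothCount K T x * placeMass K) +
        torsionOrder K * (ENNReal.ofReal (errorCoeff K C T x e) *
          ENNReal.ofReal (8 ^ Fintype.card (InfinitePlace K)) * stepMass K T e * idealZeta K e) := by
  obtain ⟨C, hC, h⟩ := exists_poisson_density
  refine ⟨C, hC, fun K _ _ T x e hT hx he he' => ?_⟩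
  obtain ⟨𝔞, h𝔞⟩ : ∃ 𝔞 : ClassGroup (𝓞 K) → (FractionalIdeal (𝓞 K)⁰ K)ˣ,
      ∀ c, ClassGroup.mk K (𝔞 c) = c := by
    refine ⟨fun c => FractionalIdeal.mk0 K (ClassGroup.mk0_surjective c).choose, fun c => ?_⟩
    rw [ClassGroup.mk_mk0]
    exact (ClassGroup.mk0_surjective c).choose_spec
  have hbij : Function.Bijective fun c => ClassGroup.mk K (𝔞 c) := by
    have : (fun c => ClassGroup.mk K (𝔞 c)) = id := funext h𝔞
    rw [this]
    exact Function.bijective_id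
  have hcount : ∑' c, ∫⁻ s in unitDomain K, countDensity (𝔞 c) T x s =
      torsionOrder K * (smoothCount K T x * placeMass K) := by
    rw [← tsum_lintegral_normCutoff hbij hT hx]
    refine tsum_congr fun c => ?_
    unfold countDensity
    exact lintegral_tsum fun α => (measurable_countTerm _ T x α).aemeasurable
  have herr : ∑' c, ∫⁻ s in unitDomain K, errorDensity (𝔞 c) C T x e s =
      torsionOrder K * (ENNReal.ofReal (errorCoeff K C T x e) *
          ENNReal.ofReal (8 ^ Fintype.card (InfinitePlace K)) * stepMass K T e * idealZeta K e) := by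
    rw [← tsum_setLIntegral_errorKernel (bijective_mk_dualIdeal hbij) hT e _
      (errorCoeff_nonneg hC hT hx)]
    refine tsum_congr fun c => ?_
    unfold errorDensity
    exact lintegral_tsum fun β => ((measurable_errorKernel hT e _).const_mul _).aemeasurable
  have hmain := tsum_setLIntegral_mainDensity 𝔞 hT hx
  rw [← hcount, ← herr, ← hmain, ← ENNReal.tsum_add, ← ENNReal.tsum_add]
  constructor
  · refine ENNReal.tsum_le_tsum fun c => ?_
    rw [← lintegral_add_left (measurable_mainDensity (𝔞 c) hT x)]
    exact lintegral_mono fun s => (h K (𝔞 c) T x e hT hx he he' s).1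
  · refine ENNReal.tsum_le_tsum fun c => ?_
    have hm : Measurable (countDensity (𝔞 c) T x) := by
      unfold countDensity
      exact Measurable.tsum fun α => measurable_countTerm (𝔞 c) T x α
    rw [← lintegral_add_left hm]
    exact lintegral_mono fun s => (h K (𝔞 c) T x e hT hx he he' s).2

end PoissonBound

section ZetaBound

open NumberField Module Ideal
open scoped ENNReal

/-- A power of a sum is the sum over tuples of the products. -/
theorem ENNReal.tsum_fin_prod {α : Type*} (f : α → ℝ≥0∞) (n : ℕ) :
    ∑' m : Fin n → α, ∏ j, f (m j) = (∑' a, f a) ^ n := by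
  induction n with
  | zero => simp
  | succ n ih =>
    rw [← (Fin.consEquiv fun _ : Fin (n + 1) => α).tsum_eq, ENNReal.tsum_prod', pow_succ', ← ih,
      ← ENNReal.tsum_mul_right]
    refine tsum_congr fun a => ?_
    rw [← ENNReal.tsum_mul_left]
    refine tsum_congr fun m => ?_
    simp [Fin.prod_univ_succ, Fin.consEquiv]

theorem Multiset.factorization_prod_eq_count {s : Multiset ℕ} (hs : ∀ p ∈ s, p.Prime) (p : ℕ) :
    s.prod.factorization p = s.count p := by
  induction s using Multiset.induction_on with
  | empty => simp
  | cons a s ih =>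
    have ha := hs a (Multiset.mem_cons_self a s)
    have hs' : ∀ q ∈ s, q.Prime := fun q hq => hs q (Multiset.mem_cons_of_mem hq)
    have h0 : s.prod ≠ 0 := Multiset.prod_ne_zero fun h => Nat.not_prime_zero (hs' 0 h)
    rw [Multiset.prod_cons, Nat.factorization_mul ha.ne_zero h0, Finsupp.add_apply, ih hs',
      Multiset.count_cons, ha.factorization, Finsupp.single_apply, add_comm]
    simp only [eq_comm]

variable {K : Type*} [Field K] [NumberField K]

/-- The rational prime below a prime ideal. -/
noncomputable def primeBelow (P : Ideal (𝓞 K)) : ℕ :=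
  absNorm (under ℤ P)

theorem prime_primeBelow {P : Ideal (𝓞 K)} (hP : Prime P) : (primeBelow P).Prime := by
  have : P.IsPrime := isPrime_of_prime hP
  have : NeZero P := ⟨hP.ne_zero⟩
  exact Nat.absNorm_under_prime P

theorem primeBelow_le_absNorm {P : Ideal (𝓞 K)} (hP : Prime P) : primeBelow P ≤ absNorm P :=
  Nat.le_of_dvd (Nat.pos_of_ne_zero (absNorm_eq_zero_iff.not.2 hP.ne_zero))
    (Int.absNorm_under_dvd_absNorm P)

omit [NumberField K] in
theorem span_primeBelow (P : Ideal (𝓞 K)) : Ideal.span {(primeBelow P : ℤ)} = under ℤ P :=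
  Int.ideal_span_absNorm_eq_self _

variable (K) in
/-- The prime ideals above each rational prime can be told apart by `n` labels if `n` is at least
the degree. -/
theorem exists_primeLabel {n : ℕ} (hn : finrank ℚ K ≤ n) :
    ∃ i : Ideal (𝓞 K) → Fin n, ∀ P Q, Prime P → Prime Q → primeBelow P = primeBelow Q →
      i P = i Q → P = Q := by
  have hn0 : 0 < n := finrank_pos.trans_le hn
  have : Nonempty (Fin n) := ⟨⟨0, hn0⟩⟩
  have key : ∀ p : ℕ, ∃ f : Ideal (𝓞 K) → Fin n,
      Set.InjOn f {P | Prime P ∧ primeBelow P = p} := by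
    intro p
    by_cases hp : p.Prime
    · have hp0 : Ideal.span {(p : ℤ)} ≠ ⊥ := by simpa using hp.ne_zero
      have hmax : (Ideal.span {(p : ℤ)}).IsMaximal := by
        have := Fact.mk hp
        exact Int.ideal_span_isMaximal_of_prime p
      have hsub : {P : Ideal (𝓞 K) | Prime P ∧ primeBelow P = p} ⊆
          IsDedekindDomain.primesOverFinset (Ideal.span {(p : ℤ)}) (𝓞 K) := by
        rintro P ⟨hP, hPp⟩
        refine (IsDedekindDomain.mem_primesOverFinset_iff hp0 _).2 ⟨isPrime_of_prime hP, ⟨?_⟩⟩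
        rw [← span_primeBelow, hPp]
      have hcard := card_primesOverFinset_le_finrank (S := 𝓞 K) ℚ K hp0
      obtain ⟨g⟩ : Nonempty (IsDedekindDomain.primesOverFinset (Ideal.span {(p : ℤ)}) (𝓞 K) ↪
          Fin n) := Function.Embedding.nonempty_of_card_le (by
            rw [Fintype.card_coe, Fintype.card_fin]
            exact hcard.trans hn)
      classical
      refine ⟨fun P => if h : P ∈ IsDedekindDomain.primesOverFinset (Ideal.span {(p : ℤ)}) (𝓞 K)
        then g ⟨P, h⟩ else Classical.arbitrary _, fun P hP Q hQ h => ?_⟩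
      have hP' := Finset.mem_coe.1 (hsub hP)
      have hQ' := Finset.mem_coe.1 (hsub hQ)
      simp only [dif_pos hP', dif_pos hQ'] at h
      exact congrArg Subtype.val (g.injective h)
    · refine ⟨fun _ => Classical.arbitrary _, fun P hP => ?_⟩
      exact absurd (hP.2 ▸ prime_primeBelow hP.1) hp
  choose f hf using key
  refine ⟨fun P => f (primeBelow P) P, fun P Q hP hQ h h' => hf (primeBelow P) ⟨hP, rfl⟩
    ⟨hQ, h.symm⟩ ?_⟩
  simp only at h'
  rw [h', h]

open UniqueFactorizationMonoid

/-- The product of the rational primes below the prime factors with a given label. -/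
noncomputable def labelPart {n : ℕ} (i : Ideal (𝓞 K) → Fin n) (I : Ideal (𝓞 K)) (j : Fin n) : ℕ :=
  (((normalizedFactors I).filter fun P => i P = j).map primeBelow).prod

theorem factorization_labelPart {n : ℕ} {i : Ideal (𝓞 K) → Fin n}
    (hi : ∀ P Q, Prime P → Prime Q → primeBelow P = primeBelow Q → i P = i Q → P = Q)
    (I : Ideal (𝓞 K)) {P : Ideal (𝓞 K)} (hP : Prime P) :
    (labelPart i I (i P)).factorization (primeBelow P) = (normalizedFactors I).count P := by
  classical
  rw [labelPart, Multiset.factorization_prod_eq_count, Multiset.count_map, Multiset.filter_filter,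
    Multiset.count_eq_card_filter_eq]
  · congr 1
    refine Multiset.filter_congr fun Q hQ => ⟨fun h => ?_, fun h => ?_⟩
    · exact hi P Q hP (prime_of_normalized_factor Q hQ) h.1 h.2.symm
    · subst h; exact ⟨rfl, rfl⟩
  · intro p hp
    obtain ⟨Q, hQ, rfl⟩ := Multiset.mem_map.1 hp
    exact prime_primeBelow (prime_of_normalized_factor Q (Multiset.mem_filter.1 hQ).1)

theorem labelPart_injective {n : ℕ} {i : Ideal (𝓞 K) → Fin n}
    (hi : ∀ P Q, Prime P → Prime Q → primeBelow P = primeBelow Q → i P = i Q → P = Q) :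
    Function.Injective fun J : (Ideal (𝓞 K))⁰ => labelPart i (J : Ideal (𝓞 K)) := by
  classical
  intro I J h
  have hI : (I : Ideal (𝓞 K)) ≠ 0 := nonZeroDivisors.coe_ne_zero I
  have hJ : (J : Ideal (𝓞 K)) ≠ 0 := nonZeroDivisors.coe_ne_zero J
  have hc : normalizedFactors (I : Ideal (𝓞 K)) = normalizedFactors (J : Ideal (𝓞 K)) := by
    ext P
    by_cases hP : Prime P
    · rw [← factorization_labelPart hi _ hP, ← factorization_labelPart hi _ hP]
      exact congrArg (fun m : Fin n → ℕ => (m (i P)).factorization (primeBelow P)) h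
    · rw [Multiset.count_eq_zero_of_notMem fun hm => hP (prime_of_normalized_factor P hm),
        Multiset.count_eq_zero_of_notMem fun hm => hP (prime_of_normalized_factor P hm)]
  refine Subtype.ext ?_
  rw [← associated_iff_eq]
  exact (associated_iff_normalizedFactors_eq_normalizedFactors hI hJ).2 hc

theorem labelPart_pos {n : ℕ} (i : Ideal (𝓞 K) → Fin n) (I : Ideal (𝓞 K)) (j : Fin n) :
    0 < labelPart i I j := by
  refine Nat.pos_of_ne_zero (Multiset.prod_ne_zero fun h => ?_)
  obtain ⟨Q, hQ, h0⟩ := Multiset.mem_map.1 h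
  exact (prime_primeBelow (prime_of_normalized_factor Q (Multiset.mem_filter.1 hQ).1)).ne_zero h0

theorem prod_labelPart_le {n : ℕ} (i : Ideal (𝓞 K) → Fin n) {I : Ideal (𝓞 K)} (hI : I ≠ 0) :
    ∏ j, labelPart i I j ≤ absNorm I := by
  have h1 : ∀ s : Multiset (Ideal (𝓞 K)), (∀ P ∈ s, Prime P) →
      ∏ j, ((s.filter fun P => i P = j).map primeBelow).prod ≤ (s.map absNorm).prod := by
    intro s
    induction s using Multiset.induction_on with
    | empty => simp
    | cons P s ih =>
      intro hs
      have ih' := ih fun Q hQ => hs Q (Multiset.mem_cons_of_mem hQ)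
      have hP := hs P (Multiset.mem_cons_self P s)
      have h2 : ∀ j, (((P ::ₘ s).filter fun P => i P = j).map primeBelow).prod =
          (if i P = j then primeBelow P else 1) *
            ((s.filter fun P => i P = j).map primeBelow).prod := by
        intro j
        by_cases h : i P = j
        · simp [h]
        · simp [h]
      simp only [h2, Finset.prod_mul_distrib, Multiset.map_cons, Multiset.prod_cons]
      refine Nat.mul_le_mul ?_ ih'
      simpa using primeBelow_le_absNorm hP
  refine (h1 _ fun P hP => prime_of_normalized_factor P hP).trans (le_of_eq ?_)
  rw [← map_multiset_prod, associated_iff_eq.1 (prod_normalizedFactors hI)]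

/-- The zeta function of a field of degree at most `n` is at most `ζ ^ n`. -/
theorem idealZeta_le {n : ℕ} (hn : finrank ℚ K ≤ n) {e : ℝ} (he : 0 < e) :
    idealZeta K e ≤ (∑' k : ℕ, ENNReal.ofReal ((k : ℝ) ^ (-(1 + e)))) ^ n := by
  obtain ⟨i, hi⟩ := exists_primeLabel K hn
  rw [← ENNReal.tsum_fin_prod]
  refine le_trans (ENNReal.tsum_le_tsum fun J => ?_)
    (ENNReal.tsum_comp_le_tsum_of_injective (labelPart_injective hi) _)
  have hpos : ∀ j, (0 : ℝ) < labelPart i (J : Ideal (𝓞 K)) j := fun j =>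
    Nat.cast_pos.2 (labelPart_pos i _ j)
  rw [← ENNReal.ofReal_prod_of_nonneg fun j _ => Real.rpow_nonneg (hpos j).le _,
    Real.finsetProd_rpow _ _ fun j _ => (hpos j).le]
  refine ENNReal.ofReal_le_ofReal (Real.rpow_le_rpow_of_nonpos
    (Finset.prod_pos fun j _ => hpos j) ?_ (by linarith))
  exact_mod_cast prod_labelPart_le i (nonZeroDivisors.coe_ne_zero J)

theorem exists_idealZeta_le (n : ℕ) {e : ℝ} (he : 0 < e) :
    ∃ C : ℝ, 0 < C ∧ ∀ (K : Type*) [Field K] [NumberField K], finrank ℚ K ≤ n →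
      idealZeta K e ≤ ENNReal.ofReal C := by
  have hs : Summable fun k : ℕ => (k : ℝ) ^ (-(1 + e)) :=
    Real.summable_nat_rpow.2 (by linarith)
  have h0 : ∀ k : ℕ, 0 ≤ (k : ℝ) ^ (-(1 + e)) := fun k => by positivity
  refine ⟨(∑' k : ℕ, (k : ℝ) ^ (-(1 + e))) ^ n, ?_, fun K _ _ hn => ?_⟩
  · refine pow_pos (hs.tsum_pos h0 1 ?_) n
    simp
  · refine (idealZeta_le hn he).trans (le_of_eq ?_)
    rw [ENNReal.ofReal_pow (tsum_nonneg h0), ENNReal.ofReal_tsum_of_nonneg h0 hs]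

/-- Rankin's bound for the number of ideals. -/
theorem idealCount_le_rankin {y e : ℝ} (hy : 0 < y) (he : 0 < e) :
    (idealCount K y : ℝ≥0∞) ≤ ENNReal.ofReal (y ^ (1 + e)) * idealZeta K e := by
  have hfin : Finite {I : (Ideal (𝓞 K))⁰ // (absNorm (I : Ideal (𝓞 K)) : ℝ) ≤ y} := by
    simp_rw [← Nat.le_floor_iff hy.le]
    exact finite_setOfPred_absNorm_le₀ ⌊y⌋₊
  have := Fintype.ofFinite {I : (Ideal (𝓞 K))⁰ // (absNorm (I : Ideal (𝓞 K)) : ℝ) ≤ y}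
  have h1 : (idealCount K y : ℝ≥0∞) =
      ∑' _ : {I : (Ideal (𝓞 K))⁰ // (absNorm (I : Ideal (𝓞 K)) : ℝ) ≤ y}, 1 := by
    rw [idealCount, Nat.card_eq_fintype_card, tsum_fintype]
    simp
  rw [h1, idealZeta, ← ENNReal.tsum_mul_left]
  refine le_trans (ENNReal.tsum_le_tsum fun J => ?_)
    (ENNReal.tsum_comp_le_tsum_of_injective Subtype.val_injective _)
  have hN : (0 : ℝ) < absNorm (J.1 : Ideal (𝓞 K)) :=
    Nat.cast_pos.2 (Nat.pos_of_ne_zero (absNorm_eq_zero_iff.not.2 (nonZeroDivisors.coe_ne_zero J.1)))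
  rw [← ENNReal.ofReal_mul (by positivity), ← ENNReal.ofReal_one]
  refine ENNReal.ofReal_le_ofReal ?_
  rw [Real.rpow_neg hN.le, ← div_eq_mul_inv, one_le_div (by positivity)]
  exact Real.rpow_le_rpow hN.le J.2 (by linarith)

end ZetaBound

section ErrorTerm

open MeasureTheory Module Real NumberField NumberField.InfinitePlace NumberField.mixedEmbedding
open NumberField.Units
open scoped Classical ENNReal

theorem exists_stepMass_le (n : ℕ) {e : ℝ} (he : 0 < e) :
    ∃ C : ℝ, 0 < C ∧ ∀ (K : Type*) [Field K] [NumberField K], finrank ℚ K ≤ n →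
      ∀ T : ℝ, 1 ≤ T → stepMass K T e ≤ ENNReal.ofReal (C * T ^ (n * (1 / 2 + e) + 2 * e)) := by
  obtain ⟨C, hC, h⟩ := exists_integral_logStepFourier_le (A := n * (1 / 2 + e)) (e := e)
    (by positivity) he
  refine ⟨C, hC, fun K _ _ hn T hT => ?_⟩
  obtain ⟨hi, hb⟩ := h T hT
  refine le_trans ?_ (ENNReal.ofReal_le_ofReal hb)
  rw [ofReal_integral_eq_lintegral_ofReal hi (ae_of_all _ fun t => by positivity), stepMass]
  refine lintegral_mono fun t => ENNReal.ofReal_le_ofReal ?_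
  refine mul_le_mul_of_nonneg_left ?_ (norm_nonneg _)
  refine Real.rpow_le_rpow_of_exponent_le (by linarith [abs_nonneg t]) ?_
  exact mul_le_mul_of_nonneg_right (by exact_mod_cast hn) (by positivity)

theorem card_infinitePlace_le_finrank (K : Type*) [Field K] [NumberField K] :
    Fintype.card (InfinitePlace K) ≤ finrank ℚ K := by
  rw [← card_add_two_mul_card_eq_rank K, card_eq_nrRealPlaces_add_nrComplexPlaces]
  omega

theorem nrComplexPlaces_le_finrank (K : Type*) [Field K] [NumberField K] :
    nrComplexPlaces K ≤ finrank ℚ K := by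
  rw [← card_add_two_mul_card_eq_rank K]
  omega

theorem errorCoeff_le {K : Type*} [Field K] [NumberField K] {n : ℕ} (hn : finrank ℚ K ≤ n)
    {C T x e : ℝ} (hC : 1 ≤ C) (hT : 1 ≤ T) (hx : 0 < x) (he : 0 < e) :
    errorCoeff K C T x e ≤
      C ^ n * 2 ^ n * (3 ^ n * exp 1) ^ e * (absDiscr K ^ (1 / 2 + e) * (T / x) ^ e) := by
  have hD := absDiscr_pos (K := K)
  have h1 : C ^ Fintype.card (InfinitePlace K) ≤ C ^ n :=
    pow_le_pow_right₀ hC ((card_infinitePlace_le_finrank K).trans hn)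
  have h2 : ((2⁻¹ : ℝ) ^ nrComplexPlaces K * √(absDiscr K))⁻¹ * absDiscr K ^ (1 + e) ≤
      2 ^ n * absDiscr K ^ (1 / 2 + e) := by
    have h3 : (√(absDiscr K))⁻¹ * absDiscr K ^ (1 + e) = absDiscr K ^ (1 / 2 + e) := by
      rw [sqrt_eq_rpow, ← rpow_neg hD.le, ← rpow_add hD]
      congr 1
      ring
    rw [mul_inv, inv_pow, inv_inv, mul_assoc, h3]
    gcongr
    · norm_num
    · exact (nrComplexPlaces_le_finrank K).trans hn
  have h4 : (3 ^ finrank ℚ K * exp 1 * T / x) ^ e ≤ (3 ^ n * exp 1) ^ e * (T / x) ^ e := by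
    rw [← mul_rpow (by positivity) (by positivity), mul_div_assoc]
    gcongr
    norm_num
  unfold errorCoeff
  calc _ = C ^ Fintype.card (InfinitePlace K) * (((2⁻¹ : ℝ) ^ nrComplexPlaces K *
        √(absDiscr K))⁻¹ * absDiscr K ^ (1 + e)) * (3 ^ finrank ℚ K * exp 1 * T / x) ^ e := by ring
    _ ≤ C ^ n * (2 ^ n * absDiscr K ^ (1 / 2 + e)) * ((3 ^ n * exp 1) ^ e * (T / x) ^ e) := by
        gcongr
    _ = _ := by ring

/-- The error term of the smoothed count, up to a constant. -/
noncomputable def errorBound (K : Type*) [Field K] [NumberField K] (n : ℕ) (T x e : ℝ) : ℝ :=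
  absDiscr K ^ (1 / 2 + e) * (T / x) ^ e * T ^ (n * (1 / 2 + e) + 2 * e)

/-- The coefficient of the main term, normalized by the mass of the weight. -/
noncomputable def residueMass (K : Type*) [Field K] [NumberField K] (h : ℝ → ℝ≥0∞) : ℝ≥0∞ :=
  mainMass K h * (torsionOrder K * placeMass K)⁻¹

theorem exists_smoothCount_le (n : ℕ) {e : ℝ} (he : 0 < e) (he' : e ≤ 1 / 4) :
    ∃ C : ℝ, 0 < C ∧ ∀ (K : Type*) [Field K] [NumberField K], finrank ℚ K ≤ n →
      ∀ T x : ℝ, 1 ≤ T → 0 < x →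
      smoothCount K T x ≤
        ENNReal.ofReal x * residueMass K (fun u => ENNReal.ofReal (logStep T u)) +
          ENNReal.ofReal (C * errorBound K n T x e) ∧
      ENNReal.ofReal x * residueMass K (fun u => ENNReal.ofReal (logStep T u)) ≤
        smoothCount K T x + ENNReal.ofReal (C * errorBound K n T x e) := by
  obtain ⟨C, hC, h⟩ := exists_smoothCount_bounds
  obtain ⟨c, hc, hc1, hp⟩ := exists_le_placeMass
  obtain ⟨S, hS, hstep⟩ := exists_stepMass_le n he
  obtain ⟨Z, hZ, hzeta⟩ := exists_idealZeta_le n he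
  refine ⟨C ^ n * 2 ^ n * (3 ^ n * exp 1) ^ e * 8 ^ n * S * Z * (c ^ n)⁻¹, by positivity,
    fun K _ _ hn T x hT hx => ?_⟩
  have hD := absDiscr_pos (K := K)
  have hcard := (card_infinitePlace_le_finrank K).trans hn
  have hp' : ENNReal.ofReal (c ^ n) ≤ placeMass K :=
    le_trans (ENNReal.ofReal_le_ofReal (pow_le_pow_of_le_one hc.le hc1 hcard)) (hp K)
  have hp0 : placeMass K ≠ 0 :=
    ((ENNReal.ofReal_pos.2 (by positivity)).trans_le hp').ne'
  have hw0 : (torsionOrder K : ℝ≥0∞) ≠ 0 := by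
    exact_mod_cast (torsionOrder_pos K).ne'
  have hwt : (torsionOrder K : ℝ≥0∞) ≠ ⊤ := ENNReal.natCast_ne_top _
  have hwp0 : (torsionOrder K * placeMass K : ℝ≥0∞) ≠ 0 := mul_ne_zero hw0 hp0
  have hwpt : (torsionOrder K * placeMass K : ℝ≥0∞) ≠ ⊤ := ENNReal.mul_ne_top hwt placeMass_ne_top
  set E : ℝ≥0∞ := ENNReal.ofReal (errorCoeff K C T x e) *
    ENNReal.ofReal (8 ^ Fintype.card (InfinitePlace K)) * stepMass K T e * idealZeta K e with hE
  have herr : torsionOrder K * E * (torsionOrder K * placeMass K)⁻¹ ≤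
      ENNReal.ofReal (C ^ n * 2 ^ n * (3 ^ n * exp 1) ^ e * 8 ^ n * S * Z * (c ^ n)⁻¹ *
        errorBound K n T x e) := by
    have h1 : torsionOrder K * E * (torsionOrder K * placeMass K)⁻¹ = E * (placeMass K)⁻¹ := by
      rw [ENNReal.mul_inv (Or.inl hw0) (Or.inl hwt)]
      calc _ = (torsionOrder K * (torsionOrder K : ℝ≥0∞)⁻¹) * (E * (placeMass K)⁻¹) := by ring
        _ = _ := by rw [ENNReal.mul_inv_cancel hw0 hwt, one_mul]
    have h2 : (placeMass K)⁻¹ ≤ ENNReal.ofReal (c ^ n)⁻¹ := by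
      rw [ENNReal.ofReal_inv_of_pos (by positivity)]
      exact ENNReal.inv_le_inv.2 hp'
    have h3 : (8 : ℝ) ^ Fintype.card (InfinitePlace K) ≤ 8 ^ n :=
      pow_le_pow_right₀ (by norm_num) hcard
    rw [h1, hE]
    calc _ ≤ ENNReal.ofReal (C ^ n * 2 ^ n * (3 ^ n * exp 1) ^ e *
            (absDiscr K ^ (1 / 2 + e) * (T / x) ^ e)) * ENNReal.ofReal (8 ^ n) *
          ENNReal.ofReal (S * T ^ (n * (1 / 2 + e) + 2 * e)) * ENNReal.ofReal Z *
          ENNReal.ofReal (c ^ n)⁻¹ := by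
          gcongr
          · exact errorCoeff_le hn hC hT hx he
          · exact hstep K hn T hT
          · exact hzeta K hn
      _ = _ := by
          rw [← ENNReal.ofReal_mul (by positivity), ← ENNReal.ofReal_mul (by positivity),
            ← ENNReal.ofReal_mul (by positivity), ← ENNReal.ofReal_mul (by positivity), errorBound]
          congr 1
          ring
  have hS' : torsionOrder K * (smoothCount K T x * placeMass K) * (torsionOrder K * placeMass K)⁻¹ =
      smoothCount K T x := by
    calc _ = smoothCount K T x * ((torsionOrder K * placeMass K) *
        (torsionOrder K * placeMass K)⁻¹) := by ring
      _ = _ := by rw [ENNReal.mul_inv_cancel hwp0 hwpt, mul_one]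
  obtain ⟨hu, hl⟩ := h K T x e hT hx he he'
  constructor
  · have := mul_le_mul_left hu (torsionOrder K * placeMass K)⁻¹
    rw [hS', add_mul, mul_assoc (ENNReal.ofReal x)] at this
    exact this.trans (add_le_add le_rfl herr)
  · have := mul_le_mul_left hl (torsionOrder K * placeMass K)⁻¹
    rw [add_mul, hS', mul_assoc (ENNReal.ofReal x)] at this
    exact this.trans (add_le_add le_rfl herr)

variable {K : Type*} [Field K] [NumberField K]

theorem residueMass_eq (h : ℝ → ℝ≥0∞) :
    residueMass K h = ENat.card (ClassGroup (𝓞 K)) *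
      (ENNReal.ofReal ((2⁻¹ : ℝ) ^ nrComplexPlaces K * √(absDiscr K))⁻¹ * normMass K) *
        (torsionOrder K * placeMass K)⁻¹ * radialMass K h := by
  rw [residueMass, mainMass]
  ring

theorem residueMass_halfLine_le {T : ℝ} (hT : 1 ≤ T) :
    residueMass K halfLineIndicator ≤ residueMass K (fun u => ENNReal.ofReal (logStep T u)) +
      ENNReal.ofReal T⁻¹ * residueMass K halfLineIndicator := by
  simp only [residueMass_eq]
  refine (mul_le_mul_right (radialMass_halfLine_le hT) _).trans (le_of_eq ?_)
  ring

theorem residueMass_logStep_le {T : ℝ} (hT : 1 ≤ T) :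
    residueMass K (fun u => ENNReal.ofReal (logStep T u)) ≤
      ENNReal.ofReal (exp (1 / T)) * residueMass K halfLineIndicator := by
  simp only [residueMass_eq]
  refine (mul_le_mul_right (radialMass_logStep_le hT) _).trans (le_of_eq ?_)
  ring

theorem residueMass_halfLine_le_mul :
    residueMass K halfLineIndicator ≤
      2 * residueMass K (fun u => ENNReal.ofReal (logStep 2 u)) := by
  simp only [residueMass_eq]
  refine (mul_le_mul_right radialMass_halfLine_le_mul _).trans (le_of_eq ?_)
  ring

theorem idealCount_eq_tsum (y : ℝ) : (idealCount K y : ℝ≥0∞) =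
    ∑' J : (Ideal (𝓞 K))⁰, if (Ideal.absNorm (J : Ideal (𝓞 K)) : ℝ) ≤ y then 1 else 0 := by
  have hfin : Finite {I : (Ideal (𝓞 K))⁰ // (Ideal.absNorm (I : Ideal (𝓞 K)) : ℝ) ≤ y} := by
    rcases le_or_gt 0 y with hy | hy
    · simp_rw [← Nat.le_floor_iff hy]
      exact Ideal.finite_setOfPred_absNorm_le₀ ⌊y⌋₊
    · have : IsEmpty {I : (Ideal (𝓞 K))⁰ // (Ideal.absNorm (I : Ideal (𝓞 K)) : ℝ) ≤ y} :=
        ⟨fun I => absurd (I.2.trans_lt hy) (not_lt.2 (Nat.cast_nonneg _))⟩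
      infer_instance
  have := Fintype.ofFinite {I : (Ideal (𝓞 K))⁰ // (Ideal.absNorm (I : Ideal (𝓞 K)) : ℝ) ≤ y}
  have h1 : (idealCount K y : ℝ≥0∞) =
      ∑' _ : {I : (Ideal (𝓞 K))⁰ // (Ideal.absNorm (I : Ideal (𝓞 K)) : ℝ) ≤ y}, 1 := by
    rw [idealCount, Nat.card_eq_fintype_card, tsum_fintype]
    simp
  rw [h1]
  exact tsum_subtype {I : (Ideal (𝓞 K))⁰ | (Ideal.absNorm (I : Ideal (𝓞 K)) : ℝ) ≤ y}
    (fun _ => (1 : ℝ≥0∞))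

theorem absNorm_cast_pos (J : (Ideal (𝓞 K))⁰) : (0 : ℝ) < Ideal.absNorm (J : Ideal (𝓞 K)) :=
  Nat.cast_pos.2 (Nat.pos_of_ne_zero
    (Ideal.absNorm_eq_zero_iff.not.2 (nonZeroDivisors.coe_ne_zero J)))

theorem smoothCount_le_idealCount {T x : ℝ} (hT : 1 ≤ T) (hx : 0 < x) :
    smoothCount K T x ≤ idealCount K (x * exp (1 / T)) := by
  rw [idealCount_eq_tsum, smoothCount]
  refine ENNReal.tsum_le_tsum fun J => ?_
  have hN := absNorm_cast_pos J
  split_ifs with h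
  · rw [← ENNReal.ofReal_one]
    exact ENNReal.ofReal_le_ofReal (logStep_le_one T _)
  · rw [logStep_eq_zero_of_le hT, ENNReal.ofReal_zero]
    have h1 := log_le_log (by positivity) (not_le.1 h).le
    rw [log_mul hx.ne' (exp_ne_zero _), log_exp] at h1
    linarith

theorem idealCount_le_smoothCount {T x : ℝ} (hT : 1 ≤ T) (hx : 0 < x) :
    (idealCount K x : ℝ≥0∞) ≤ smoothCount K T x + idealCount K (x / T) := by
  rw [idealCount_eq_tsum, idealCount_eq_tsum, smoothCount, ← ENNReal.tsum_add]
  refine ENNReal.tsum_le_tsum fun J => ?_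
  have hN := absNorm_cast_pos J
  have hT0 : 0 < T := by linarith
  split_ifs with h h'
  · exact le_add_self
  · rw [logStep_eq_one hT, ENNReal.ofReal_one]
    · exact le_self_add
    · have h1 := log_le_log (by positivity) (not_le.1 h').le
      rw [log_div hx.ne' hT0.ne'] at h1
      linarith
    · linarith [log_le_log hN h]
  · exact zero_le
  · exact zero_le

end ErrorTerm

section Conclusion

open Module Real NumberField Filter Topology
open scoped ENNReal

theorem residueMass_halfLine_ne_top (K : Type*) [Field K] [NumberField K] :
    residueMass K halfLineIndicator ≠ ⊤ := by
  obtain ⟨C, -, h⟩ := exists_smoothCount_le (finrank ℚ K) (e := 1 / 4) (by norm_num) le_rfl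
  have h1 := (h K le_rfl 2 1 (by norm_num) one_pos).2
  rw [ENNReal.ofReal_one, one_mul] at h1
  have h2 : smoothCount K 2 1 ≠ ⊤ :=
    ne_top_of_le_ne_top (ENNReal.natCast_ne_top _)
      (smoothCount_le_idealCount (K := K) (by norm_num : (1 : ℝ) ≤ 2) one_pos)
  have h3 : residueMass K (fun u => ENNReal.ofReal (logStep 2 u)) ≠ ⊤ :=
    ne_top_of_le_ne_top (ENNReal.add_ne_top.2 ⟨h2, ENNReal.ofReal_ne_top⟩) h1
  exact ne_top_of_le_ne_top (ENNReal.mul_ne_top ENNReal.ofNat_ne_top h3) residueMass_halfLine_le_mul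

/-- The coefficient of the main term of the ideal count. -/
noncomputable def idealDensity (K : Type*) [Field K] [NumberField K] : ℝ :=
  (residueMass K halfLineIndicator).toReal

theorem idealDensity_nonneg (K : Type*) [Field K] [NumberField K] : 0 ≤ idealDensity K :=
  ENNReal.toReal_nonneg

theorem ofReal_idealDensity (K : Type*) [Field K] [NumberField K] :
    ENNReal.ofReal (idealDensity K) = residueMass K halfLineIndicator :=
  ENNReal.ofReal_toReal (residueMass_halfLine_ne_top K)

theorem errorBound_nonneg (K : Type*) [Field K] [NumberField K] (n : ℕ) {T x : ℝ} (e : ℝ)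
    (hT : 1 ≤ T) (hx : 0 < x) : 0 ≤ errorBound K n T x e := by
  have := absDiscr_pos (K := K)
  unfold errorBound
  positivity

theorem exists_idealCount_le (n : ℕ) {e : ℝ} (he : 0 < e) :
    ∃ C : ℝ, 0 < C ∧ ∀ (K : Type*) [Field K] [NumberField K], finrank ℚ K ≤ n →
      ∀ y : ℝ, 0 < y → (idealCount K y : ℝ) ≤ C * y ^ (1 + e) := by
  obtain ⟨Z, hZ, hzeta⟩ := exists_idealZeta_le n he
  refine ⟨Z, hZ, fun K _ _ hn y hy => ?_⟩
  have h := (idealCount_le_rankin (K := K) hy he).trans (mul_le_mul_right (hzeta K hn) _)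
  rw [← ENNReal.ofReal_mul (by positivity), ← ENNReal.ofReal_natCast,
    ENNReal.ofReal_le_ofReal_iff (by positivity)] at h
  linarith

theorem exists_idealCount_bounds (n : ℕ) {e : ℝ} (he : 0 < e) (he' : e ≤ 1 / 4) :
    ∃ C : ℝ, 0 < C ∧ ∀ (K : Type*) [Field K] [NumberField K], finrank ℚ K ≤ n →
      ∀ T x : ℝ, 1 ≤ T → 0 < x →
      (idealCount K x : ℝ) ≤ x * (exp (1 / T) * idealDensity K) +
          C * (errorBound K n T x e + (x / T) ^ (1 + e)) ∧
      x * idealDensity K ≤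
        idealCount K (x * exp (1 / T)) + C * errorBound K n T x e + x * (T⁻¹ * idealDensity K) := by
  obtain ⟨C₁, hC₁, h₁⟩ := exists_smoothCount_le n he he'
  obtain ⟨C₂, hC₂, h₂⟩ := exists_idealCount_le n he
  refine ⟨C₁ + C₂, by positivity, fun K _ _ hn T x hT hx => ?_⟩
  have hE := errorBound_nonneg K n e hT hx
  have hρ := idealDensity_nonneg K
  have hT0 : 0 < T := by linarith
  obtain ⟨hu, hl⟩ := h₁ K hn T x hT hx
  constructor
  · have h3 : (idealCount K x : ℝ≥0∞) ≤ ENNReal.ofReal x * (ENNReal.ofReal (exp (1 / T)) *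
        ENNReal.ofReal (idealDensity K)) + ENNReal.ofReal (C₁ * errorBound K n T x e) +
          idealCount K (x / T) := by
      rw [ofReal_idealDensity]
      refine (idealCount_le_smoothCount hT hx).trans (add_le_add (hu.trans ?_) le_rfl)
      gcongr
      exact residueMass_logStep_le hT
    rw [← ENNReal.ofReal_mul (by positivity), ← ENNReal.ofReal_mul (by positivity),
      ← ENNReal.ofReal_natCast, ← ENNReal.ofReal_natCast, ← ENNReal.ofReal_add (by positivity)
      (by positivity), ← ENNReal.ofReal_add (by positivity) (by positivity),
      ENNReal.ofReal_le_ofReal_iff (by positivity)] at h3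
    have h4 := h₂ K hn (x / T) (by positivity)
    have h5 : 0 ≤ C₂ * errorBound K n T x e := by positivity
    have h6 : 0 ≤ C₁ * (x / T) ^ (1 + e) := by positivity
    linarith
  · have h3 : ENNReal.ofReal x * ENNReal.ofReal (idealDensity K) ≤
        idealCount K (x * exp (1 / T)) + ENNReal.ofReal (C₁ * errorBound K n T x e) +
          ENNReal.ofReal x * (ENNReal.ofReal T⁻¹ * ENNReal.ofReal (idealDensity K)) := by
      rw [ofReal_idealDensity]
      refine (mul_le_mul_right (residueMass_halfLine_le hT) _).trans ?_
      rw [mul_add]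
      exact add_le_add (hl.trans (add_le_add (smoothCount_le_idealCount hT hx) le_rfl)) le_rfl
    rw [← ENNReal.ofReal_mul (by positivity), ← ENNReal.ofReal_mul (by positivity),
      ← ENNReal.ofReal_mul (by positivity), ← ENNReal.ofReal_natCast,
      ← ENNReal.ofReal_add (by positivity) (by positivity),
      ← ENNReal.ofReal_add (by positivity) (by positivity),
      ENNReal.ofReal_le_ofReal_iff (by positivity)] at h3
    have h5 : 0 ≤ C₂ * errorBound K n T x e := by positivity
    linarith

/-- The density of the ideals is at most a small power of the discriminant. -/
theorem exists_idealDensity_le (n : ℕ) {e : ℝ} (he : 0 < e) (he' : e ≤ 1 / 4) :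
    ∃ C : ℝ, 0 < C ∧ ∀ (K : Type*) [Field K] [NumberField K], finrank ℚ K ≤ n →
      idealDensity K ≤ C * absDiscr K ^ e := by
  obtain ⟨C₁, hC₁, h₁⟩ := exists_idealCount_bounds n he he'
  obtain ⟨C₂, hC₂, h₂⟩ := exists_idealCount_le n he
  refine ⟨2 * (C₂ * exp (1 / 2) ^ (1 + e) + C₁ * (2 ^ e * 2 ^ (n * (1 / 2 + e) + 2 * e))),
    by positivity, fun K _ _ hn => ?_⟩
  have hD := absDiscr_pos (K := K)
  have hD1 := one_le_absDiscr (K := K)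
  have h3 := (h₁ K hn 2 (absDiscr K) (by norm_num) hD).2
  have h4 := h₂ K hn (absDiscr K * exp (1 / 2)) (by positivity)
  have h5 : (absDiscr K * exp (1 / 2)) ^ (1 + e) =
      absDiscr K * (absDiscr K ^ e * exp (1 / 2) ^ (1 + e)) := by
    rw [mul_rpow hD.le (exp_pos _).le, rpow_add hD, rpow_one]
    ring
  have h6 : errorBound K n 2 (absDiscr K) e ≤
      absDiscr K * (absDiscr K ^ e * (2 ^ e * 2 ^ (n * (1 / 2 + e) + 2 * e))) := by
    have h7 : absDiscr K ^ (1 / 2 + e) * (2 / absDiscr K) ^ e ≤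
        absDiscr K * (absDiscr K ^ e * 2 ^ e) := by
      rw [rpow_add hD, mul_assoc]
      have h8 : absDiscr K ^ (1 / 2 : ℝ) ≤ absDiscr K := by
        simpa using rpow_le_rpow_of_exponent_le hD1 (by norm_num : (1 / 2 : ℝ) ≤ 1)
      have h9 : (2 / absDiscr K) ^ e ≤ 2 ^ e := by
        gcongr
        exact div_le_self (by norm_num) hD1
      gcongr
    unfold errorBound
    calc _ ≤ absDiscr K * (absDiscr K ^ e * 2 ^ e) * 2 ^ (n * (1 / 2 + e) + 2 * e) := by gcongr
      _ = _ := by ring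
  rw [h5] at h4
  refine le_of_mul_le_mul_left ?_ hD
  nlinarith [mul_le_mul_of_nonneg_left h6 hC₁.le]

theorem exists_abs_idealCount_sub_le_of_cutoff (n : ℕ) {e : ℝ} (he : 0 < e) (he' : e ≤ 1 / 4) :
    ∃ C : ℝ, 0 < C ∧ ∀ (K : Type*) [Field K] [NumberField K], finrank ℚ K ≤ n →
      ∀ T x : ℝ, 1 ≤ T → 0 < x →
      |(idealCount K x : ℝ) - idealDensity K * x| ≤
        C * (x / T * absDiscr K ^ e + errorBound K n T x e + (x / T) ^ (1 + e)) := by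
  obtain ⟨C₁, hC₁, h₁⟩ := exists_idealCount_bounds n he he'
  obtain ⟨C₂, hC₂, h₂⟩ := exists_idealDensity_le n he he'
  refine ⟨3 * C₁ + 2 * C₂, by positivity, fun K _ _ hn T x hT hx => ?_⟩
  have hD := absDiscr_pos (K := K)
  have hT0 : 0 < T := by linarith
  have hTi : 1 / T ≤ 1 := by rw [div_le_one hT0]; exact hT
  have hTi0 : 0 < 1 / T := by positivity
  have hρ := idealDensity_nonneg K
  have hρ' := h₂ K hn
  have hE := errorBound_nonneg K n e hT hx
  have hP : 0 ≤ (x / T) ^ (1 + e) := by positivity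
  have hmain : x / T * idealDensity K ≤ C₂ * (x / T * absDiscr K ^ e) := by
    calc _ ≤ x / T * (C₂ * absDiscr K ^ e) := by gcongr
      _ = _ := by ring
  have hQ : 0 ≤ x / T * absDiscr K ^ e := by positivity
  have hexp : exp (1 / T) ≤ 1 + 2 * (1 / T) := by
    have h := abs_exp_sub_one_le (x := 1 / T) (by rwa [abs_of_pos hTi0])
    rw [abs_of_pos hTi0] at h
    linarith [le_abs_self (exp (1 / T) - 1)]
  have hexp' : 1 - 1 / T ≤ exp (-(1 / T)) := by linarith [add_one_le_exp (-(1 / T))]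
  have hxρ : 0 ≤ x * idealDensity K := by positivity
  have hxT : x / T = x * (1 / T) := by ring
  rw [abs_le]
  constructor
  · obtain ⟨-, hl⟩ := h₁ K hn T (x * exp (-(1 / T))) hT (by positivity)
    have hc : x * exp (-(1 / T)) * exp (1 / T) = x := by
      rw [mul_assoc, ← exp_add, neg_add_cancel, exp_zero, mul_one]
    rw [hc] at hl
    have hE' : errorBound K n T (x * exp (-(1 / T))) e ≤ 3 * errorBound K n T x e := by
      have h3 : (T / (x * exp (-(1 / T)))) ^ e ≤ 3 * (T / x) ^ e := by
        have h4 : T / (x * exp (-(1 / T))) = exp (1 / T) * (T / x) := by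
          rw [exp_neg]
          field_simp
        rw [h4, mul_rpow (exp_pos _).le (by positivity), ← exp_mul]
        gcongr
        refine (exp_le_exp.2 (by nlinarith : 1 / T * e ≤ 1)).trans exp_one_lt_three.le
      unfold errorBound
      calc _ ≤ absDiscr K ^ (1 / 2 + e) * (3 * (T / x) ^ e) * T ^ (n * (1 / 2 + e) + 2 * e) := by
            gcongr
        _ = _ := by ring
    have hs : exp (-(1 / T)) ≤ 1 := exp_le_one_iff.2 (by linarith)
    have h5 : x * exp (-(1 / T)) * (T⁻¹ * idealDensity K) ≤ x / T * idealDensity K := by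
      calc _ ≤ x * 1 * (T⁻¹ * idealDensity K) := by gcongr
        _ = _ := by ring
    have h6 : x * (1 - 1 / T) * idealDensity K ≤ x * exp (-(1 / T)) * idealDensity K := by gcongr
    have h7 : x * (1 - 1 / T) * idealDensity K = idealDensity K * x - x / T * idealDensity K := by
      ring
    have h8 := mul_le_mul_of_nonneg_left hE' hC₁.le
    nlinarith [mul_nonneg hC₁.le hP, mul_nonneg hC₂.le hP, mul_nonneg hC₂.le hE,
      mul_nonneg hC₁.le hQ]
  · obtain ⟨hu, -⟩ := h₁ K hn T x hT hx
    have h3 : x * (exp (1 / T) * idealDensity K) ≤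
        idealDensity K * x + 2 * (x / T * idealDensity K) := by
      calc _ ≤ x * ((1 + 2 * (1 / T)) * idealDensity K) := by gcongr
        _ = _ := by ring
    nlinarith [mul_nonneg hC₁.le hP, mul_nonneg hC₂.le hP, mul_nonneg hC₂.le hE,
      mul_nonneg hC₁.le hQ, mul_nonneg hC₁.le hE]

/-- The asymptotic formula for the ideal count, with an unspecified main term. -/
theorem exists_abs_idealCount_sub_le (n : ℕ) {ε : ℝ} (hε : 0 < ε) :
    ∃ C : ℝ, ∀ (K : Type*) [Field K] [NumberField K], finrank ℚ K ≤ n →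
      ∀ x : ℝ, 0 < x → absDiscr K ^ (n + 4) < x ^ (2 * n) →
        |(idealCount K x : ℝ) - idealDensity K * x| ≤
          C * (x ^ (1 - 2 / ((n : ℝ) + 2) + ε) * absDiscr K ^ (1 / ((n : ℝ) + 2) + ε)) := by
  have he : 0 < min (ε / 2) (1 / 4) := lt_min (by positivity) (by norm_num)
  obtain ⟨C, hC, h⟩ := exists_abs_idealCount_sub_le_of_cutoff n he (min_le_right _ _)
  have hε' : 2 * min (ε / 2) (1 / 4) ≤ ε := by linarith [min_le_left (ε / 2) (1 / 4)]
  set e := min (ε / 2) (1 / 4)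
  refine ⟨3 * C, fun K _ _ hn x hx hDx => ?_⟩
  have hD := absDiscr_pos (K := K)
  have hD1 := one_le_absDiscr (K := K)
  have hx1 : 1 ≤ x := by
    by_contra! hlt
    exact absurd (hDx.trans_le (pow_le_one₀ hx.le hlt.le)) (not_lt.2 (one_le_pow₀ hD1))
  have hxD : absDiscr K ≤ x ^ 2 := by
    by_contra! hlt
    have h1 : x ^ (2 * n) ≤ absDiscr K ^ (n + 4) := by
      rw [pow_mul]
      exact (pow_le_pow_left₀ (by positivity) hlt.le n).trans (pow_le_pow_right₀ hD1 (by omega))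
    exact absurd hDx (not_lt.2 h1)
  have hn2 : (0 : ℝ) < n + 2 := by positivity
  set A := x / absDiscr K ^ (1 / 2 : ℝ) with hA
  have hA0 : 0 < A := by positivity
  have hA1 : 1 ≤ A := by
    rw [hA, one_le_div (by positivity), ← sqrt_eq_rpow]
    exact sqrt_le_iff.2 ⟨hx.le, hxD⟩
  have hAx : A ≤ x := div_le_self hx.le (one_le_rpow hD1 (by norm_num))
  set T := A ^ (2 / ((n : ℝ) + 2)) with hTdef
  have hT1 : 1 ≤ T := one_le_rpow hA1 (by positivity)
  have hT0 : 0 < T := by linarith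
  have hTA : T ≤ A := by
    have : 2 / ((n : ℝ) + 2) ≤ 1 := by
      rw [div_le_one hn2]
      linarith [Nat.cast_nonneg (α := ℝ) n]
    simpa using rpow_le_rpow_of_exponent_le hA1 this
  set Y := x ^ (1 - 2 / ((n : ℝ) + 2)) * absDiscr K ^ (1 / ((n : ℝ) + 2)) with hY
  have hY0 : 0 < Y := by positivity
  have hxT : x / T = Y := by
    rw [hTdef, hA, div_rpow hx.le (by positivity), ← rpow_mul hD.le, hY, rpow_sub hx, rpow_one]
    have : 1 / 2 * (2 / ((n : ℝ) + 2)) = 1 / ((n : ℝ) + 2) := by field_simp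
    rw [this]
    field_simp
  have hDT : absDiscr K ^ (1 / 2 : ℝ) * T ^ ((n : ℝ) * (1 / 2)) = Y := by
    have h1 : T ^ ((n : ℝ) * (1 / 2)) * T = A := by
      nth_rewrite 2 [← rpow_one T]
      rw [← rpow_add hT0, hTdef, ← rpow_mul hA0.le]
      convert rpow_one A using 2
      field_simp
    rw [← hxT, eq_div_iff hT0.ne', mul_assoc, h1, hA]
    field_simp
  have hDe : 1 ≤ absDiscr K ^ e := one_le_rpow hD1 he.le
  have hxe : 1 ≤ x ^ (2 * e) := one_le_rpow hx1 (by positivity)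
  set P := x ^ (2 * e) * absDiscr K ^ e with hP
  have b1 : x / T * absDiscr K ^ e ≤ Y * P := by
    rw [hxT, hP]
    gcongr
    exact le_mul_of_one_le_left (by positivity) hxe
  have b2 : errorBound K n T x e ≤ Y * P := by
    have h1 : (T / x) ^ e ≤ 1 :=
      rpow_le_one (by positivity) ((div_le_one hx).2 (hTA.trans hAx)) he.le
    have h2 : T ^ ((n : ℝ) * (1 / 2 + e) + 2 * e) ≤ T ^ ((n : ℝ) * (1 / 2)) * x ^ (2 * e) := by
      have h3 : (n : ℝ) * (1 / 2 + e) + 2 * e = n * (1 / 2) + (n + 2) * e := by ring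
      have h4 : T ^ (((n : ℝ) + 2) * e) = A ^ (2 * e) := by
        rw [hTdef, ← rpow_mul hA0.le]
        congr 1
        field_simp
      rw [h3, rpow_add hT0, h4]
      gcongr
    unfold errorBound
    calc _ ≤ absDiscr K ^ (1 / 2 + e) * 1 * (T ^ ((n : ℝ) * (1 / 2)) * x ^ (2 * e)) := by gcongr
      _ = (absDiscr K ^ (1 / 2 : ℝ) * T ^ ((n : ℝ) * (1 / 2))) * P := by
          rw [rpow_add hD, hP]
          ring
      _ = _ := by rw [hDT]
  have b3 : (x / T) ^ (1 + e) ≤ Y * P := by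
    have h1 : (x / T) ^ e ≤ x ^ (2 * e) :=
      (rpow_le_rpow (by positivity) (div_le_self hx.le hT1) he.le).trans
        (rpow_le_rpow_of_exponent_le hx1 (by linarith))
    rw [rpow_add (by positivity), rpow_one, hP, hxT]
    rw [hxT] at h1
    gcongr
    exact h1.trans (le_mul_of_one_le_right (by positivity) hDe)
  have hPε : P ≤ x ^ ε * absDiscr K ^ ε := by
    rw [hP]
    gcongr
    linarith
  refine (h K hn T x hT1 hx).trans ?_
  calc _ ≤ C * (Y * P + Y * P + Y * P) := by gcongr
    _ = 3 * C * (Y * P) := by ring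
    _ ≤ 3 * C * (Y * (x ^ ε * absDiscr K ^ ε)) := by gcongr
    _ = _ := by
        rw [hY, rpow_add hx, rpow_add hD]
        ring

theorem idealDensity_eq_residue (K : Type*) [Field K] [NumberField K] :
    idealDensity K = dedekindZeta_residue K := by
  set n := finrank ℚ K with hn
  have hn0 : 0 < n := finrank_pos
  have hn2 : (0 : ℝ) < n + 2 := by positivity
  obtain ⟨C, h⟩ := exists_abs_idealCount_sub_le n (ε := 1 / ((n : ℝ) + 2)) (by positivity)
  set B := C * absDiscr K ^ (1 / ((n : ℝ) + 2) + 1 / ((n : ℝ) + 2)) with hB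
  have hlim : Tendsto (fun x : ℝ => (idealCount K x : ℝ) / x) atTop (𝓝 (idealDensity K)) := by
    rw [tendsto_iff_norm_sub_tendsto_zero]
    have h0 : Tendsto (fun x : ℝ => B * x ^ (-(1 / ((n : ℝ) + 2)))) atTop (𝓝 0) := by
      simpa using (tendsto_rpow_neg_atTop (y := 1 / ((n : ℝ) + 2)) (by positivity)).const_mul B
    refine squeeze_zero' (Eventually.of_forall fun x => norm_nonneg _) ?_ h0
    have hlarge : ∀ᶠ x : ℝ in atTop, absDiscr K ^ (n + 4) < x ^ (2 * n) :=
      (tendsto_pow_atTop (by omega)).eventually_gt_atTop _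
    filter_upwards [hlarge, eventually_gt_atTop 0] with x hx hx0
    have h1 := h K le_rfl x hx0 hx
    have h2 : (idealCount K x : ℝ) / x - idealDensity K =
        ((idealCount K x : ℝ) - idealDensity K * x) / x := by
      field_simp
    rw [h2, norm_eq_abs, abs_div, abs_of_pos hx0, div_le_iff₀ hx0]
    refine h1.trans (le_of_eq ?_)
    have h3 : (1 : ℝ) - 2 / ((n : ℝ) + 2) + 1 / ((n : ℝ) + 2) = -(1 / ((n : ℝ) + 2)) + 1 := by
      ring
    rw [h3, rpow_add hx0, rpow_one, hB]
    ring
  exact tendsto_nhds_unique hlim (Ideal.tendsto_norm_le_div_atTop₀ K)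

end Conclusion

theorem mainTheorem2 (n : ℕ) (ε : ℝ) (hε : 0 < ε) :
    ∃ C : ℝ, ∀ (K : Type*) [Field K] [NumberField K], Module.finrank ℚ K ≤ n →
      ∀ x : ℝ, 0 < x → absDiscr K ^ (n + 4) < x ^ (2 * n) →
        |(idealCount K x : ℝ) - NumberField.dedekindZeta_residue K * x| ≤
          C * (x ^ (1 - 2 / ((n : ℝ) + 2) + ε) *
            absDiscr K ^ (1 / ((n : ℝ) + 2) + ε)) := by
  obtain ⟨C, h⟩ := exists_abs_idealCount_sub_le n hε
  refine ⟨C, fun K _ _ hn x hx hDx => ?_⟩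
  rw [← idealDensity_eq_residue]
  exact h K hn x hx hDx
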